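/- Let $n,m\ge 1$ be integers, identify $\mathbb R^n$ with $\mathbb R^n\times\{0\}=\partial\mathbb R^{n+1}_+$, where $\mathbb R^{n+1}_+=\mathbb R^n\times(0,\infty)$, and set $\gamma_n=\Gamma\big(\tfrac{n+1}2\big)/\pi^{(n+1)/2}$. For an open set $\omega\subset\mathbb R^n$ and $v\in L^2_{\rm loc}(\mathbb R^n;\mathbb R^m)$ let $$\mathcal E(v,\omega)=\frac{\gamma_n}4\iint_{\omega\times\omega}\frac{|v(x)-v(y)|^2}{|x-y|^{n+1}}\,dx\,dy+\frac{\gamma_n}2\iint_{\omega\times(\mathbb R^n\setminus\omega)}\frac{|v(x)-v(y)|^2}{|x-y|^{n+1}}\,dx\,dy ,$$ and $\widehat H^{1/2}(\omega;\mathbb R^m)=\{v\in L^2_{\rm loc}(\mathbb R^n;\mathbb R^m):\mathcal E(v,\omega)<\infty\}$. For $x=(x',x_{n+1})\in\mathbb R^{n+1}_+$ let $$v^{\rm e}(x)=\gamma_n\int_{\mathbb R^n}\frac{x_{n+1}\,v(z)}{(|x'-z|^2+x_{n+1}^2)^{\frac{n+1}2}}\,dz .$$ For a bounded open set $\Omega\subset\mathbb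 R^{n+1}_+$ let $\partial^0\Omega=\{x\in\partial\Omega\cap\mathbb R^n: B_r(x)\cap\mathbb R^{n+1}_+\subset\Omega\text{ for some }r>0\}$; $\Omega$ is called admissible if $\partial\Omega$ is Lipschitz, $\partial^0\Omega$ is nonempty and has Lipschitz boundary in $\mathbb R^n$, and $\partial\Omega=(\partial\Omega\cap\mathbb R^{n+1}_+)\cup\overline{\partial^0\Omega}$. Let $\omega\subset\mathbb R^n$ be a bounded open set, let $\Omega\subset\mathbb R^{n+1}_+$ be an admissible bounded open set with $\overline{\partial^0\Omega}\subset\omega$, and let $v\in\widehat H^{1/2}(\omega;\mathbb R^m)$. Then the integral defining $v^{\rm e}$ converges absolutely at every point of $\mathbb R^{n+1}_+$, $v^{\rm e}\in H^1(\Omega;\mathbb R^m)$, and the following hold for every $u\in H^1(\Omega;\mathbb R^m)$ such that $u-v^{\rm e}$ is compactly supported in $\Omega\cup\partial^0\Omega$. Denote by $\bar u:\mathbb R^n\to\mathbb R^m$ the trace of $u$ on $\partial^0\Omega$, extended by $v$ on $\mathbb R^n\setminus\partial^0\Omega$. (i) The trace exists, $\bar u\in\widehat H^{1/2}(\omega;\mathbb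 R^m)$, and $$\frac12\int_\Omega|\nabla u|^2\,dx-\frac12\int_\Omega|\nabla v^{\rm e}|^2\,dx\ \ge\ \mathcal E(\bar u,\omega)-\mathcal E(v,\omega).$$ (ii) (Local minimality of the extension.) If the trace of $u$ on $\partial^0\Omega$ equals $v$ a.e., then $\int_\Omega|\nabla v^{\rm e}|^2\,dx\le\int_\Omega|\nabla u|^2\,dx$. (iii) (Transfer of minimality.) Let $\mathcal C$ be any class of functions $\mathbb R^n\to\mathbb R^m$ and $F$ any real-valued functional of functions $\mathbb R^n\to\mathbb R^m$. If $\mathcal E(v,\omega)+F(v)\le\mathcal E(w,\omega)+F(w)$ for all $w\in\mathcal C\cap\widehat H^{1/2}(\omega;\mathbb R^m)$ such that $w-v$ is compactly supported in $\omega$, and if $\bar u\in\mathcal C$ (for some representative, which is then used below), then $$\frac12\int_\Omega|\nabla v^{\rm e}|^2\,dx+F(v)\ \le\ \frac12\int_\Omega|\nabla u|^2\,dx+F(\bar u).$$ -/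

import Mathlib

open MeasureTheory Filter Topology Set
open scoped ENNReal ContDiff

noncomputable section

namespace HalfLap

/-- The Euclidean space of dimension `d`. -/
abbrev Euc (d : ℕ) : Type := EuclideanSpace ℝ (Fin d)

/-! ### The half-space and its boundary -/

/-- The last coordinate of a point of the space of dimension `n + 1`. -/
def height {n : ℕ} (x : Euc (n + 1)) : ℝ := x (Fin.last n)

/-- The first `n` coordinates of a point of the space of dimension `n + 1`. -/
def horiz {n : ℕ} (x : Euc (n + 1)) : Euc n :=
  WithLp.toLp 2 (fun i : Fin n => x i.castSucc)

/-- The identification of the space of dimension `n` with the hyperplane of height zero. -/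
def incl {n : ℕ} (x : Euc n) : Euc (n + 1) :=
  WithLp.toLp 2 (Fin.snoc (α := fun _ => ℝ) (fun i : Fin n => x i) 0)

/-- The open upper half-space. -/
def upperHalf (n : ℕ) : Set (Euc (n + 1)) := {x | 0 < height x}

/-- The flat part of the boundary, seen as a subset of the space of dimension `n`: the boundary
points of height zero around which a small half-ball is contained in `Ω`. -/
def flatBdry {n : ℕ} (Ω : Set (Euc (n + 1))) : Set (Euc n) :=
  {x | incl x ∈ frontier Ω ∧ ∃ r : ℝ, 0 < r ∧ Metric.ball (incl x) r ∩ upperHalf n ⊆ Ω}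

/-- `U` has Lipschitz boundary: near each boundary point, `U` is the strict epigraph of a Lipschitz
function in the direction of some unit vector `e`. The function is evaluated at the orthogonal
projection of the point on the hyperplane orthogonal to `e`. -/
def HasLipschitzBoundary {d : ℕ} (U : Set (Euc d)) : Prop :=
  ∀ p ∈ frontier U, ∃ (e : Euc d) (r : ℝ) (K : NNReal) (g : Euc d → ℝ),
    ‖e‖ = 1 ∧ 0 < r ∧ LipschitzWith K g ∧
    ∀ x ∈ Metric.ball p r, x ∈ U ↔ g (x - (inner ℝ e x) • e) < inner ℝ e x

/-- Admissible bounded open subsets of the half-space. -/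
structure IsAdmissible {n : ℕ} (Ω : Set (Euc (n + 1))) : Prop where
  isOpen : IsOpen Ω
  isBounded : Bornology.IsBounded Ω
  subset_upperHalf : Ω ⊆ upperHalf n
  lipschitz : HasLipschitzBoundary Ω
  flat_nonempty : (flatBdry Ω).Nonempty
  flat_lipschitz : HasLipschitzBoundary (flatBdry Ω)
  frontier_eq : frontier Ω = (frontier Ω ∩ upperHalf n) ∪ incl '' closure (flatBdry Ω)

/-! ### The fractional energy and its energy space -/

/-- The normalizing constant `Γ((n+1)/2) / π^((n+1)/2)`. -/
def gammaConst (n : ℕ) : ℝ :=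
  Real.Gamma (((n : ℝ) + 1) / 2) / Real.pi ^ (((n : ℝ) + 1) / 2)

/-- The double integral of `|v(x) - v(y)|² / |x - y|^(n+1)` over `A × B`. -/
def gagliardo {n m : ℕ} (v : Euc n → Euc m) (A B : Set (Euc n)) : ℝ≥0∞ :=
  ∫⁻ x in A, ∫⁻ y in B, ENNReal.ofReal (‖v x - v y‖ ^ 2 / ‖x - y‖ ^ (n + 1))

/-- The 1/2-Dirichlet energy of `v` in `W`, possibly infinite. -/
def fracEnergy {n m : ℕ} (v : Euc n → Euc m) (W : Set (Euc n)) : ℝ≥0∞ :=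
  ENNReal.ofReal (gammaConst n / 4) * gagliardo v W W +
    ENNReal.ofReal (gammaConst n / 2) * gagliardo v W Wᶜ

/-- Locally square integrable functions on the whole space with finite 1/2-Dirichlet energy
in `W`. -/
def MemHhat {n m : ℕ} (W : Set (Euc n)) (v : Euc n → Euc m) : Prop :=
  (∀ K : Set (Euc n), IsCompact K → MemLp v 2 (volume.restrict K)) ∧ fracEnergy v W < ⊤

/-! ### The harmonic extension -/

/-- The Poisson kernel `γ x_{n+1} / (|x' - z|² + x_{n+1}²)^((n+1)/2)` of the half-space. -/
def poissonKernel {n : ℕ} (x : Euc (n + 1)) (z : Euc n) : ℝ :=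
  gammaConst n * (height x / (‖horiz x - z‖ ^ 2 + height x ^ 2) ^ (((n : ℝ) + 1) / 2))

/-- The harmonic extension of `v` to the half-space (relevant at points of positive height). -/
def harmExt {n m : ℕ} (v : Euc n → Euc m) (x : Euc (n + 1)) : Euc m :=
  ∫ z, poissonKernel x z • v z

/-! ### The Sobolev space `H¹`, Dirichlet energy and traces -/

/-- The `i`-th partial derivative of a function. -/
def partialDeriv {d : ℕ} {F : Type*} [NormedAddCommGroup F] [NormedSpace ℝ F]
    (i : Fin d) (f : Euc d → F) (x : Euc d) : F :=
  fderiv ℝ f x (EuclideanSpace.single i 1)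

/-- `G` is a weak gradient of `u` in `Ω`; `G x i` is the `i`-th partial derivative at `x`. -/
def IsWeakGrad {d m : ℕ} (Ω : Set (Euc d)) (u : Euc d → Euc m)
    (G : Euc d → Fin d → Euc m) : Prop :=
  ∀ φ : Euc d → ℝ, ContDiff ℝ ∞ φ → HasCompactSupport φ → tsupport φ ⊆ Ω →
    ∀ i : Fin d, ∫ x in Ω, partialDeriv i φ x • u x = - ∫ x in Ω, φ x • G x i

/-- The Sobolev space of square integrable maps on `Ω` with square integrable weak gradient. -/
def MemH1 {d m : ℕ} (Ω : Set (Euc d)) (u : Euc d → Euc m) : Prop :=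
  MemLp u 2 (volume.restrict Ω) ∧
    ∃ G : Euc d → Fin d → Euc m,
      (∀ i, MemLp (fun x => G x i) 2 (volume.restrict Ω)) ∧ IsWeakGrad Ω u G

open Classical in
/-- The weak gradient of a map in `H¹(Ω)` (unique almost everywhere in `Ω`). -/
def weakGrad {d m : ℕ} (Ω : Set (Euc d)) (u : Euc d → Euc m) : Euc d → Fin d → Euc m :=
  if h : MemH1 Ω u then h.2.choose else 0

/-- The Dirichlet energy: one half of the integral over `Ω` of `|∇u|²`. -/
def dirichletEnergy {d m : ℕ} (Ω : Set (Euc d)) (u : Euc d → Euc m) : ℝ :=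
  (1 / 2) * ∫ x in Ω, ∑ i, ‖weakGrad Ω u x i‖ ^ 2

/-- `w` is the trace on the flat part of the boundary of the map `u` of class `H¹(Ω)`: some
sequence of maps that are smooth up to the boundary converges to `u` in `H¹(Ω)`, while its
restrictions to the flat part converge to `w` in `L²`. -/
def IsFlatTrace {n m : ℕ} (Ω : Set (Euc (n + 1))) (u : Euc (n + 1) → Euc m)
    (w : Euc n → Euc m) : Prop :=
  MemH1 Ω u ∧ MemLp w 2 (volume.restrict (flatBdry Ω)) ∧
    ∃ U : ℕ → Euc (n + 1) → Euc m, (∀ k, ContDiff ℝ ∞ (U k)) ∧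
      Tendsto (fun k => eLpNorm (fun x => U k x - u x) 2 (volume.restrict Ω)) atTop (𝓝 0) ∧
      (∀ i, Tendsto (fun k => eLpNorm (fun x => partialDeriv i (U k) x - weakGrad Ω u x i) 2
        (volume.restrict Ω)) atTop (𝓝 0)) ∧
      Tendsto (fun k => eLpNorm (fun x => U k (incl x) - w x) 2
        (volume.restrict (flatBdry Ω))) atTop (𝓝 0)

/-- `w` is the trace of `u` on the flat part of the boundary, extended by `v` outside it. -/
def IsExtendedTrace {n m : ℕ} (Ω : Set (Euc (n + 1))) (v : Euc n → Euc m)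
    (u : Euc (n + 1) → Euc m) (w : Euc n → Euc m) : Prop :=
  IsFlatTrace Ω u w ∧ ∀ᵐ x, x ∉ flatBdry Ω → w x = v x

/-- The difference of two maps defined on `Ω` is compactly supported in the union of `Ω` and the
flat part of its boundary. -/
def CompactDiffUpToFlat {n m : ℕ} (Ω : Set (Euc (n + 1))) (u₁ u₂ : Euc (n + 1) → Euc m) : Prop :=
  ∃ K : Set (Euc (n + 1)), IsCompact K ∧ K ⊆ Ω ∪ incl '' flatBdry Ω ∧
    ∀ᵐ x, x ∈ Ω → x ∉ K → u₁ x = u₂ x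

/-- The difference of two maps is compactly supported in `W`. -/
def CompactDiffIn {n m : ℕ} (W : Set (Euc n)) (w₁ w₂ : Euc n → Euc m) : Prop :=
  ∃ K : Set (Euc n), IsCompact K ∧ K ⊆ W ∧ ∀ᵐ x, x ∉ K → w₁ x = w₂ x

end HalfLap

end

/-!
Write `vᵉ` for the harmonic extension of `v`, `Q η` for the integral of `|η x - η y|²/|x - y|^(n+1)`
over pairs of points, and `γ` for `gammaConst n`. The fractional energy in `W` is `γ/4` times the
same integral over the pairs that touch `W` (`fracEnergy_eq`), so that it is a quadratic form in `v`
like the Dirichlet energy. The energy inequality compares the two forms along perturbations of `v`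
and of `vᵉ`.

*The extension.* Finite interaction energy of one point with the whole space bounds the growth of
`v` at infinity (`integrable_wt_smul`), and then the Poisson integral and its derivatives converge
absolutely. The integral `harmGrad` of the differentiated kernel against `v` is the weak gradient of
`vᵉ` (`isWeakGrad_harmExt`). Since the derivatives of the kernel have mean zero on horizontal
hyperplanes, a Cauchy-Schwarz estimate with a suitable splitting of the kernel bounds the Dirichlet
energy above a set by the interaction energy of this set with the whole space
(`exists_lintegral_harmGrad_le`). Hence `vᵉ` and its gradient are square integrable on bounded sets
whose closure meets the hyperplane only inside `W` (`memLp_harmExt`, `memLp_harmGrad`).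

*First variation.* For a test map `φ` with compact support in the closed half-space, whose boundary
values `η` are supported in `W`, the pairing of `∇φ` and `∇vᵉ` equals `γ/2` times the pairing of the
differences of `η` and of `v` (`integral_inner_harmGrad`). Green's formula for the Poisson kernel
above the height `t` leaves a boundary integral with the vertical derivative of the kernel; this
derivative is even and has mean zero, so the integral can be symmetrized into one over pairs of
points (`neg_integral_inner_harmGrad_last`). As `t → 0`, the derivative tends to `γ/|x - y|^(n+1)`
under a domination.

*Second variation.* Applied to smooth `η` and to truncations of `ηᵉ` as test maps, the same identity
shows that the Dirichlet energy of `ηᵉ` is `γ/2 * Q η` (`sum_integral_harmGrad_eq`). Applied to `η`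
and an arbitrary `φ` with boundary values `η`, it shows that `γ/2 * Q η` is the pairing of `∇φ` with
`∇ηᵉ`, and Young's inequality gives the sharp trace inequality: `γ/2 * Q η` is at most the integral
of `|∇φ|²` (`integral_pairDiff_sq_le`).

*Conclusion.* Expanding both squares, the change of the fractional energy from `v` to `v + η` is at
most the change of the Dirichlet energy from `vᵉ` to `vᵉ + φ` (`lintegral_pairDiff_add_le`). A
competitor `u` is reduced to this case by approximation: `u - vᵉ`, extended by zero, is an `H¹` map
of the half-space, which a downward translation and mollification approximate by smooth maps with
support near that of `u - vᵉ` (`exists_isHalfApprox_sub`). Their boundary values converge by the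
elementary trace inequality, which produces the trace of `u`, and the inequality passes to the limit
by Fatou's lemma (`exists_extendedTrace`). The trace is unique almost everywhere
(`IsFlatTrace.ae_eq`), so the inequality holds for every representative. Local minimality is the case
where the fractional energies cancel, and the transfer of minimality adds the energy inequality to
the minimality of `v`.
-/


/-! ### Coordinates on the half-space -/

namespace HalfLap

/-- The point of the space of dimension `n + 1` with horizontal part `x` and height `t`. -/
def join {n : ℕ} (x : Euc n) (t : ℝ) : Euc (n + 1) :=
  WithLp.toLp 2 (Fin.snoc (α := fun _ => ℝ) (fun i : Fin n => x i) t)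

section Coordinates

variable {n : ℕ}

@[simp] theorem height_join (x : Euc n) (t : ℝ) : height (join x t) = t := by
  simp [height, join]

@[simp] theorem horiz_join (x : Euc n) (t : ℝ) : horiz (join x t) = x := by
  ext i; simp [horiz, join]

@[simp] theorem join_horiz_height (X : Euc (n + 1)) : join (horiz X) (height X) = X := by
  ext i
  refine Fin.lastCases ?_ (fun j => ?_) i
  · simp [height, join]
  · simp [horiz, join]

theorem incl_eq_join (x : Euc n) : incl x = join x 0 := rfl

theorem norm_sq_eq (X : Euc (n + 1)) : ‖X‖ ^ 2 = ‖horiz X‖ ^ 2 + height X ^ 2 := by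
  simp [EuclideanSpace.norm_sq_eq, Fin.sum_univ_castSucc, horiz, height]

theorem continuous_height : Continuous (height : Euc (n + 1) → ℝ) := by
  unfold height; fun_prop

theorem continuous_horiz : Continuous (horiz : Euc (n + 1) → Euc n) := by
  unfold horiz; fun_prop

theorem join_add (x y : Euc n) (s t : ℝ) : join (x + y) (s + t) = join x s + join y t := by
  ext i
  refine Fin.lastCases ?_ (fun j => ?_) i <;> simp [join]

theorem join_sub (x y : Euc n) (s t : ℝ) : join (x - y) (s - t) = join x s - join y t := by
  ext i
  refine Fin.lastCases ?_ (fun j => ?_) i <;> simp [join]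

theorem join_smul (c : ℝ) (x : Euc n) (t : ℝ) : join (c • x) (c * t) = c • join x t := by
  ext i
  refine Fin.lastCases ?_ (fun j => ?_) i <;> simp [join]

theorem norm_sq_join (x : Euc n) (t : ℝ) : ‖join x t‖ ^ 2 = ‖x‖ ^ 2 + t ^ 2 := by
  simp [norm_sq_eq]

/-- The splitting of the space of dimension `n + 1` in horizontal part and height. -/
noncomputable def joinL : (Euc n × ℝ) →L[ℝ] Euc (n + 1) :=
  LinearMap.toContinuousLinearMap
    { toFun := fun p => join p.1 p.2
      map_add' := fun p q => join_add p.1 q.1 p.2 q.2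
      map_smul' := fun c p => join_smul c p.1 p.2 }

theorem contDiff_join {k : WithTop ℕ∞} :
    ContDiff ℝ k (fun p : Euc n × ℝ => join p.1 p.2) := (joinL (n := n)).contDiff

theorem continuous_join : Continuous (fun p : Euc n × ℝ => join p.1 p.2) :=
  (joinL (n := n)).continuous

theorem continuous_incl : Continuous (incl : Euc n → Euc (n + 1)) :=
  continuous_join.comp (by fun_prop : Continuous fun x : Euc n => (x, (0 : ℝ)))

theorem norm_incl (x : Euc n) : ‖incl x‖ = ‖x‖ := by
  have := norm_sq_join x 0
  rw [← incl_eq_join] at this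
  have h : ‖incl x‖ ^ 2 = ‖x‖ ^ 2 := by simpa using this
  exact (pow_left_inj₀ (norm_nonneg _) (norm_nonneg _) two_ne_zero).1 h

@[simp] theorem height_incl (x : Euc n) : height (incl x) = 0 := height_join x 0
@[simp] theorem horiz_incl (x : Euc n) : horiz (incl x) = x := horiz_join x 0

theorem norm_horiz_le (X : Euc (n + 1)) : ‖horiz X‖ ≤ ‖X‖ := by
  have := norm_sq_eq X
  apply le_of_sq_le_sq _ (norm_nonneg X)
  nlinarith [sq_nonneg (height X)]

theorem abs_height_le (X : Euc (n + 1)) : |height X| ≤ ‖X‖ := by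
  have := norm_sq_eq X
  apply abs_le_of_sq_le_sq _ (norm_nonneg X)
  nlinarith [sq_nonneg ‖horiz X‖]

theorem height_sub (X Y : Euc (n + 1)) : height (X - Y) = height X - height Y := by
  simp [height]

theorem horiz_sub (X Y : Euc (n + 1)) : horiz (X - Y) = horiz X - horiz Y := by
  ext i; simp [horiz]

/-- The homeomorphism splitting a point into its horizontal part and its height. -/
def joinHomeo (n : ℕ) : (Euc n × ℝ) ≃ₜ Euc (n + 1) where
  toFun p := join p.1 p.2
  invFun X := (horiz X, height X)
  left_inv p := by simp
  right_inv X := by simp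
  continuous_toFun := continuous_join
  continuous_invFun := continuous_horiz.prodMk continuous_height

theorem measurePreserving_join (n : ℕ) :
    MeasurePreserving (joinHomeo n) (volume.prod volume) volume := by
  have h1 := (PiLp.volume_preserving_ofLp (Fin n)).prod (MeasurePreserving.id (volume : Measure ℝ))
  have h2 := Measure.measurePreserving_swap (μ := (volume : Measure (Fin n → ℝ)))
    (ν := (volume : Measure ℝ))
  have h3 := (volume_preserving_piFinSuccAbove (fun _ : Fin (n + 1) => ℝ) (Fin.last n)).symm
  have h4 := PiLp.volume_preserving_toLp (Fin (n + 1))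
  have e : ⇑(joinHomeo n) = WithLp.toLp 2 ∘
      (MeasurableEquiv.piFinSuccAbove (fun _ : Fin (n + 1) => ℝ) (Fin.last n)).symm ∘
        Prod.swap ∘ Prod.map WithLp.ofLp id := by
    funext p
    ext i
    simp only [joinHomeo, join, Homeomorph.homeomorph_mk_coe, Equiv.coe_fn_mk, Function.comp,
      Prod.map, Prod.swap, MeasurableEquiv.piFinSuccAbove_symm_apply]
    refine Fin.lastCases ?_ (fun j => ?_) i
    · simp [Fin.insertNthEquiv]
    · simp [Fin.insertNthEquiv]
  rw [e]
  exact h4.comp (h3.comp (h2.comp h1))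

theorem measurableEmbedding_join (n : ℕ) : MeasurableEmbedding (joinHomeo n) :=
  (joinHomeo n).measurableEmbedding

theorem lintegral_join {f : Euc (n + 1) → ℝ≥0∞} (hf : AEMeasurable f) :
    ∫⁻ X, f X = ∫⁻ t, ∫⁻ x, f (join x t) := by
  rw [← (measurePreserving_join n).lintegral_comp_emb (measurableEmbedding_join n)]
  have : AEMeasurable (fun p => f (joinHomeo n p)) (volume.prod volume) :=
    hf.comp_quasiMeasurePreserving (measurePreserving_join n).quasiMeasurePreserving
  rw [lintegral_prod_symm _ this]
  rfl

theorem integral_join {E : Type*} [NormedAddCommGroup E] [NormedSpace ℝ E]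
    {f : Euc (n + 1) → E} (hf : Integrable f) :
    ∫ X, f X = ∫ t, ∫ x, f (join x t) := by
  rw [← (measurePreserving_join n).integral_comp (measurableEmbedding_join n)]
  have : Integrable (fun p => f (joinHomeo n p)) (volume.prod volume) :=
    (measurePreserving_join n).integrable_comp_of_integrable hf
  rw [integral_prod_symm _ this]
  rfl

theorem integral_join' {E : Type*} [NormedAddCommGroup E] [NormedSpace ℝ E]
    {f : Euc (n + 1) → E} (hf : Integrable f) :
    ∫ X, f X = ∫ x, ∫ t, f (join x t) := by
  rw [← (measurePreserving_join n).integral_comp (measurableEmbedding_join n)]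
  have : Integrable (fun p => f (joinHomeo n p)) (volume.prod volume) :=
    (measurePreserving_join n).integrable_comp_of_integrable hf
  rw [integral_prod _ this]
  rfl

theorem isOpen_upperHalf : IsOpen (upperHalf n) := isOpen_lt continuous_const continuous_height

theorem measurableSet_upperHalf : MeasurableSet (upperHalf n) := isOpen_upperHalf.measurableSet

end Coordinates

/-! ### The Cauchy-Schwarz and Jensen inequalities -/

theorem sq_lintegral_mul_le {α : Type*} [MeasurableSpace α] {μ : Measure α} {f g : α → ℝ≥0∞}
    (hf : AEMeasurable f μ) (hg : AEMeasurable g μ) :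
    (∫⁻ x, f x * g x ∂μ) ^ 2 ≤ (∫⁻ x, f x ^ 2 ∂μ) * ∫⁻ x, g x ^ 2 ∂μ := by
  have h := ENNReal.lintegral_mul_le_Lp_mul_Lq μ Real.HolderConjugate.two_two hf hg
  have h2 := pow_le_pow_left' h 2
  refine h2.trans_eq ?_
  rw [mul_pow, ← ENNReal.rpow_natCast, ← ENNReal.rpow_natCast (_ ^ (1 / 2 : ℝ)),
    ← ENNReal.rpow_mul, ← ENNReal.rpow_mul]
  simp

/-- Cauchy-Schwarz for an integral weighted by a nonnegative function. -/
theorem sq_lintegral_weight_mul_le {α : Type*} [MeasurableSpace α] {μ : Measure α}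
    {w g : α → ℝ≥0∞} (hw : AEMeasurable w μ) (hg : AEMeasurable g μ) :
    (∫⁻ x, w x * g x ∂μ) ^ 2 ≤ (∫⁻ x, w x ∂μ) * ∫⁻ x, w x * g x ^ 2 ∂μ := by
  have h := sq_lintegral_mul_le (μ := μ) (hw.pow_const (1 / 2 : ℝ))
    ((hw.pow_const (1 / 2 : ℝ)).mul hg)
  have e : ∀ x, (w x ^ (1 / 2 : ℝ)) ^ 2 = w x := fun x => by
    rw [← ENNReal.rpow_natCast, ← ENNReal.rpow_mul]; simp
  simp only [Pi.mul_apply, mul_pow, e] at h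
  convert h using 4 with x
  rw [← mul_assoc, ← sq, e]

/-- Jensen's inequality for the square of the norm of an average. -/
theorem enorm_integral_smul_sq_le {α E : Type*} [MeasurableSpace α] {μ : Measure α}
    [NormedAddCommGroup E] [NormedSpace ℝ E] {w : α → ℝ} {g : α → E}
    (hw : AEMeasurable w μ) (hg : AEStronglyMeasurable g μ) (hw1 : ∫⁻ x, ‖w x‖ₑ ∂μ ≤ 1) :
    ‖∫ x, w x • g x ∂μ‖ₑ ^ 2 ≤ ∫⁻ x, ‖w x‖ₑ * ‖g x‖ₑ ^ 2 ∂μ := by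
  calc ‖∫ x, w x • g x ∂μ‖ₑ ^ 2 ≤ (∫⁻ x, ‖w x • g x‖ₑ ∂μ) ^ 2 :=
        pow_le_pow_left' (enorm_integral_le_lintegral_enorm _) 2
    _ = (∫⁻ x, ‖w x‖ₑ * ‖g x‖ₑ ∂μ) ^ 2 := by simp only [enorm_smul]
    _ ≤ _ := sq_lintegral_weight_mul_le hw.enorm hg.enorm
    _ ≤ 1 * _ := by gcongr
    _ = _ := one_mul _

theorem eLpNorm_two_sq {α E : Type*} [MeasurableSpace α] {μ : Measure α}
    [NormedAddCommGroup E] (f : α → E) : eLpNorm f 2 μ ^ 2 = ∫⁻ x, ‖f x‖ₑ ^ 2 ∂μ := by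
  rw [eLpNorm_eq_lintegral_rpow_enorm_toReal (by simp) (by simp), ← ENNReal.rpow_natCast,
    ← ENNReal.rpow_mul]
  simp

end HalfLap

/-! ### The Poisson kernel -/

namespace HalfLap

section Kernel

variable {n : ℕ}

theorem gammaConst_pos (n : ℕ) : 0 < gammaConst n := by
  unfold gammaConst
  have : 0 < Real.Gamma (((n : ℝ) + 1) / 2) := Real.Gamma_pos_of_pos (by positivity)
  positivity

/-- The Poisson kernel as a function on the space of dimension `n + 1`, singular at the origin. -/
noncomputable def pker (Y : Euc (n + 1)) : ℝ :=
  gammaConst n * (height Y * (‖Y‖ ^ 2) ^ (-(((n : ℝ) + 1) / 2)))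

/-- The `i`-th partial derivative of `pker` away from the origin. -/
noncomputable def dpker (i : Fin (n + 1)) (Y : Euc (n + 1)) : ℝ :=
  gammaConst n * ((if i = Fin.last n then 1 else 0) * (‖Y‖ ^ 2) ^ (-(((n : ℝ) + 1) / 2)) -
    (n + 1) * (height Y * Y i * (‖Y‖ ^ 2) ^ (-(((n : ℝ) + 1) / 2) - 1)))

/-- The second partial derivative of `pker` in the `i`-th direction away from the origin. -/
noncomputable def ddpker (i : Fin (n + 1)) (Y : Euc (n + 1)) : ℝ :=
  gammaConst n * ((if i = Fin.last n then 1 else 0) * (-(n + 1) * Y i *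
      (‖Y‖ ^ 2) ^ (-(((n : ℝ) + 1) / 2) - 1)) -
    (n + 1) * ((if i = Fin.last n then 1 else 0) * Y i * (‖Y‖ ^ 2) ^ (-(((n : ℝ) + 1) / 2) - 1) +
      height Y * (‖Y‖ ^ 2) ^ (-(((n : ℝ) + 1) / 2) - 1) -
      (n + 3) * height Y * Y i ^ 2 * (‖Y‖ ^ 2) ^ (-(((n : ℝ) + 1) / 2) - 1 - 1)))

theorem norm_sq_sub_incl (X : Euc (n + 1)) (z : Euc n) :
    ‖X - incl z‖ ^ 2 = ‖horiz X - z‖ ^ 2 + height X ^ 2 := by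
  simp [norm_sq_eq, horiz_sub, height_sub]

theorem poissonKernel_eq (X : Euc (n + 1)) (z : Euc n) :
    poissonKernel X z = pker (X - incl z) := by
  rw [poissonKernel, pker, norm_sq_sub_incl, height_sub, height_incl, sub_zero,
    Real.rpow_neg (by positivity), div_eq_mul_inv]

theorem hasFDerivAt_normSq_rpow (s : ℝ) {Y : Euc (n + 1)} (hY : Y ≠ 0) :
    HasFDerivAt (fun Z : Euc (n + 1) => (‖Z‖ ^ 2) ^ s)
      ((s * (‖Y‖ ^ 2) ^ (s - 1)) • (2 • innerSL ℝ Y)) Y := by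
  have h := (hasStrictFDerivAt_norm_sq Y).hasFDerivAt
  exact h.rpow_const (Or.inl (by positivity))

theorem hasFDerivAt_coord (i : Fin (n + 1)) (Y : Euc (n + 1)) :
    HasFDerivAt (fun Z : Euc (n + 1) => Z i)
      (EuclideanSpace.proj i : EuclideanSpace ℝ (Fin (n + 1)) →L[ℝ] ℝ) Y :=
  (EuclideanSpace.proj i : EuclideanSpace ℝ (Fin (n + 1)) →L[ℝ] ℝ).hasFDerivAt

theorem hasLineDerivAt_pker (i : Fin (n + 1)) {Y : Euc (n + 1)} (hY : Y ≠ 0) :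
    HasLineDerivAt ℝ pker (dpker i Y) Y (EuclideanSpace.single i 1) := by
  have h := (((hasFDerivAt_coord (Fin.last n) Y).mul
    (hasFDerivAt_normSq_rpow (-(((n : ℝ) + 1) / 2)) hY)).const_mul (gammaConst n)).hasLineDerivAt
      (EuclideanSpace.single i 1)
  refine HasDerivAt.congr_deriv
    (show HasDerivAt (fun t : ℝ => pker (Y + t • EuclideanSpace.single i 1)) _ 0 from h) ?_
  by_cases hi : i = Fin.last n
  · subst hi
    simp [dpker, height, EuclideanSpace.inner_single_right]
    ring
  · have hi' : Fin.last n ≠ i := Ne.symm hi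
    simp [dpker, height, EuclideanSpace.inner_single_right, hi, hi']
    exact Or.inl (by ring)

theorem hasLineDerivAt_dpker (i : Fin (n + 1)) {Y : Euc (n + 1)} (hY : Y ≠ 0) :
    HasLineDerivAt ℝ (dpker i) (ddpker i Y) Y (EuclideanSpace.single i 1) := by
  have h := ((((hasFDerivAt_normSq_rpow (-(((n : ℝ) + 1) / 2)) hY).const_mul
    (if i = Fin.last n then (1 : ℝ) else 0)).sub
    ((((hasFDerivAt_coord (Fin.last n) Y).mul (hasFDerivAt_coord i Y)).mul
      (hasFDerivAt_normSq_rpow (-(((n : ℝ) + 1) / 2) - 1) hY)).const_mul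
        ((n : ℝ) + 1))).const_mul (gammaConst n)).hasLineDerivAt
      (EuclideanSpace.single i 1)
  refine HasDerivAt.congr_deriv
    (show HasDerivAt (fun t : ℝ => dpker i (Y + t • EuclideanSpace.single i 1)) _ 0 from h) ?_
  by_cases hi : i = Fin.last n
  · subst hi
    simp [ddpker, height, EuclideanSpace.inner_single_right]
    exact Or.inl (by ring)
  · have hi' : Fin.last n ≠ i := Ne.symm hi
    simp [ddpker, height, EuclideanSpace.inner_single_right, hi, hi']
    ring

/-- The Poisson kernel is harmonic away from the origin. -/
theorem sum_ddpker {Y : Euc (n + 1)} (hY : Y ≠ 0) : ∑ i, ddpker i Y = 0 := by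
  have hN : 0 < ‖Y‖ ^ 2 := by positivity
  have hs : ∑ i, Y i ^ 2 = ‖Y‖ ^ 2 := by
    rw [EuclideanSpace.norm_sq_eq]; simp
  have e : (‖Y‖ ^ 2) ^ (-(((n : ℝ) + 1) / 2) - 1) =
      ‖Y‖ ^ 2 * (‖Y‖ ^ 2) ^ (-(((n : ℝ) + 1) / 2) - 1 - 1) := by
    rw [Real.rpow_sub_one hN.ne' (-(((n : ℝ) + 1) / 2) - 1)]
    field_simp
  set A := (‖Y‖ ^ 2) ^ (-(((n : ℝ) + 1) / 2) - 1) with hA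
  set B := (‖Y‖ ^ 2) ^ (-(((n : ℝ) + 1) / 2) - 1 - 1) with hB
  have : ∀ i, ddpker i Y = gammaConst n * ((if i = Fin.last n then -2 * (n + 1) * Y i * A else 0)
      - (n + 1) * height Y * A + (n + 1) * (n + 3) * height Y * B * Y i ^ 2) := by
    intro i
    rw [ddpker, ← hA, ← hB]
    split_ifs <;> ring
  simp_rw [this]
  rw [← Finset.mul_sum, Finset.sum_add_distrib, Finset.sum_sub_distrib, ← Finset.mul_sum _ (fun i => Y i ^ 2), hs]
  simp only [Finset.sum_ite_eq', Finset.mem_univ, if_true, Finset.sum_const, Finset.card_univ,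
    Fintype.card_fin, nsmul_eq_mul]
  rw [e]
  simp only [height]
  push_cast
  ring

theorem continuousOn_normSq_rpow (s : ℝ) :
    ContinuousOn (fun Z : Euc (n + 1) => (‖Z‖ ^ 2) ^ s) {0}ᶜ := fun _ hY =>
  (hasFDerivAt_normSq_rpow s hY).continuousAt.continuousWithinAt

theorem continuous_coord (i : Fin (n + 1)) : Continuous (fun Z : Euc (n + 1) => Z i) := by fun_prop

theorem continuousOn_pker : ContinuousOn (pker (n := n)) {0}ᶜ := by
  unfold pker
  exact continuousOn_const.mul (continuous_height.continuousOn.mul (continuousOn_normSq_rpow _))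

theorem continuousOn_dpker (i : Fin (n + 1)) : ContinuousOn (dpker i) {0}ᶜ := by
  unfold dpker
  exact continuousOn_const.mul ((continuousOn_const.mul (continuousOn_normSq_rpow _)).sub
    (continuousOn_const.mul ((continuous_height.continuousOn.mul
      (continuous_coord i).continuousOn).mul (continuousOn_normSq_rpow _))))

theorem continuousOn_ddpker (i : Fin (n + 1)) : ContinuousOn (ddpker i) {0}ᶜ := by
  have h1 := (continuous_coord i).continuousOn (s := {0}ᶜ)
  have h2 := (continuous_height (n := n)).continuousOn (s := {0}ᶜ)
  have h3 := continuousOn_normSq_rpow (n := n) (-(((n : ℝ) + 1) / 2) - 1)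
  have h4 := continuousOn_normSq_rpow (n := n) (-(((n : ℝ) + 1) / 2) - 1 - 1)
  unfold ddpker
  fun_prop

theorem measurable_height : Measurable (height : Euc (n + 1) → ℝ) := continuous_height.measurable

theorem measurable_pker : Measurable (pker (n := n)) := by
  have := measurable_height (n := n)
  unfold pker; fun_prop

theorem measurable_dpker (i : Fin (n + 1)) : Measurable (dpker i) := by
  have := measurable_height (n := n)
  have h := (continuous_coord i).measurable
  unfold dpker
  fun_prop

theorem abs_coord_le (i : Fin (n + 1)) (Y : Euc (n + 1)) : |Y i| ≤ ‖Y‖ := by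
  simpa using PiLp.norm_apply_le Y i

theorem abs_dpker_le (i : Fin (n + 1)) (Y : Euc (n + 1)) :
    |dpker i Y| ≤ gammaConst n * (n + 2) * (‖Y‖ ^ 2) ^ (-(((n : ℝ) + 1) / 2)) := by
  have hγ := gammaConst_pos n
  rcases eq_or_ne Y 0 with rfl | hY
  · have h0 : (0 : ℝ) ^ (-(((n : ℝ) + 1) / 2)) = 0 :=
      Real.zero_rpow (by have : (0 : ℝ) < (((n : ℝ) + 1) / 2) := by positivity
                         linarith)
    simp [dpker, height, h0]
  have hN : 0 < ‖Y‖ ^ 2 := by positivity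
  rw [dpker, abs_mul, abs_of_pos hγ, mul_assoc (gammaConst n) ((n : ℝ) + 2)]
  refine mul_le_mul_of_nonneg_left ?_ hγ.le
  rw [Real.rpow_sub_one hN.ne']
  set A := (‖Y‖ ^ 2) ^ (-(((n : ℝ) + 1) / 2)) with hA
  have hA0 : 0 < A := by positivity
  have h1 : |height Y * Y i * (A / ‖Y‖ ^ 2)| ≤ A := by
    rw [abs_mul, abs_mul, abs_of_pos (by positivity : 0 < A / ‖Y‖ ^ 2)]
    calc |height Y| * |Y i| * (A / ‖Y‖ ^ 2) ≤ ‖Y‖ * ‖Y‖ * (A / ‖Y‖ ^ 2) := by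
          gcongr
          · exact abs_height_le Y
          · exact abs_coord_le i Y
      _ = A := by field_simp
  have h2 : |(if i = Fin.last n then (1 : ℝ) else 0) * A| ≤ A := by
    split_ifs <;> simp [hA0.le, abs_of_pos hA0]
  refine (abs_sub _ _).trans ?_
  rw [abs_mul ((n : ℝ) + 1), abs_of_pos (by positivity : (0 : ℝ) < (n : ℝ) + 1)]
  nlinarith [(Nat.cast_nonneg n : (0 : ℝ) ≤ n)]

/-- Subordination: `s ↦ q⁻ˢ` is a Gamma integral of Gaussians. -/
theorem lintegral_rpow_mul_exp {a r : ℝ} (ha : 0 < a) (hr : 0 < r) :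
    ∫⁻ t in Ioi (0 : ℝ), ENNReal.ofReal (t ^ (a - 1) * Real.exp (-(r * t))) =
      ENNReal.ofReal ((1 / r) ^ a * Real.Gamma a) := by
  have h := Real.integral_rpow_mul_exp_neg_mul_Ioi ha hr
  have hpos : 0 < (1 / r) ^ a * Real.Gamma a := by
    have := Real.Gamma_pos_of_pos ha
    positivity
  rw [← h, ofReal_integral_eq_lintegral_ofReal]
  · exact Integrable.of_integral_ne_zero (by rw [h]; exact hpos.ne')
  · filter_upwards [ae_restrict_mem measurableSet_Ioi] with t ht
    have : (0 : ℝ) < t := ht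
    positivity

theorem lintegral_gaussian {b : ℝ} (hb : 0 < b) :
    ∫⁻ y : Euc n, ENNReal.ofReal (Real.exp (-b * ‖y‖ ^ 2)) =
      ENNReal.ofReal ((Real.pi / b) ^ ((n : ℝ) / 2)) := by
  have h := GaussianFourier.integral_rexp_neg_mul_sq_norm (V := Euc n) hb
  have hpos : 0 < (Real.pi / b) ^ ((n : ℝ) / 2) := by positivity
  simp only [finrank_euclideanSpace, Fintype.card_fin] at h
  rw [← h, ofReal_integral_eq_lintegral_ofReal]
  · exact Integrable.of_integral_ne_zero (by rw [h]; exact hpos.ne')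
  · exact Eventually.of_forall fun y => (Real.exp_pos _).le

/-- The integrals of the powers of `‖y‖² + t²` over the horizontal space, computed by subordination to
the Gaussian integral. -/
theorem lintegral_bracket {s t : ℝ} (hs : (n : ℝ) / 2 < s) (ht : 0 < t) :
    ∫⁻ y : Euc n, ENNReal.ofReal ((‖y‖ ^ 2 + t ^ 2) ^ (-s)) =
      ENNReal.ofReal (Real.pi ^ ((n : ℝ) / 2) * Real.Gamma (s - n / 2) / Real.Gamma s *
        (t ^ 2) ^ ((n : ℝ) / 2 - s)) := by
  have hs0 : 0 < s := lt_of_le_of_lt (by positivity) hs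
  have hG := Real.Gamma_pos_of_pos hs0
  have hG' := Real.Gamma_pos_of_pos (sub_pos.2 hs)
  have key : ENNReal.ofReal (Real.Gamma s) *
      ∫⁻ y : Euc n, ENNReal.ofReal ((‖y‖ ^ 2 + t ^ 2) ^ (-s)) =
      ENNReal.ofReal (Real.pi ^ ((n : ℝ) / 2) * Real.Gamma (s - n / 2) *
        (t ^ 2) ^ ((n : ℝ) / 2 - s)) := by
    rw [← lintegral_const_mul' _ _ ENNReal.ofReal_ne_top]
    calc ∫⁻ y : Euc n, ENNReal.ofReal (Real.Gamma s) * ENNReal.ofReal ((‖y‖ ^ 2 + t ^ 2) ^ (-s))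
        = ∫⁻ y : Euc n, ∫⁻ τ in Ioi (0 : ℝ),
            ENNReal.ofReal (τ ^ (s - 1) * Real.exp (-((‖y‖ ^ 2 + t ^ 2) * τ))) := by
          refine lintegral_congr fun y => ?_
          have hq : 0 < ‖y‖ ^ 2 + t ^ 2 := by positivity
          rw [lintegral_rpow_mul_exp hs0 hq, ← ENNReal.ofReal_mul hG.le, mul_comm,
            Real.rpow_neg hq.le, one_div, Real.inv_rpow hq.le]
      _ = ∫⁻ τ in Ioi (0 : ℝ), ∫⁻ y : Euc n,
            ENNReal.ofReal (τ ^ (s - 1) * Real.exp (-((‖y‖ ^ 2 + t ^ 2) * τ))) := by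
          apply lintegral_lintegral_swap
          apply Measurable.aemeasurable
          unfold Function.uncurry
          fun_prop
      _ = ∫⁻ τ in Ioi (0 : ℝ), ENNReal.ofReal (Real.pi ^ ((n : ℝ) / 2)) *
            ENNReal.ofReal (τ ^ ((s - n / 2) - 1) * Real.exp (-(t ^ 2 * τ))) := by
          refine setLIntegral_congr_fun measurableSet_Ioi fun τ hτ => ?_
          have hτ : 0 < τ := hτ
          have : ∀ y : Euc n, ENNReal.ofReal (τ ^ (s - 1) * Real.exp (-((‖y‖ ^ 2 + t ^ 2) * τ))) =
              ENNReal.ofReal (τ ^ (s - 1) * Real.exp (-(t ^ 2 * τ))) *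
                ENNReal.ofReal (Real.exp (-τ * ‖y‖ ^ 2)) := fun y => by
            rw [← ENNReal.ofReal_mul (by positivity), mul_assoc, ← Real.exp_add]
            ring_nf
          simp only [this]
          rw [lintegral_const_mul' _ _ ENNReal.ofReal_ne_top, lintegral_gaussian hτ,
            ← ENNReal.ofReal_mul (by positivity), ← ENNReal.ofReal_mul (by positivity),
            Real.div_rpow Real.pi_pos.le hτ.le]
          congr 1
          have : τ ^ (s - n / 2 - 1) = τ ^ (s - 1) / τ ^ ((n : ℝ) / 2) := by
            rw [← Real.rpow_sub hτ]; ring_nf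
          rw [this]; field_simp
      _ = _ := by
          rw [lintegral_const_mul' _ _ ENNReal.ofReal_ne_top,
            lintegral_rpow_mul_exp (sub_pos.2 hs) (by positivity),
            ← ENNReal.ofReal_mul (by positivity), one_div, Real.inv_rpow (by positivity),
            ← Real.rpow_neg (by positivity), neg_sub]
          ring_nf
  have hGe : ENNReal.ofReal (Real.Gamma s) ≠ 0 := by simpa using hG
  rw [← ENNReal.mul_right_inj hGe ENNReal.ofReal_ne_top, key, ← ENNReal.ofReal_mul hG.le]
  congr 1
  field_simp

/-- The normalizing constant `gammaConst n` gives the Poisson kernel unit mass at every height. -/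
theorem lintegral_pker {t : ℝ} (ht : 0 < t) :
    ∫⁻ y : Euc n, ENNReal.ofReal (pker (join y t)) = 1 := by
  have hγ := gammaConst_pos n
  have : ∀ y : Euc n, ENNReal.ofReal (pker (join y t)) =
      ENNReal.ofReal (gammaConst n * t) *
        ENNReal.ofReal ((‖y‖ ^ 2 + t ^ 2) ^ (-(((n : ℝ) + 1) / 2))) := fun y => by
    rw [← ENNReal.ofReal_mul (by positivity), pker, norm_sq_join, height_join, mul_assoc]
  simp only [this]
  rw [lintegral_const_mul' _ _ ENNReal.ofReal_ne_top, lintegral_bracket (by linarith) ht,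
    ← ENNReal.ofReal_mul (by positivity), ← ENNReal.ofReal_one]
  congr 1
  have e1 : ((n : ℝ) + 1) / 2 - n / 2 = 1 / 2 := by ring
  have e2 : (n : ℝ) / 2 - ((n : ℝ) + 1) / 2 = -(1 / 2) := by ring
  have hG : 0 < Real.Gamma (((n : ℝ) + 1) / 2) := Real.Gamma_pos_of_pos (by positivity)
  rw [e1, e2, Real.Gamma_one_half_eq, Real.rpow_neg (by positivity), ← Real.sqrt_eq_rpow,
    Real.sqrt_sq ht.le, gammaConst, Real.sqrt_eq_rpow]
  have e3 : Real.pi ^ (((n : ℝ) + 1) / 2) = Real.pi ^ ((n : ℝ) / 2) * Real.pi ^ (1 / 2 : ℝ) := by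
    rw [← Real.rpow_add Real.pi_pos]; ring_nf
  rw [e3]
  field_simp

end Kernel

end HalfLap

namespace HalfLap

section KernelIntegrals

variable {n : ℕ}

theorem integrable_bracket {s t : ℝ} (hs : (n : ℝ) / 2 < s) (ht : 0 < t) :
    Integrable (fun y : Euc n => (‖y‖ ^ 2 + t ^ 2) ^ (-s)) := by
  refine ⟨(by fun_prop : Measurable fun y : Euc n => (‖y‖ ^ 2 + t ^ 2) ^ (-s)).aestronglyMeasurable,
    ?_⟩
  rw [hasFiniteIntegral_iff_ofReal (Eventually.of_forall fun y => by positivity),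
    lintegral_bracket hs ht]
  exact ENNReal.ofReal_lt_top

theorem half_lt (n : ℕ) : (n : ℝ) / 2 < ((n : ℝ) + 1) / 2 := by linarith

theorem join_add_smul_single (x : Euc n) (s h : ℝ) :
    join x s + h • EuclideanSpace.single (Fin.last n) 1 = join x (s + h) := by
  ext i
  refine Fin.lastCases ?_ (fun j => ?_) i
  · simp [join]
  · simp [join, (Fin.castSucc_lt_last j).ne]

theorem join_add_smul_single_castSucc (x : Euc n) (s h : ℝ) (j : Fin n) :
    join x s + h • EuclideanSpace.single j.castSucc 1 =
      join (x + h • EuclideanSpace.single j 1) s := by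
  ext i
  refine Fin.lastCases ?_ (fun k => ?_) i
  · simp [join, (Fin.castSucc_lt_last j).ne']
  · simp [join]

/-- A vertical directional derivative is a derivative in the height. -/
theorem hasDerivAt_join_of_hasLineDerivAt {E : Type*} [NormedAddCommGroup E] [NormedSpace ℝ E]
    {f : Euc (n + 1) → E} {f' : E} {x : Euc n} {s : ℝ}
    (h : HasLineDerivAt ℝ f f' (join x s) (EuclideanSpace.single (Fin.last n) 1)) :
    HasDerivAt (fun t => f (join x t)) f' s := by
  have h' : HasDerivAt (fun t : ℝ => f (join x (s + t))) f' (s - s) := by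
    simpa [HasLineDerivAt, join_add_smul_single] using h
  simpa using h'.comp_sub_const s s

/-- A horizontal directional derivative is a directional derivative along horizontal slices. -/
theorem hasLineDerivAt_slice {E : Type*} [NormedAddCommGroup E] [NormedSpace ℝ E]
    {f : Euc (n + 1) → E} {f' : E} {x : Euc n} {s : ℝ} {j : Fin n}
    (h : HasLineDerivAt ℝ f f' (join x s) (EuclideanSpace.single j.castSucc 1)) :
    HasLineDerivAt ℝ (fun y => f (join y s)) f' x (EuclideanSpace.single j 1) := by
  simpa [HasLineDerivAt, join_add_smul_single_castSucc] using h

theorem hasLineDerivAt_comp_sub {E F : Type*} [NormedAddCommGroup E] [NormedSpace ℝ E]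
    [NormedAddCommGroup F] [NormedSpace ℝ F]
    {f : F → E} {f' : E} {x v a : F} (h : HasLineDerivAt ℝ f f' (x - a) v) :
    HasLineDerivAt ℝ (fun y => f (y - a)) f' x v := by
  simpa [HasLineDerivAt, add_sub_right_comm] using h

theorem join_ne_zero {x : Euc n} {t : ℝ} (ht : t ≠ 0) : join x t ≠ 0 := by
  intro h
  have := congrArg height h
  simp [height_join] at this
  exact ht (by simpa [height] using this)

theorem rpow_normSq_join_le {δ s : ℝ} (hδ : 0 < δ) (hs : δ ≤ s) (y : Euc n) (p : ℝ)
    (hp : 0 ≤ p) :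
    (‖join y s‖ ^ 2) ^ (-p) ≤ (‖y‖ ^ 2 + δ ^ 2) ^ (-p) := by
  rw [norm_sq_join]
  apply Real.rpow_le_rpow_of_nonpos (by positivity) _ (by linarith)
  gcongr

theorem integrable_dpker_join (i : Fin (n + 1)) {t : ℝ} (ht : 0 < t) :
    Integrable (fun y : Euc n => dpker i (join y t)) := by
  have hm : Measurable (fun y : Euc n => dpker i (join y t)) :=
    (measurable_dpker i).comp (continuous_join.comp (by fun_prop :
      Continuous fun y : Euc n => (y, t))).measurable
  refine ((integrable_bracket (half_lt n) ht).const_mul (gammaConst n * (n + 2))).mono'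
    hm.aestronglyMeasurable (Eventually.of_forall fun y => ?_)
  rw [Real.norm_eq_abs]
  refine (abs_dpker_le i _).trans_eq ?_
  rw [norm_sq_join]

theorem pker_join_nonneg {t : ℝ} (ht : 0 ≤ t) (y : Euc n) : 0 ≤ pker (join y t) := by
  have := gammaConst_pos n
  unfold pker
  rw [height_join]
  positivity

theorem measurable_pker_join (t : ℝ) : Measurable (fun y : Euc n => pker (join y t)) :=
  measurable_pker.comp (continuous_join.comp (by fun_prop :
      Continuous fun y : Euc n => (y, t))).measurable

theorem integrable_pker_join {t : ℝ} (ht : 0 < t) :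
    Integrable (fun y : Euc n => pker (join y t)) := by
  refine ⟨(measurable_pker_join t).aestronglyMeasurable, ?_⟩
  rw [hasFiniteIntegral_iff_ofReal (Eventually.of_forall fun y => pker_join_nonneg ht.le y),
    lintegral_pker ht]
  exact ENNReal.one_lt_top

theorem integral_pker_join {t : ℝ} (ht : 0 < t) : ∫ y : Euc n, pker (join y t) = 1 := by
  rw [integral_eq_lintegral_of_nonneg_ae (Eventually.of_forall fun y => pker_join_nonneg ht.le y)
    (measurable_pker_join t).aestronglyMeasurable, lintegral_pker ht]
  rfl

/-- Every partial derivative of the Poisson kernel has mean zero on horizontal hyperplanes: the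
horizontal ones are odd, and the vertical one is the derivative of the constant total mass. -/
theorem integral_dpker_join (i : Fin (n + 1)) {t : ℝ} (ht : 0 < t) :
    ∫ y : Euc n, dpker i (join y t) = 0 := by
  refine Fin.lastCases ?_ (fun j => ?_) i
  · have h := hasDerivAt_integral_of_dominated_loc_of_deriv_le (μ := (volume : Measure (Euc n)))
      (F := fun s y => pker (join y s)) (F' := fun s y => dpker (Fin.last n) (join y s))
      (x₀ := t) (s := Metric.ball t (t / 2))
      (bound := fun y => gammaConst n * (n + 2) *
        (‖y‖ ^ 2 + (t / 2) ^ 2) ^ (-(((n : ℝ) + 1) / 2)))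
      (Metric.ball_mem_nhds t (by positivity))
      (Eventually.of_forall fun s => (measurable_pker_join s).aestronglyMeasurable)
      (integrable_pker_join ht) (integrable_dpker_join _ ht).aestronglyMeasurable
      (Eventually.of_forall fun y s hs => ?_)
      ((integrable_bracket (half_lt n) (by positivity)).const_mul _)
      (Eventually.of_forall fun y s hs => ?_)
    · refine h.2.unique ?_
      have : (fun s => ∫ y : Euc n, pker (join y s)) =ᶠ[𝓝 t] fun _ => 1 := by
        filter_upwards [lt_mem_nhds ht] with s hs using integral_pker_join hs
      exact (hasDerivAt_const t (1 : ℝ)).congr_of_eventuallyEq this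
    · rw [Metric.mem_ball, Real.dist_eq, abs_lt] at hs
      rw [Real.norm_eq_abs]
      refine (abs_dpker_le _ _).trans ?_
      have := gammaConst_pos n
      refine mul_le_mul_of_nonneg_left ?_ (by positivity)
      exact rpow_normSq_join_le (δ := t / 2) (s := s) (half_pos ht) (by linarith [hs.1]) y _ (by positivity)
    · rw [Metric.mem_ball, Real.dist_eq, abs_lt] at hs
      exact hasDerivAt_join_of_hasLineDerivAt (hasLineDerivAt_pker _ (join_ne_zero (by linarith [hs.1])))
  · have h : ∀ y : Euc n, dpker j.castSucc (join (-y) t) = -dpker j.castSucc (join y t) := by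
      intro y
      have hj : j.castSucc ≠ Fin.last n := (Fin.castSucc_lt_last j).ne
      rw [dpker, dpker, norm_sq_join, norm_sq_join]
      have h1 : (join (-y) t) j.castSucc = -(join y t) j.castSucc := by simp [join]
      rw [h1, height_join, height_join, norm_neg]
      simp [hj]
    have h2 := integral_neg_eq_self (fun y : Euc n => dpker j.castSucc (join y t)) volume
    simp only [h, integral_neg] at h2
    linarith

/-! ### Green's formula for the Poisson kernel -/

theorem setIntegral_join {E : Type*} [NormedAddCommGroup E] [NormedSpace ℝ E]
    {f : Euc (n + 1) → E} {t : ℝ} (hf : IntegrableOn f {X | t < height X}) :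
    ∫ X in {X | t < height X}, f X = ∫ s in Ioi t, ∫ x, f (join x s) := by
  have hm : MeasurableSet {X : Euc (n + 1) | t < height X} :=
    measurableSet_lt measurable_const measurable_height
  rw [← integral_indicator hm, integral_join (by rwa [integrable_indicator_iff hm]),
    ← integral_indicator measurableSet_Ioi]
  congr 1; ext s
  by_cases hs : t < s <;> simp [indicator, hs]

theorem setIntegral_join' {E : Type*} [NormedAddCommGroup E] [NormedSpace ℝ E]
    {f : Euc (n + 1) → E} {t : ℝ} (hf : IntegrableOn f {X | t < height X}) :
    ∫ X in {X | t < height X}, f X = ∫ x, ∫ s in Ioi t, f (join x s) := by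
  have hm : MeasurableSet {X : Euc (n + 1) | t < height X} :=
    measurableSet_lt measurable_const measurable_height
  rw [← integral_indicator hm, integral_join' (by rwa [integrable_indicator_iff hm])]
  congr 1; ext x
  rw [← integral_indicator measurableSet_Ioi]
  congr 1; ext s
  by_cases hs : t < s <;> simp [indicator, hs]

theorem integrableOn_of_continuousOn_of_hasCompactSupport {E : Type*} [NormedAddCommGroup E]
    {f : Euc (n + 1) → E} {S : Set (Euc (n + 1))} (hS : IsClosed S)
    (hf : ContinuousOn f S) (hc : HasCompactSupport f) : IntegrableOn f S := by
  have hK : IsCompact (tsupport f ∩ S) := hc.isCompact.inter_right hS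
  have h1 : IntegrableOn f (tsupport f ∩ S) :=
    (hf.mono inter_subset_right).integrableOn_compact hK
  refine h1.of_forall_sdiff_eq_zero hS.measurableSet fun X hX => ?_
  by_contra h
  exact hX.2 ⟨subset_tsupport f h, hX.1⟩

theorem continuousOn_sub_incl {E : Type*} [TopologicalSpace E] {f : Euc (n + 1) → E}
    (hf : ContinuousOn f {0}ᶜ) (z : Euc n) {t : ℝ} (ht : 0 < t) :
    ContinuousOn (fun X => f (X - incl z)) {X | t ≤ height X} := by
  refine hf.comp (by fun_prop) fun X hX => ?_
  intro h
  have : height (X - incl z) = 0 := by rw [h]; simp [height]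
  rw [height_sub, height_incl, sub_zero] at this
  have hX' : t ≤ height X := hX
  linarith

theorem partialDeriv_hasLineDerivAt {d : ℕ} {E : Type*} [NormedAddCommGroup E] [NormedSpace ℝ E]
    {φ : Euc d → E} (hφ : Differentiable ℝ φ) (i : Fin d) (X : Euc d) :
    HasLineDerivAt ℝ φ (partialDeriv i φ X) X (EuclideanSpace.single i 1) :=
  (hφ X).hasFDerivAt.hasLineDerivAt _

theorem continuous_partialDeriv {d : ℕ} {E : Type*} [NormedAddCommGroup E] [NormedSpace ℝ E]
    {φ : Euc d → E} (hφ : ContDiff ℝ 1 φ) (i : Fin d) : Continuous (partialDeriv i φ) := by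
  unfold partialDeriv
  exact (hφ.continuous_fderiv one_ne_zero).clm_apply continuous_const

theorem hasCompactSupport_partialDeriv {d : ℕ} {E : Type*} [NormedAddCommGroup E]
    [NormedSpace ℝ E] {φ : Euc d → E} (hφ : HasCompactSupport φ) (i : Fin d) :
    HasCompactSupport (partialDeriv i φ) :=
  (hφ.fderiv_apply ℝ (EuclideanSpace.single i 1))

theorem tsupport_partialDeriv_subset {d : ℕ} {E : Type*} [NormedAddCommGroup E]
    [NormedSpace ℝ E] (φ : Euc d → E) (i : Fin d) :
    tsupport (partialDeriv i φ) ⊆ tsupport φ :=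
  (tsupport_fderiv_apply_subset ℝ (EuclideanSpace.single i 1))

theorem sub_incl_join (x z : Euc n) (s : ℝ) : join x s - incl z = join (x - z) s := by
  rw [incl_eq_join, ← join_sub, sub_zero]

theorem sub_incl_ne_zero {X : Euc (n + 1)} (hX : 0 < height X) (z : Euc n) : X - incl z ≠ 0 := by
  intro h
  have h2 : height (X - incl z) = 0 := by rw [h]; simp [height]
  rw [height_sub, height_incl] at h2
  linarith

/-- Green's formula for the Poisson kernel with pole `z` on the half-space above height `t`. -/
theorem integral_dpker_smul_partialDeriv {E : Type*} [NormedAddCommGroup E] [NormedSpace ℝ E]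
    [CompleteSpace E]
    {φ : Euc (n + 1) → E} (hφ : ContDiff ℝ 1 φ) (hc : HasCompactSupport φ) (z : Euc n) {t : ℝ}
    (ht : 0 < t) :
    ∫ X in {X | t < height X}, ∑ i, dpker i (X - incl z) • partialDeriv i φ X =
      -∫ x, dpker (Fin.last n) (join x t - incl z) • φ (join x t) := by
  have hcl : IsClosed {X : Euc (n + 1) | t ≤ height X} := isClosed_le continuous_const continuous_height
  have hsub : {X : Euc (n + 1) | t < height X} ⊆ {X | t ≤ height X} := fun X (h : t < _) => h.le
  have I1 : ∀ i, IntegrableOn (fun X => dpker i (X - incl z) • partialDeriv i φ X)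
      {X | t < height X} := fun i =>
    (integrableOn_of_continuousOn_of_hasCompactSupport hcl
      ((continuousOn_sub_incl (continuousOn_dpker i) z ht).smul
        (continuous_partialDeriv hφ i).continuousOn)
      ((hasCompactSupport_partialDeriv hc i).smul_left)).mono_set hsub
  have I2 : ∀ i, IntegrableOn (fun X => ddpker i (X - incl z) • φ X) {X | t < height X} := fun i =>
    (integrableOn_of_continuousOn_of_hasCompactSupport hcl
      ((continuousOn_sub_incl (continuousOn_ddpker i) z ht).smul hφ.continuous.continuousOn)
      (hc.smul_left)).mono_set hsub
  have hd := hφ.differentiable one_ne_zero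
  have hcs : ∀ s : ℝ, HasCompactSupport (fun x : Euc n => φ (join x s)) := fun s => by
    refine HasCompactSupport.intro (hc.isCompact.image continuous_horiz) fun x hx => ?_
    refine image_eq_zero_of_notMem_tsupport fun h => hx ⟨_, h, by simp⟩
  have hcj : ∀ s : ℝ, Continuous (fun x : Euc n => join x s) := fun s =>
    continuous_join.comp (by fun_prop : Continuous fun x : Euc n => (x, s))
  have H : ∀ j : Fin n, ∫ X in {X | t < height X},
      dpker j.castSucc (X - incl z) • partialDeriv j.castSucc φ X =
      - ∫ X in {X | t < height X}, ddpker j.castSucc (X - incl z) • φ X := by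
    intro j
    rw [setIntegral_join (I1 _), setIntegral_join (I2 _), ← integral_neg]
    refine setIntegral_congr_fun measurableSet_Ioi fun s hs => ?_
    have hs : 0 < s := ht.trans hs
    have hcont : ∀ {f : Euc (n + 1) → ℝ}, ContinuousOn f {0}ᶜ →
        Continuous fun x : Euc n => f (join x s - incl z) := fun hf => by
      rw [← continuousOn_univ]
      exact (continuousOn_sub_incl hf z hs).comp (hcj s).continuousOn fun x _ => by simp
    have hcp : HasCompactSupport (fun x : Euc n => partialDeriv j.castSucc φ (join x s)) := by
      refine HasCompactSupport.intro (hc.isCompact.image continuous_horiz) fun x hx => ?_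
      refine image_eq_zero_of_notMem_tsupport fun h => hx ⟨_, tsupport_partialDeriv_subset φ _ h,
        by simp⟩
    refine integral_bilinear_hasLineDerivAt_right_eq_neg_left_of_integrable
      (B := ContinuousLinearMap.lsmul ℝ ℝ) (v := EuclideanSpace.single j 1)
      (f := fun x : Euc n => dpker j.castSucc (join x s - incl z))
      (f' := fun x : Euc n => ddpker j.castSucc (join x s - incl z))
      (g := fun x => φ (join x s)) (g' := fun x => partialDeriv j.castSucc φ (join x s))
      ?_ ?_ ?_ ?_ ?_
    · exact ((hcont (continuousOn_ddpker _)).smul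
        (hφ.continuous.comp (hcj s))).integrable_of_hasCompactSupport (hcs s).smul_left
    · exact ((hcont (continuousOn_dpker _)).smul
        ((continuous_partialDeriv hφ _).comp (hcj s))).integrable_of_hasCompactSupport hcp.smul_left
    · exact ((hcont (continuousOn_dpker _)).smul
        (hφ.continuous.comp (hcj s))).integrable_of_hasCompactSupport (hcs s).smul_left
    · intro x _
      refine hasLineDerivAt_slice (f := fun X => dpker j.castSucc (X - incl z)) ?_
      exact hasLineDerivAt_comp_sub
        (hasLineDerivAt_dpker _ (sub_incl_ne_zero (by rwa [height_join]) z))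
    · intro x _
      exact hasLineDerivAt_slice (partialDeriv_hasLineDerivAt hd _ _)
  have V : ∫ X in {X | t < height X},
      dpker (Fin.last n) (X - incl z) • partialDeriv (Fin.last n) φ X =
      - (∫ x, dpker (Fin.last n) (join x t - incl z) • φ (join x t)) -
      ∫ X in {X | t < height X}, ddpker (Fin.last n) (X - incl z) • φ X := by
    rw [eq_sub_iff_add_eq, ← integral_add (I1 _) (I2 _)]
    refine (setIntegral_join' ((I1 (Fin.last n)).add (I2 (Fin.last n)))).trans ?_
    rw [← integral_neg]
    refine integral_congr_ae (Eventually.of_forall fun x => ?_)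
    have hline : Continuous fun s : ℝ => join x s :=
      continuous_join.comp (by fun_prop : Continuous fun s : ℝ => (x, s))
    obtain ⟨R, hR⟩ : ∃ R : ℝ, ∀ s, R < s → φ (join x s) = 0 := by
      obtain ⟨R, hR⟩ := hc.isCompact.isBounded.subset_closedBall 0
      refine ⟨R, fun s hs => image_eq_zero_of_notMem_tsupport fun h => ?_⟩
      have := hR h
      rw [mem_closedBall_zero_iff] at this
      have h2 := abs_height_le (join x s)
      rw [height_join] at h2
      have := le_abs_self s
      linarith
    have hder : ∀ s ∈ Ici t, HasDerivAt
        (fun s => dpker (Fin.last n) (join x s - incl z) • φ (join x s))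
        (dpker (Fin.last n) (join x s - incl z) • partialDeriv (Fin.last n) φ (join x s) +
          ddpker (Fin.last n) (join x s - incl z) • φ (join x s)) s := by
      intro s hs
      have hs : 0 < s := ht.trans_le hs
      have h1 : HasDerivAt (fun s => dpker (Fin.last n) (join x s - incl z)) _ s :=
        hasDerivAt_join_of_hasLineDerivAt (f := fun X => dpker (Fin.last n) (X - incl z))
          (hasLineDerivAt_comp_sub
            (hasLineDerivAt_dpker _ (sub_incl_ne_zero (by rwa [height_join]) z)))
      have h2 := hasDerivAt_join_of_hasLineDerivAt
          (partialDeriv_hasLineDerivAt hd (Fin.last n) (join x s))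
      exact h1.smul h2
    have hlim : Tendsto (fun s => dpker (Fin.last n) (join x s - incl z) • φ (join x s)) atTop
        (𝓝 0) := by
      refine tendsto_const_nhds.congr' ?_
      filter_upwards [eventually_gt_atTop R] with s hs
      rw [hR s hs, smul_zero]
    have hint : IntegrableOn (fun s => dpker (Fin.last n) (join x s - incl z) •
          partialDeriv (Fin.last n) φ (join x s) +
          ddpker (Fin.last n) (join x s - incl z) • φ (join x s)) (Ioi t) := by
      have hcont : ContinuousOn (fun s => dpker (Fin.last n) (join x s - incl z) •
          partialDeriv (Fin.last n) φ (join x s) +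
          ddpker (Fin.last n) (join x s - incl z) • φ (join x s)) (Ici t) := by
        have a : ∀ {f : Euc (n + 1) → ℝ}, ContinuousOn f {0}ᶜ →
            ContinuousOn (fun s : ℝ => f (join x s - incl z)) (Ici t) := fun hf =>
          (continuousOn_sub_incl hf z ht).comp hline.continuousOn fun s hs => by simpa using hs
        exact ((a (continuousOn_dpker _)).smul
          ((continuous_partialDeriv hφ _).comp hline).continuousOn).add
          ((a (continuousOn_ddpker _)).smul (hφ.continuous.comp hline).continuousOn)
      have h1 : IntegrableOn (fun s => dpker (Fin.last n) (join x s - incl z) •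
          partialDeriv (Fin.last n) φ (join x s) +
          ddpker (Fin.last n) (join x s - incl z) • φ (join x s)) (Icc t (max t (R + 1))) :=
        (hcont.mono Icc_subset_Ici_self).integrableOn_compact isCompact_Icc
      refine IntegrableOn.of_forall_sdiff_eq_zero (h1.mono_set Ioc_subset_Icc_self)
        measurableSet_Ioi fun s hs => ?_
      have hs2 : R < s := by
        have h := hs.2
        simp only [mem_Ioc, not_and, not_le] at h
        have := (le_max_right t (R + 1)).trans_lt (h hs.1)
        linarith
      have e1 : partialDeriv (Fin.last n) φ (join x s) = 0 := by
        have h2 := hasDerivAt_join_of_hasLineDerivAt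
          (partialDeriv_hasLineDerivAt hd (Fin.last n) (join x s))
        refine h2.unique ((hasDerivAt_const s (0 : E)).congr_of_eventuallyEq ?_)
        filter_upwards [lt_mem_nhds hs2] with r hr using hR r hr
      rw [e1, hR s hs2, smul_zero, smul_zero, add_zero]
    have := integral_Ioi_of_hasDerivAt_of_tendsto' hder hint hlim
    rw [zero_sub] at this
    exact this
  rw [integral_finsetSum _ fun i _ => I1 i, Fin.sum_univ_castSucc, V]
  simp only [H]
  have hs0 : ∑ i, ∫ X in {X | t < height X}, ddpker i (X - incl z) • φ X = 0 := by
    rw [← integral_finsetSum _ fun i _ => I2 i]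
    rw [setIntegral_congr_fun (g := fun _ => (0 : E))
      (measurableSet_lt measurable_const measurable_height)]
    · simp
    · intro X hX
      have hX : t < height X := hX
      simp only [← Finset.sum_smul]
      rw [sum_ddpker (sub_incl_ne_zero (ht.trans hX) z), zero_smul]
  rw [Fin.sum_univ_castSucc] at hs0
  rw [Finset.sum_neg_distrib, eq_neg_of_add_eq_zero_left hs0]
  abel

end KernelIntegrals

end HalfLap

/-! ### The harmonic extension and its gradient -/

namespace HalfLap

section Extension

variable {n m : ℕ}

/-- The weight governing the integrability of the data of the Poisson extension. -/
noncomputable def wt (z : Euc n) : ℝ := (1 + ‖z‖ ^ 2) ^ (-(((n : ℝ) + 1) / 2))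

/-- The gradient of the harmonic extension, obtained by differentiating the Poisson kernel. -/
noncomputable def harmGrad (v : Euc n → Euc m) (X : Euc (n + 1)) (i : Fin (n + 1)) : Euc m :=
  ∫ z, dpker i (X - incl z) • v z

/-- The integrand of the Gagliardo energy. -/
noncomputable def gagDens (v : Euc n → Euc m) (x y : Euc n) : ℝ≥0∞ :=
  ENNReal.ofReal (‖v x - v y‖ ^ 2 / ‖x - y‖ ^ (n + 1))

theorem gagliardo_eq (v : Euc n → Euc m) (A B : Set (Euc n)) :
    gagliardo v A B = ∫⁻ x in A, ∫⁻ y in B, gagDens v x y := rfl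

theorem wt_pos (z : Euc n) : 0 < wt z := by unfold wt; positivity

theorem continuous_wt : Continuous (wt (n := n)) := by
  unfold wt
  refine Continuous.rpow_const (by fun_prop) fun z => Or.inl (by positivity)

theorem rpow_normSq_eq (y : Euc n) :
    (‖y‖ ^ 2) ^ (-(((n : ℝ) + 1) / 2)) = 1 / ‖y‖ ^ (n + 1) := by
  rw [Real.rpow_neg (by positivity), one_div, ← Real.rpow_natCast, ← Real.rpow_natCast,
    ← Real.rpow_mul (norm_nonneg _)]
  congr 2
  push_cast
  ring

theorem gagDens_eq (v : Euc n → Euc m) (x y : Euc n) :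
    gagDens v x y = ENNReal.ofReal (1 / ‖x - y‖ ^ (n + 1)) * ‖v x - v y‖ₑ ^ 2 := by
  rw [gagDens, ← ofReal_norm, ← ENNReal.ofReal_pow (norm_nonneg _),
    ← ENNReal.ofReal_mul (by positivity)]
  congr 1; ring

theorem gagDens_symm (v : Euc n → Euc m) (x y : Euc n) : gagDens v x y = gagDens v y x := by
  rw [gagDens, gagDens, norm_sub_rev, norm_sub_rev x y]

theorem aemeasurable_gagDens {v : Euc n → Euc m} (hv : AEStronglyMeasurable v) :
    AEMeasurable (fun p : Euc n × Euc n => gagDens v p.1 p.2) (volume.prod volume) := by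
  have h1 := hv.comp_fst (ν := (volume : Measure (Euc n)))
  have h2 := hv.comp_snd (μ := (volume : Measure (Euc n)))
  have h3 : AEMeasurable (fun p : Euc n × Euc n => ‖v p.1 - v p.2‖ ^ 2) (volume.prod volume) :=
    (h1.sub h2).norm.aemeasurable.pow_const 2
  have h4 : Measurable (fun p : Euc n × Euc n => ‖p.1 - p.2‖ ^ (n + 1)) := by fun_prop
  exact (h3.div h4.aemeasurable).ennreal_ofReal

theorem one_add_normSq_le {R δ : ℝ} (hδ : 0 < δ) {X : Euc (n + 1)} (hX : ‖X‖ ≤ R)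
    (hδX : δ ≤ height X) (z : Euc n) :
    1 + ‖z‖ ^ 2 ≤ ((1 + 2 * R ^ 2) / δ ^ 2 + 2) * ‖X - incl z‖ ^ 2 := by
  have h1 : δ ^ 2 ≤ ‖X - incl z‖ ^ 2 := by
    have := norm_sq_sub_incl X z
    nlinarith [sq_nonneg ‖horiz X - z‖]
  have h2 : ‖z‖ ≤ ‖X - incl z‖ + ‖X‖ := by
    rw [← norm_incl z]
    calc ‖incl z‖ = ‖X - (X - incl z)‖ := by rw [sub_sub_cancel]
      _ ≤ ‖X‖ + ‖X - incl z‖ := norm_sub_le _ _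
      _ = _ := add_comm _ _
  have h3 : ‖z‖ ^ 2 ≤ 2 * ‖X - incl z‖ ^ 2 + 2 * R ^ 2 := by
    have h0 := norm_nonneg X
    nlinarith [norm_nonneg z, sq_nonneg (‖X - incl z‖ - ‖X‖), norm_nonneg (X - incl z)]
  have h4 : 1 + 2 * R ^ 2 ≤ (1 + 2 * R ^ 2) / δ ^ 2 * ‖X - incl z‖ ^ 2 := by
    rw [div_mul_eq_mul_div, le_div_iff₀ (by positivity)]
    exact mul_le_mul_of_nonneg_left h1 (by positivity)
  linarith

/-- On bounded sets at positive distance from the boundary, the kernels are dominated by the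
weight `wt`. -/
theorem exists_rpow_le_wt (n : ℕ) {R δ : ℝ} (hδ : 0 < δ) :
    ∃ C : ℝ, 0 < C ∧ ∀ X : Euc (n + 1), ‖X‖ ≤ R → δ ≤ height X → ∀ z,
      (‖X - incl z‖ ^ 2) ^ (-(((n : ℝ) + 1) / 2)) ≤ C * wt z := by
  refine ⟨((1 + 2 * R ^ 2) / δ ^ 2 + 2) ^ (((n : ℝ) + 1) / 2), by positivity,
    fun X hX hδX z => ?_⟩
  set c := (1 + 2 * R ^ 2) / δ ^ 2 + 2 with hc
  have hc0 : 0 < c := by positivity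
  have h := one_add_normSq_le hδ hX hδX z
  rw [← hc] at h
  have h1 : (c * ‖X - incl z‖ ^ 2) ^ (-(((n : ℝ) + 1) / 2)) ≤ wt z :=
    Real.rpow_le_rpow_of_nonpos (by positivity) h (neg_nonpos.2 (by positivity))
  rw [Real.mul_rpow hc0.le (by positivity), Real.rpow_neg hc0.le] at h1
  rw [← inv_mul_le_iff₀ (by positivity)]
  exact h1

theorem exists_abs_dpker_le (n : ℕ) {R δ : ℝ} (hδ : 0 < δ) :
    ∃ C : ℝ, 0 < C ∧ ∀ X : Euc (n + 1), ‖X‖ ≤ R → δ ≤ height X → ∀ z i,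
      |dpker i (X - incl z)| ≤ C * wt z := by
  obtain ⟨C, hC, h⟩ := exists_rpow_le_wt n (R := R) hδ
  have hγ := gammaConst_pos n
  refine ⟨gammaConst n * (n + 2) * C, by positivity, fun X hX hδX z i => ?_⟩
  refine (abs_dpker_le i _).trans ?_
  rw [mul_assoc _ C]
  exact mul_le_mul_of_nonneg_left (h X hX hδX z) (by positivity)

theorem exists_abs_pker_le (n : ℕ) {R δ : ℝ} (hδ : 0 < δ) :
    ∃ C : ℝ, 0 < C ∧ ∀ X : Euc (n + 1), ‖X‖ ≤ R → δ ≤ height X → ∀ z,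
      |pker (X - incl z)| ≤ C * wt z := by
  obtain ⟨C, hC, h⟩ := exists_rpow_le_wt n (R := R) hδ
  have hγ := gammaConst_pos n
  refine ⟨gammaConst n * ((|R| + 1) * C), by positivity, fun X hX hδX z => ?_⟩
  rw [pker, abs_mul, abs_mul, abs_of_pos hγ, mul_assoc, mul_assoc,
    abs_of_nonneg (by positivity : 0 ≤ (‖X - incl z‖ ^ 2) ^ (-(((n : ℝ) + 1) / 2)))]
  refine mul_le_mul_of_nonneg_left ?_ hγ.le
  refine mul_le_mul ?_ (h X hX hδX z) (by positivity) (by positivity)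
  rw [height_sub, height_incl, sub_zero]
  linarith [abs_height_le X, le_abs_self R]

theorem aestronglyMeasurable_of_wt {v : Euc n → Euc m} (hv : Integrable (fun z => wt z • v z)) :
    AEStronglyMeasurable v := by
  have h : AEStronglyMeasurable (fun z => (wt z)⁻¹ • (wt z • v z)) :=
    (continuous_wt.inv₀ fun z => (wt_pos z).ne').aestronglyMeasurable.smul
      hv.aestronglyMeasurable
  refine h.congr (Eventually.of_forall fun z => ?_)
  exact inv_smul_smul₀ (wt_pos z).ne' _

theorem integrable_wt (n : ℕ) : Integrable (wt (n := n)) := by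
  have := integrable_bracket (half_lt n) one_pos
  refine this.congr (Eventually.of_forall fun z => ?_)
  simp [wt, add_comm]

/-- Finite interaction energy of a nonnegligible set with the whole space controls the growth
at infinity. -/
theorem integrable_wt_smul {v : Euc n → Euc m} (hv : AEStronglyMeasurable v) {A : Set (Euc n)}
    (hA : volume A ≠ 0) (hfin : ∫⁻ x in A, ∫⁻ z, gagDens v x z ≠ ⊤) :
    Integrable (fun z => wt z • v z) := by
  have hae : ∀ᵐ x ∂(volume.restrict A), ∫⁻ z, gagDens v x z < ⊤ := by
    refine ae_lt_top' ?_ hfin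
    exact ((aemeasurable_gagDens hv).lintegral_prod_right').mono_measure Measure.restrict_le_self
  -- a single point `x` with finite interaction energy suffices
  obtain ⟨x, hx⟩ : ∃ x, ∫⁻ z, gagDens v x z < ⊤ := by
    have : NeBot (ae (volume.restrict A)) := ae_neBot.2 (by simpa using hA)
    exact hae.exists
  obtain ⟨C, hC, hCb⟩ := exists_rpow_le_wt n (R := 1) one_pos
  have hg : Integrable (fun z => ‖v x - v z‖ ^ 2 / ‖x - z‖ ^ (n + 1)) := by
    refine ⟨?_, ?_⟩
    · have h3 : AEMeasurable (fun z => ‖v x - v z‖ ^ 2) :=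
        (aestronglyMeasurable_const.sub hv).norm.aemeasurable.pow_const 2
      have h4 : Measurable (fun z : Euc n => ‖x - z‖ ^ (n + 1)) := by fun_prop
      exact (h3.div h4.aemeasurable).aestronglyMeasurable
    · rw [hasFiniteIntegral_iff_ofReal (Eventually.of_forall fun y => by positivity)]
      exact hx
  -- the weight `(1 + |z|²)^(-(n+1)/2)` is comparable to the one centered at `x`
  set c : ℝ := 2 + 2 * ‖x‖ ^ 2 with hc
  have hwt : ∀ z, z ≠ x → wt z ≤ c ^ (((n : ℝ) + 1) / 2) * (1 / ‖x - z‖ ^ (n + 1)) := by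
    intro z hz
    have hpos : 0 < ‖x - z‖ := norm_pos_iff.2 (sub_ne_zero.2 hz.symm)
    rw [← rpow_normSq_eq]
    have h1 : ‖x - z‖ ^ 2 ≤ c * (1 + ‖z‖ ^ 2) := by
      have := norm_sub_le x z
      nlinarith [norm_nonneg x, norm_nonneg z, sq_nonneg (‖x‖ - ‖z‖), norm_nonneg (x - z),
        mul_nonneg (sq_nonneg ‖x‖) (sq_nonneg ‖z‖)]
    have h2 : (c * (1 + ‖z‖ ^ 2)) ^ (-(((n : ℝ) + 1) / 2)) ≤
        (‖x - z‖ ^ 2) ^ (-(((n : ℝ) + 1) / 2)) :=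
      Real.rpow_le_rpow_of_nonpos (by positivity) h1 (neg_nonpos.2 (by positivity))
    rw [Real.mul_rpow (by positivity) (by positivity), Real.rpow_neg (by positivity : 0 ≤ c),
      inv_mul_le_iff₀ (by positivity)] at h2
    exact h2
  refine Integrable.mono' (((integrable_wt n).const_mul (1 + ‖v x‖)).add
    (hg.const_mul (c ^ (((n : ℝ) + 1) / 2)))) (continuous_wt.aestronglyMeasurable.smul hv) ?_
  refine Eventually.of_forall fun z => ?_
  have hw := wt_pos z
  rw [norm_smul, Real.norm_eq_abs, abs_of_pos hw]
  simp only [Pi.add_apply]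
  rcases eq_or_ne z x with rfl | hz
  -- at `z = x` the quotient in the dominating function is `0 / 0 = 0`
  · simp
    nlinarith
  · have h1 : ‖v z‖ ≤ 1 + ‖v x‖ + ‖v x - v z‖ ^ 2 := by
      have : ‖v z‖ ≤ ‖v x‖ + ‖v x - v z‖ := by
        calc ‖v z‖ = ‖v x - (v x - v z)‖ := by rw [sub_sub_cancel]
          _ ≤ _ := norm_sub_le _ _
      nlinarith [sq_nonneg (‖v x - v z‖ - 1), norm_nonneg (v x - v z)]
    have h2 := mul_le_mul_of_nonneg_right (hwt z hz) (sq_nonneg ‖v x - v z‖)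
    calc wt z * ‖v z‖ ≤ wt z * (1 + ‖v x‖ + ‖v x - v z‖ ^ 2) := by gcongr
      _ = (1 + ‖v x‖) * wt z + wt z * ‖v x - v z‖ ^ 2 := by ring
      _ ≤ _ := by
        refine add_le_add le_rfl (h2.trans_eq ?_)
        ring

theorem continuous_sub_incl (X : Euc (n + 1)) : Continuous fun z : Euc n => X - incl z :=
  continuous_const.sub continuous_incl

section Kernel

variable {v : Euc n → Euc m} (hv : Integrable (fun z => wt z • v z))

include hv in
theorem integrable_kernel_smul {κ : Euc (n + 1) → ℝ} (hκ : Measurable κ) {C : ℝ} {X : Euc (n + 1)}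
    (h : ∀ z, |κ (X - incl z)| ≤ C * wt z) : Integrable (fun z => κ (X - incl z) • v z) := by
  refine Integrable.mono' (hv.norm.const_mul C)
    ((hκ.comp (continuous_sub_incl X).measurable).aestronglyMeasurable.smul
      (aestronglyMeasurable_of_wt hv)) (Eventually.of_forall fun z => ?_)
  rw [norm_smul, norm_smul, ← mul_assoc, Real.norm_eq_abs, Real.norm_eq_abs, abs_of_pos (wt_pos z)]
  exact mul_le_mul_of_nonneg_right (h z) (norm_nonneg _)

include hv in
theorem integrable_pker_smul {X : Euc (n + 1)} (hX : 0 < height X) :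
    Integrable (fun z => pker (X - incl z) • v z) := by
  obtain ⟨C, _, h⟩ := exists_abs_pker_le n (R := ‖X‖) hX
  exact integrable_kernel_smul hv measurable_pker (h X le_rfl le_rfl)

include hv in
theorem integrable_dpker_smul {X : Euc (n + 1)} (hX : 0 < height X) (i : Fin (n + 1)) :
    Integrable (fun z => dpker i (X - incl z) • v z) := by
  obtain ⟨C, _, h⟩ := exists_abs_dpker_le n (R := ‖X‖) hX
  exact integrable_kernel_smul hv (measurable_dpker i) fun z => h X le_rfl le_rfl z i

theorem harmExt_eq (v : Euc n → Euc m) (X : Euc (n + 1)) :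
    harmExt v X = ∫ z, pker (X - incl z) • v z := by
  simp only [harmExt, poissonKernel_eq]

theorem integrable_pker_sub {t : ℝ} (ht : 0 < t) (x : Euc n) :
    Integrable (fun z => pker (join x t - incl z)) := by
  simp only [sub_incl_join]
  exact (integrable_pker_join ht).comp_sub_left x

theorem integral_pker_sub {t : ℝ} (ht : 0 < t) (x : Euc n) :
    ∫ z, pker (join x t - incl z) = 1 := by
  simp only [sub_incl_join]
  rw [integral_sub_left_eq_self (fun y : Euc n => pker (join y t)), integral_pker_join ht]

theorem integrable_dpker_sub {t : ℝ} (ht : 0 < t) (x : Euc n) (i : Fin (n + 1)) :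
    Integrable (fun z => dpker i (join x t - incl z)) := by
  simp only [sub_incl_join]
  exact (integrable_dpker_join i ht).comp_sub_left x

theorem integral_dpker_sub {t : ℝ} (ht : 0 < t) (x : Euc n) (i : Fin (n + 1)) :
    ∫ z, dpker i (join x t - incl z) = 0 := by
  simp only [sub_incl_join]
  rw [integral_sub_left_eq_self (fun y : Euc n => dpker i (join y t)), integral_dpker_join i ht]

include hv in
theorem harmExt_sub_const {t : ℝ} (ht : 0 < t) (x : Euc n) (c : Euc m) :
    harmExt v (join x t) - c = ∫ z, pker (join x t - incl z) • (v z - c) := by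
  simp only [smul_sub]
  rw [integral_sub (integrable_pker_smul hv (by simpa using ht))
    ((integrable_pker_sub ht x).smul_const c), integral_smul_const, integral_pker_sub ht, one_smul,
    harmExt_eq]

include hv in
/-- Constants can be subtracted from the data, because the derivatives of the kernel have mean zero. -/
theorem harmGrad_eq_sub_const {t : ℝ} (ht : 0 < t) (x : Euc n) (i : Fin (n + 1)) (c : Euc m) :
    harmGrad v (join x t) i = ∫ z, dpker i (join x t - incl z) • (v z - c) := by
  simp only [smul_sub]
  rw [integral_sub (integrable_dpker_smul hv (by simpa using ht) i)
    ((integrable_dpker_sub ht x i).smul_const c), integral_smul_const, integral_dpker_sub ht,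
    zero_smul, sub_zero, harmGrad]

theorem aestronglyMeasurable_kernel {κ : Euc (n + 1) → ℝ} (hκ : Measurable κ)
    (hv : AEStronglyMeasurable v) :
    AEStronglyMeasurable (fun p : Euc (n + 1) × Euc n => κ (p.1 - incl p.2) • v p.2)
      (volume.prod volume) := by
  have h1 : Measurable fun p : Euc (n + 1) × Euc n => κ (p.1 - incl p.2) :=
    hκ.comp (continuous_fst.sub (continuous_incl.comp continuous_snd)).measurable
  exact h1.aestronglyMeasurable.smul hv.comp_snd

theorem aestronglyMeasurable_harmExt (hv : AEStronglyMeasurable v) :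
    AEStronglyMeasurable (harmExt v) := by
  have h := (aestronglyMeasurable_kernel (measurable_pker (n := n)) hv).integral_prod_right'
  simpa only [harmExt_eq, funext (harmExt_eq v)] using h

theorem aestronglyMeasurable_harmGrad (hv : AEStronglyMeasurable v) (i : Fin (n + 1)) :
    AEStronglyMeasurable (fun X => harmGrad v X i) :=
  (aestronglyMeasurable_kernel (measurable_dpker i) hv).integral_prod_right'

theorem norm_integral_kernel_le {κ : Euc (n + 1) → ℝ} {C : ℝ} {X : Euc (n + 1)}
    (hv : Integrable (fun z => wt z • v z))
    (h : ∀ z, |κ (X - incl z)| ≤ C * wt z) :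
    ‖∫ z, κ (X - incl z) • v z‖ ≤ C * ∫ z, ‖wt z • v z‖ := by
  rw [← integral_const_mul]
  refine norm_integral_le_of_norm_le (hv.norm.const_mul C) (Eventually.of_forall fun z => ?_)
  rw [norm_smul, norm_smul, ← mul_assoc, Real.norm_eq_abs, Real.norm_eq_abs, abs_of_pos (wt_pos z)]
  exact mul_le_mul_of_nonneg_right (h z) (norm_nonneg _)

include hv in
theorem exists_norm_harmExt_le (R : ℝ) {δ : ℝ} (hδ : 0 < δ) :
    ∃ C : ℝ, ∀ X : Euc (n + 1), ‖X‖ ≤ R → δ ≤ height X →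
      ‖harmExt v X‖ ≤ C ∧ ∀ i, ‖harmGrad v X i‖ ≤ C := by
  obtain ⟨C₁, h₁, H₁⟩ := exists_abs_pker_le n (R := R) hδ
  obtain ⟨C₂, h₂, H₂⟩ := exists_abs_dpker_le n (R := R) hδ
  refine ⟨max C₁ C₂ * ∫ z, ‖wt z • v z‖, fun X hX hδX => ⟨?_, fun i => ?_⟩⟩
  · rw [harmExt_eq]
    exact norm_integral_kernel_le hv fun z => (H₁ X hX hδX z).trans
      (mul_le_mul_of_nonneg_right (le_max_left _ _) (wt_pos z).le)
  · exact norm_integral_kernel_le hv fun z => (H₂ X hX hδX z i).trans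
      (mul_le_mul_of_nonneg_right (le_max_right _ _) (wt_pos z).le)

end Kernel

end Extension

end HalfLap

/-! ### Energy bounds for the harmonic extension -/

namespace HalfLap

section ExtensionEnergy

variable {n m : ℕ}

/-- Fubini's theorem for the pairing of a kernel applied to `v` with an integrable function. -/
theorem integral_bilin_kernel {α E F : Type*} [MeasurableSpace α] {μ : Measure α} [SFinite μ]
    [NormedAddCommGroup E] [NormedSpace ℝ E]
    [CompleteSpace E] [NormedAddCommGroup F] [NormedSpace ℝ F] [CompleteSpace F]
    (B : E →L[ℝ] Euc m →L[ℝ] F)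
    {v : Euc n → Euc m} (hv : Integrable (fun z => wt z • v z))
    {κ : Euc (n + 1) → ℝ} (hκ : Measurable κ) {ξ : α → Euc (n + 1)} (hξ : Measurable ξ)
    {b : α → E} (hb : Integrable b μ) {C : ℝ}
    (h : ∀ᵐ a ∂μ, b a ≠ 0 → ∀ z, |κ (ξ a - incl z)| ≤ C * wt z) :
    Integrable (fun z => B (∫ a, κ (ξ a - incl z) • b a ∂μ) (v z)) ∧
    ∫ a, B (b a) (∫ z, κ (ξ a - incl z) • v z) ∂μ =
      ∫ z, B (∫ a, κ (ξ a - incl z) • b a ∂μ) (v z) := by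
  have hvm := aestronglyMeasurable_of_wt hv
  have hκm : Measurable fun p : α × Euc n => κ (ξ p.1 - incl p.2) :=
    hκ.comp ((hξ.comp measurable_fst).sub (continuous_incl.measurable.comp measurable_snd))
  have hκz : ∀ z : Euc n, Measurable fun a : α => κ (ξ a - incl z) := fun z =>
    hκ.comp (hξ.sub measurable_const)
  have hint : Integrable (fun p : α × Euc n => κ (ξ p.1 - incl p.2) • B (b p.1) (v p.2))
      (μ.prod volume) := by
    refine Integrable.mono' ((hb.norm.mul_prod hv.norm).const_mul (C * ‖B‖)) ?_ ?_
    · refine hκm.aestronglyMeasurable.smul ?_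
      exact B.aestronglyMeasurable_comp₂ hb.aestronglyMeasurable.comp_fst hvm.comp_snd
    · filter_upwards [Measure.quasiMeasurePreserving_fst.ae h] with p hp
      by_cases h0 : b p.1 = 0
      · simp [h0]
      · rw [norm_smul, norm_smul, Real.norm_eq_abs, Real.norm_eq_abs, abs_of_pos (wt_pos p.2)]
        calc |κ (ξ p.1 - incl p.2)| * ‖B (b p.1) (v p.2)‖
            ≤ (C * wt p.2) * (‖B‖ * ‖b p.1‖ * ‖v p.2‖) :=
              mul_le_mul (hp h0 _) (B.le_opNorm₂ _ _) (norm_nonneg _)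
                ((abs_nonneg _).trans (hp h0 p.2))
          _ = _ := by ring
  have e : (fun z => ∫ a, κ (ξ a - incl z) • B (b a) (v z) ∂μ) =
      fun z => B (∫ a, κ (ξ a - incl z) • b a ∂μ) (v z) := by
    funext z
    have hi : Integrable (fun a => κ (ξ a - incl z) • b a) μ := by
      refine Integrable.mono' (hb.norm.const_mul (C * wt z))
        ((hκz z).aestronglyMeasurable.smul hb.aestronglyMeasurable) ?_
      filter_upwards [h] with a ha
      by_cases h0 : b a = 0
      · simp [h0]
      · rw [norm_smul, Real.norm_eq_abs]
        exact mul_le_mul_of_nonneg_right (ha h0 z) (norm_nonneg _)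
    have := (B.flip (v z)).integral_comp_comm hi
    simpa using this
  refine ⟨e ▸ hint.integral_prod_right, ?_⟩
  calc ∫ a, B (b a) (∫ z, κ (ξ a - incl z) • v z) ∂μ
      = ∫ a, (∫ z, κ (ξ a - incl z) • B (b a) (v z)) ∂μ := by
        refine integral_congr_ae ?_
        filter_upwards [h] with a ha
        by_cases h0 : b a = 0
        · simp [h0]
        · rw [← (B (b a)).integral_comp_comm (integrable_kernel_smul hv hκ (ha h0))]
          simp only [map_smul]
    _ = ∫ z, ∫ a, κ (ξ a - incl z) • B (b a) (v z) ∂μ := integral_integral_swap hint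
    _ = _ := by rw [e]

theorem exists_bounds_of_isCompact {K : Set (Euc (n + 1))} (hK : IsCompact K)
    (hKH : K ⊆ upperHalf n) : ∃ R δ : ℝ, 0 < δ ∧ ∀ X ∈ K, ‖X‖ ≤ R ∧ δ ≤ height X := by
  obtain ⟨δ, hδ, h⟩ := hK.exists_forall_le' continuous_height.continuousOn (a := 0)
    fun X hX => hKH hX
  obtain ⟨R, hR⟩ := hK.isBounded.subset_closedBall 0
  exact ⟨R, δ, hδ, fun X hX => ⟨by simpa using hR hX, h X hX⟩⟩

/-- The gradient of the harmonic extension, defined by differentiating the kernel, is its weak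
gradient in the half-space. -/
theorem isWeakGrad_harmExt {v : Euc n → Euc m} (hv : Integrable (fun z => wt z • v z)) :
    IsWeakGrad (upperHalf n) (harmExt v) (harmGrad v) := by
  intro φ hφ hc hsupp i
  obtain ⟨R, δ, hδ, hK⟩ := exists_bounds_of_isCompact hc.isCompact hsupp
  obtain ⟨C₁, _, H₁⟩ := exists_abs_pker_le n (R := R) hδ
  obtain ⟨C₂, _, H₂⟩ := exists_abs_dpker_le n (R := R) hδ
  have hφ1 : ContDiff ℝ 1 φ := hφ.of_le (by exact_mod_cast le_top)
  have hmem : ∀ X, φ X ≠ 0 → X ∈ tsupport φ := fun X h => subset_tsupport _ h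
  have hmem' : ∀ X, partialDeriv i φ X ≠ 0 → X ∈ tsupport φ := fun X h =>
    tsupport_partialDeriv_subset φ i (subset_tsupport _ h)
  have e1 := (integral_bilin_kernel (ContinuousLinearMap.lsmul ℝ ℝ) hv (measurable_pker (n := n))
    (μ := volume.restrict (upperHalf n)) (ξ := fun X => X) measurable_id
    (b := partialDeriv i φ)
    ((continuous_partialDeriv hφ1 i).integrable_of_hasCompactSupport
      (hasCompactSupport_partialDeriv hc i)).restrict
    (C := C₁) (Eventually.of_forall fun X h z =>
      H₁ X (hK X (hmem' X h)).1 (hK X (hmem' X h)).2 z)).2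
  have e2 := (integral_bilin_kernel (ContinuousLinearMap.lsmul ℝ ℝ) hv
    (measurable_dpker (n := n) i)
    (μ := volume.restrict (upperHalf n)) (ξ := fun X => X) measurable_id (b := φ)
    (hφ.continuous.integrable_of_hasCompactSupport hc).restrict
    (C := C₂) (Eventually.of_forall fun X h z =>
      H₂ X (hK X (hmem X h)).1 (hK X (hmem X h)).2 z i)).2
  simp only [ContinuousLinearMap.lsmul_apply] at e1 e2
  simp only [harmExt_eq]
  unfold harmGrad
  rw [e1, e2, ← integral_neg]
  refine integral_congr_ae (Eventually.of_forall fun z => ?_)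
  simp only
  rw [← neg_smul]
  congr 1
  -- integration by parts against the smooth kernel, on the support of the test function
  have hz : ∀ X ∈ tsupport φ, X - incl z ≠ 0 := fun X hX => sub_incl_ne_zero (hsupp hX) z
  rw [setIntegral_eq_integral_of_forall_compl_eq_zero, setIntegral_eq_integral_of_forall_compl_eq_zero]
  · have hcont : ∀ {f : Euc (n + 1) → ℝ} {g : Euc (n + 1) → ℝ}, ContinuousOn f {0}ᶜ →
        Continuous g → tsupport g ⊆ tsupport φ →
        Integrable fun X => f (X - incl z) * g X := by
      intro f g hf hg hgs
      have hgc : HasCompactSupport g := hc.of_isClosed_subset (isClosed_tsupport g) hgs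
      have h1 : IntegrableOn (fun X => f (X - incl z) * g X) (tsupport φ) := by
        refine ContinuousOn.integrableOn_compact hc.isCompact ?_
        exact (hf.comp (by fun_prop) fun X hX => hz X hX).mul hg.continuousOn
      refine (integrableOn_iff_integrable_of_support_subset fun X hX => ?_).1 h1
      have : g X ≠ 0 := right_ne_zero_of_mul hX
      exact hgs (subset_tsupport g this)
    refine integral_bilinear_hasLineDerivAt_right_eq_neg_left_of_integrable
      (B := ContinuousLinearMap.mul ℝ ℝ) (v := EuclideanSpace.single i 1)
      (f := fun X => pker (X - incl z)) (f' := fun X => dpker i (X - incl z))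
      (g := φ) (g' := partialDeriv i φ)
      (hcont (continuousOn_dpker i) hφ.continuous le_rfl)
      (hcont continuousOn_pker (continuous_partialDeriv hφ1 i) (tsupport_partialDeriv_subset φ i))
      (hcont continuousOn_pker hφ.continuous le_rfl)
      (fun X hX => hasLineDerivAt_comp_sub (hasLineDerivAt_pker i (hz X hX)))
      (fun X _ => partialDeriv_hasLineDerivAt (hφ1.differentiable one_ne_zero) i X)
  · intro X hX
    have : φ X = 0 := by
      by_contra h; exact hX (hsupp (hmem X h))
    simp [this]
  · intro X hX
    have : partialDeriv i φ X = 0 := by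
      by_contra h; exact hX (hsupp (hmem' X h))
    simp [this]

theorem lintegral_enorm_pker {t : ℝ} (ht : 0 < t) (x : Euc n) :
    ∫⁻ z, ‖pker (join x t - incl z)‖ₑ = 1 := by
  have : ∀ z, ‖pker (join x t - incl z)‖ₑ = ENNReal.ofReal (pker (join (x - z) t)) := fun z => by
    rw [sub_incl_join, Real.enorm_eq_ofReal (pker_join_nonneg ht.le _)]
  simp only [this]
  rw [lintegral_sub_left_eq_self (fun y : Euc n => ENNReal.ofReal (pker (join y t))),
    lintegral_pker ht]

theorem pker_join_le {t : ℝ} (ht : 0 ≤ t) (y : Euc n) (hy : y ≠ 0) :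
    pker (join y t) ≤ gammaConst n * t * (1 / ‖y‖ ^ (n + 1)) := by
  have hγ := gammaConst_pos n
  rw [← rpow_normSq_eq, pker, height_join, norm_sq_join, ← mul_assoc]
  refine mul_le_mul_of_nonneg_left ?_ (by positivity)
  have : 0 < ‖y‖ := norm_pos_iff.2 hy
  refine Real.rpow_le_rpow_of_nonpos (by positivity) ?_ (neg_nonpos.2 (by positivity))
  nlinarith [sq_nonneg t]

/-- Jensen's inequality for the Poisson average. -/
theorem enorm_harmExt_sub_sq_le {v : Euc n → Euc m} (hv : Integrable (fun z => wt z • v z)) {t : ℝ}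
    (ht : 0 < t) (x : Euc n) (c : Euc m) :
    ‖harmExt v (join x t) - c‖ₑ ^ 2 ≤ ∫⁻ z, ‖pker (join x t - incl z)‖ₑ * ‖v z - c‖ₑ ^ 2 := by
  rw [harmExt_sub_const hv ht]
  exact enorm_integral_smul_sq_le
    (measurable_pker.comp (continuous_sub_incl _).measurable).aemeasurable
    ((aestronglyMeasurable_of_wt hv).sub aestronglyMeasurable_const)
    (lintegral_enorm_pker ht x).le

/-- The difference between the extension and its boundary value is controlled by the interaction
energy of the point `x` with the whole space, since `pker` is at most `γₙ t / |y|^(n+1)`. -/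
theorem enorm_harmExt_sub_self_sq_le {v : Euc n → Euc m} (hv : Integrable (fun z => wt z • v z))
    {t : ℝ} (ht : 0 < t) (x : Euc n) :
    ‖harmExt v (join x t) - v x‖ₑ ^ 2 ≤
      ENNReal.ofReal (gammaConst n * t) * ∫⁻ z, gagDens v x z := by
  have hγ := gammaConst_pos n
  refine (enorm_harmExt_sub_sq_le hv ht x (v x)).trans ?_
  rw [← lintegral_const_mul' _ _ ENNReal.ofReal_ne_top]
  refine lintegral_mono fun z => ?_
  simp only
  rcases eq_or_ne z x with rfl | hz
  · simp
  · rw [gagDens_eq, ← mul_assoc, ← ENNReal.ofReal_mul (by positivity), ← enorm_neg (v z - v x),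
      neg_sub]
    refine mul_le_mul_left ?_ _
    rw [sub_incl_join, Real.enorm_eq_ofReal (pker_join_nonneg ht.le _)]
    exact ENNReal.ofReal_le_ofReal (pker_join_le ht.le _ (sub_ne_zero.2 hz.symm))

/-- The one-dimensional integral behind the gradient estimate. -/
theorem lintegral_rpow_mul_bracket_le {s r : ℝ} (hs : 1 / 4 < s) (hr : 0 < r) :
    ∫⁻ t in Ioi (0 : ℝ), ENNReal.ofReal (t ^ (-(1 / 2) : ℝ) * (r ^ 2 + t ^ 2) ^ (-s)) ≤
      ENNReal.ofReal ((2 + 1 / (2 * s - 1 / 2)) * r ^ (1 / 2 - 2 * s)) := by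
  have hs2 : -(1 / 2) - 2 * s < -1 := by linarith
  rw [← Ioc_union_Ioi_eq_Ioi hr.le]
  refine (lintegral_union_le _ _ _).trans ?_
  rw [add_mul, ENNReal.ofReal_add (by positivity)
    (mul_nonneg (one_div_nonneg.2 (by linarith)) (by positivity))]
  refine add_le_add ?_ ?_
  · have hi : IntegrableOn (fun t : ℝ => t ^ (-(1 / 2) : ℝ) * r ^ (-(2 * s))) (Ioc 0 r) :=
      (((intervalIntegral.intervalIntegrable_rpow' (by norm_num)).1).mul_const _)
    have hv : ∫ t in Ioc 0 r, t ^ (-(1 / 2) : ℝ) * r ^ (-(2 * s)) = 2 * r ^ (1 / 2 - 2 * s) := by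
      rw [integral_mul_const, ← intervalIntegral.integral_of_le hr.le,
        integral_rpow (Or.inl (by norm_num))]
      have : r ^ (1 / 2 - 2 * s) = r ^ (1 / 2 : ℝ) * r ^ (-(2 * s)) := by
        rw [← Real.rpow_add hr]; ring_nf
      rw [this, Real.zero_rpow (by norm_num)]
      norm_num
      ring
    rw [← hv, ofReal_integral_eq_lintegral_ofReal hi]
    · refine setLIntegral_mono' measurableSet_Ioc fun t ht => ENNReal.ofReal_le_ofReal ?_
      have ht0 : 0 < t := ht.1
      refine mul_le_mul_of_nonneg_left ?_ (by positivity)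
      have : r ^ (-(2 * s)) = (r ^ 2) ^ (-s) := by
        rw [← Real.rpow_natCast, ← Real.rpow_mul hr.le]; push_cast; ring_nf
      rw [this]
      exact Real.rpow_le_rpow_of_nonpos (by positivity) (by nlinarith) (by linarith)
    · filter_upwards [ae_restrict_mem measurableSet_Ioc] with t ht
      have ht0 : 0 < t := ht.1
      positivity
  · have hi := integrableOn_Ioi_rpow_of_lt hs2 hr
    have hv := integral_Ioi_rpow_of_lt hs2 hr
    have e : -r ^ (-(1 / 2) - 2 * s + 1) / (-(1 / 2) - 2 * s + 1) =
        1 / (2 * s - 1 / 2) * r ^ (1 / 2 - 2 * s) := by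
      have h1 : -(1 / 2) - 2 * s + 1 = 1 / 2 - 2 * s := by ring
      rw [h1]
      have h2 : 2 * s - 1 / 2 ≠ 0 := by linarith
      have h3 : 1 / 2 - 2 * s ≠ 0 := by linarith
      have h4 : 1 / 2 - 2 * s = -(2 * s - 1 / 2) := by ring
      rw [h4, neg_div_neg_eq, div_eq_mul_inv, mul_comm, ← one_div]
    rw [← e, ← hv, ofReal_integral_eq_lintegral_ofReal hi]
    · refine setLIntegral_mono' measurableSet_Ioi fun t ht => ENNReal.ofReal_le_ofReal ?_
      have ht0 : 0 < t := hr.trans ht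
      have : t ^ (-(1 / 2) - 2 * s) = t ^ (-(1 / 2) : ℝ) * (t ^ 2) ^ (-s) := by
        rw [← Real.rpow_natCast t 2, ← Real.rpow_mul ht0.le, ← Real.rpow_add ht0]
        push_cast; ring_nf
      rw [this]
      refine mul_le_mul_of_nonneg_left ?_ (by positivity)
      exact Real.rpow_le_rpow_of_nonpos (by positivity) (by nlinarith) (by linarith)
    · filter_upwards [ae_restrict_mem measurableSet_Ioi] with t ht
      have ht0 : 0 < t := hr.trans ht
      positivity

/-- Pointwise Cauchy-Schwarz bound for the gradient of the extension. The kernel is split in two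
powers, the first of which is integrable, so that the remaining weight in `t` is integrable near
`t = 0`. -/
theorem exists_enorm_harmGrad_sq_le (n : ℕ) : ∃ C : ℝ, 0 < C ∧ ∀ {m : ℕ} {v : Euc n → Euc m},
    Integrable (fun z => wt z • v z) → ∀ (i : Fin (n + 1)) {t : ℝ}, 0 < t → ∀ x,
      ‖harmGrad v (join x t) i‖ₑ ^ 2 ≤ ∫⁻ z, ENNReal.ofReal C *
        (ENNReal.ofReal (t ^ (-(1 / 2) : ℝ) *
          (‖x - z‖ ^ 2 + t ^ 2) ^ (-(((n : ℝ) + 1) / 2 + 1 / 4))) * ‖v x - v z‖ₑ ^ 2) := by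
  have hγ := gammaConst_pos n
  set C₀ := gammaConst n * (n + 2) with hC₀
  -- the kernel is bounded by the power `-(n+1)/2 = -s₁/2 - s₂/2` of `‖x - z‖² + t²`
  set s₁ : ℝ := ((n : ℝ) + 1) / 2 - 1 / 4 with hs₁
  set s₂ : ℝ := ((n : ℝ) + 1) / 2 + 1 / 4 with hs₂
  set c₁ := Real.pi ^ ((n : ℝ) / 2) * Real.Gamma (s₁ - n / 2) / Real.Gamma s₁ with hc₁
  have hs : (n : ℝ) / 2 < s₁ := by rw [hs₁]; linarith
  have hs₁0 : 0 < s₁ := lt_of_le_of_lt (by positivity) hs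
  have hc₁0 : 0 < c₁ := by
    have h1 := Real.Gamma_pos_of_pos (sub_pos.2 hs)
    have h2 := Real.Gamma_pos_of_pos hs₁0
    positivity
  refine ⟨C₀ ^ 2 * c₁, by positivity, fun {m v} hv i {t} ht x => ?_⟩
  have hvm := aestronglyMeasurable_of_wt hv
  have hq : ∀ z, 0 < ‖x - z‖ ^ 2 + t ^ 2 := fun z => by positivity
  have m1 : ∀ s : ℝ, Measurable fun z : Euc n =>
      ENNReal.ofReal ((‖x - z‖ ^ 2 + t ^ 2) ^ s) := fun s => by fun_prop
  have hd : AEMeasurable (fun z => ‖v x - v z‖ₑ) := (aestronglyMeasurable_const.sub hvm).enorm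
  calc ‖harmGrad v (join x t) i‖ₑ ^ 2
      ≤ (∫⁻ z, ENNReal.ofReal C₀ * (ENNReal.ofReal ((‖x - z‖ ^ 2 + t ^ 2) ^ (-s₁ / 2)) *
          (ENNReal.ofReal ((‖x - z‖ ^ 2 + t ^ 2) ^ (-s₂ / 2)) * ‖v x - v z‖ₑ))) ^ 2 := by
        refine pow_le_pow_left' ?_ 2
        rw [harmGrad_eq_sub_const hv ht x i (v x)]
        refine (enorm_integral_le_lintegral_enorm _).trans (lintegral_mono fun z => ?_)
        rw [enorm_smul, ← enorm_neg (v z - v x), neg_sub, ← mul_assoc, ← mul_assoc,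
          mul_assoc (ENNReal.ofReal C₀), ← ENNReal.ofReal_mul (by positivity),
          ← ENNReal.ofReal_mul (by positivity), ← Real.rpow_add (hq z)]
        refine mul_le_mul_left ?_ _
        rw [← ofReal_norm, Real.norm_eq_abs]
        refine ENNReal.ofReal_le_ofReal ((abs_dpker_le i _).trans_eq ?_)
        rw [sub_incl_join, norm_sq_join]
        congr 2
        rw [hs₁, hs₂]; ring
    _ = ENNReal.ofReal C₀ ^ 2 * (∫⁻ z, ENNReal.ofReal ((‖x - z‖ ^ 2 + t ^ 2) ^ (-s₁ / 2)) *
          (ENNReal.ofReal ((‖x - z‖ ^ 2 + t ^ 2) ^ (-s₂ / 2)) * ‖v x - v z‖ₑ)) ^ 2 := by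
        rw [lintegral_const_mul' _ _ ENNReal.ofReal_ne_top, mul_pow]
    _ ≤ ENNReal.ofReal C₀ ^ 2 * ((∫⁻ z, ENNReal.ofReal ((‖x - z‖ ^ 2 + t ^ 2) ^ (-s₁ / 2)) ^ 2) *
          ∫⁻ z, (ENNReal.ofReal ((‖x - z‖ ^ 2 + t ^ 2) ^ (-s₂ / 2)) * ‖v x - v z‖ₑ) ^ 2) := by
        gcongr
        exact sq_lintegral_mul_le (m1 _).aemeasurable ((m1 _).aemeasurable.mul hd)
    _ = ENNReal.ofReal C₀ ^ 2 * ((∫⁻ z, ENNReal.ofReal ((‖x - z‖ ^ 2 + t ^ 2) ^ (-s₁))) *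
          ∫⁻ z, ENNReal.ofReal ((‖x - z‖ ^ 2 + t ^ 2) ^ (-s₂)) * ‖v x - v z‖ₑ ^ 2) := by
        have e : ∀ (s : ℝ) (z : Euc n), ENNReal.ofReal ((‖x - z‖ ^ 2 + t ^ 2) ^ (-s / 2)) ^ 2 =
            ENNReal.ofReal ((‖x - z‖ ^ 2 + t ^ 2) ^ (-s)) := fun s z => by
          rw [← ENNReal.ofReal_pow (by positivity), ← Real.rpow_natCast, ← Real.rpow_mul (hq z).le]
          push_cast
          ring_nf
        simp only [mul_pow, e]
    _ = _ := by
        have e1 : ∫⁻ z, ENNReal.ofReal ((‖x - z‖ ^ 2 + t ^ 2) ^ (-s₁)) =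
            ENNReal.ofReal (c₁ * t ^ (-(1 / 2) : ℝ)) := by
          rw [lintegral_sub_left_eq_self
            (fun y : Euc n => ENNReal.ofReal ((‖y‖ ^ 2 + t ^ 2) ^ (-s₁))),
            lintegral_bracket hs ht, ← Real.rpow_natCast t 2, ← Real.rpow_mul ht.le]
          congr 3
          rw [hs₁]; push_cast; ring
        rw [e1, ← lintegral_const_mul' _ _ ENNReal.ofReal_ne_top,
          ← ENNReal.ofReal_pow (by positivity), ← lintegral_const_mul' _ _ ENNReal.ofReal_ne_top]
        refine lintegral_congr fun z => ?_
        rw [← mul_assoc, ← mul_assoc, ← mul_assoc, ← ENNReal.ofReal_mul (by positivity),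
          ← ENNReal.ofReal_mul (by positivity), ← ENNReal.ofReal_mul (by positivity)]
        congr 2
        ring

/-- The Dirichlet energy of the extension above a set is controlled by the interaction energy of
this set with the whole space. -/
theorem exists_lintegral_harmGrad_le (n : ℕ) : ∃ C : ℝ, 0 < C ∧ ∀ {m : ℕ} {v : Euc n → Euc m},
    Integrable (fun z => wt z • v z) → ∀ (i : Fin (n + 1)) (A : Set (Euc n)),
      ∫⁻ t in Ioi (0 : ℝ), ∫⁻ x in A, ‖harmGrad v (join x t) i‖ₑ ^ 2 ≤
        ENNReal.ofReal C * ∫⁻ x in A, ∫⁻ z, gagDens v x z := by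
  obtain ⟨C, hC, h⟩ := exists_enorm_harmGrad_sq_le n
  set s₂ : ℝ := ((n : ℝ) + 1) / 2 + 1 / 4 with hs₂
  have hs : 1 / 4 < s₂ := by rw [hs₂]; linarith [(by positivity : 0 < ((n : ℝ) + 1) / 2)]
  have hc2 : 0 < 2 + 1 / (2 * s₂ - 1 / 2) := by
    have : 0 < 2 * s₂ - 1 / 2 := by linarith
    positivity
  refine ⟨C * (2 + 1 / (2 * s₂ - 1 / 2)), by positivity, fun {m v} hv i A => ?_⟩
  have hvm := aestronglyMeasurable_of_wt hv
  have hd : AEMeasurable (fun q : (Euc n) × Euc n => ‖v q.1 - v q.2‖ₑ ^ 2)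
      (volume.prod volume) := ((hvm.comp_fst.sub hvm.comp_snd).enorm.pow_const 2)
  have hd' : AEMeasurable (fun q : (Euc n) × Euc n => ‖v q.1 - v q.2‖ₑ ^ 2)
      ((volume.restrict A).prod volume) := hd.mono_measure
        (Measure.prod_mono Measure.restrict_le_self le_rfl)
  set f : ℝ → Euc n → Euc n → ℝ≥0∞ := fun t x z => ENNReal.ofReal C *
        (ENNReal.ofReal (t ^ (-(1 / 2) : ℝ) * (‖x - z‖ ^ 2 + t ^ 2) ^ (-s₂)) *
          ‖v x - v z‖ₑ ^ 2) with hf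
  have hfm : AEMeasurable (fun q : ℝ × (Euc n × Euc n) => f q.1 q.2.1 q.2.2)
      ((volume.restrict (Ioi 0)).prod ((volume.restrict A).prod volume)) := by
    have h1 : Measurable fun q : ℝ × (Euc n × Euc n) =>
        ENNReal.ofReal (q.1 ^ (-(1 / 2) : ℝ) * (‖q.2.1 - q.2.2‖ ^ 2 + q.1 ^ 2) ^ (-s₂)) := by
      fun_prop
    have h2 := hd'.comp_quasiMeasurePreserving
      (Measure.quasiMeasurePreserving_snd (μ := volume.restrict (Ioi (0 : ℝ))))
    exact (h1.aemeasurable.mul h2).const_mul _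
  have hfm2 : ∀ t, AEMeasurable (Function.uncurry (f t)) ((volume.restrict A).prod volume) := by
    intro t
    have h1 : Measurable fun q : (Euc n × Euc n) =>
        ENNReal.ofReal (t ^ (-(1 / 2) : ℝ) * (‖q.1 - q.2‖ ^ 2 + t ^ 2) ^ (-s₂)) := by
      fun_prop
    exact (h1.aemeasurable.mul hd').const_mul _
  calc ∫⁻ t in Ioi (0 : ℝ), ∫⁻ x in A, ‖harmGrad v (join x t) i‖ₑ ^ 2
      ≤ ∫⁻ t in Ioi (0 : ℝ), ∫⁻ x in A, ∫⁻ z, f t x z :=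
        setLIntegral_mono' measurableSet_Ioi fun t ht => lintegral_mono fun x => h hv i ht x
    _ = ∫⁻ t in Ioi (0 : ℝ), ∫⁻ q : Euc n × Euc n, f t q.1 q.2
          ∂((volume.restrict A).prod volume) :=
        lintegral_congr fun t => lintegral_lintegral (hfm2 t)
    _ = ∫⁻ q : Euc n × Euc n, (∫⁻ t in Ioi (0 : ℝ), f t q.1 q.2)
          ∂((volume.restrict A).prod volume) := lintegral_lintegral_swap hfm
    _ ≤ ∫⁻ q : Euc n × Euc n, ENNReal.ofReal (C * (2 + 1 / (2 * s₂ - 1 / 2))) *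
          gagDens v q.1 q.2 ∂((volume.restrict A).prod volume) := by
        refine lintegral_mono fun q => ?_
        simp only [hf]
        rw [lintegral_const_mul' _ _ ENNReal.ofReal_ne_top,
          lintegral_mul_const' _ _ (by finiteness), ENNReal.ofReal_mul hC.le, mul_assoc]
        refine mul_le_mul_right ?_ _
        rcases eq_or_ne q.1 q.2 with hq | hq
        -- on the diagonal both sides vanish
        · simp [hq]
        · have hr : 0 < ‖q.1 - q.2‖ := norm_pos_iff.2 (sub_ne_zero.2 hq)
          rw [gagDens_eq, ← mul_assoc, ← ENNReal.ofReal_mul hc2.le]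
          gcongr
          refine (lintegral_rpow_mul_bracket_le hs hr).trans_eq ?_
          congr 2
          rw [one_div (‖q.1 - q.2‖ ^ (n + 1)), ← Real.rpow_natCast, ← Real.rpow_neg hr.le]
          congr 1
          rw [hs₂]; push_cast; ring
    _ = _ := by
        rw [lintegral_const_mul' _ _ ENNReal.ofReal_ne_top, lintegral_prod]
        exact (aemeasurable_gagDens hvm).mono_measure
          (Measure.prod_mono Measure.restrict_le_self le_rfl)

theorem setLIntegral_cylinder {f : Euc (n + 1) → ℝ≥0∞} (hf : AEMeasurable f) {A : Set (Euc n)}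
    (hA : MeasurableSet A) {T : Set ℝ} (hT : MeasurableSet T) :
    ∫⁻ X in {X | horiz X ∈ A ∧ height X ∈ T}, f X = ∫⁻ t in T, ∫⁻ x in A, f (join x t) := by
  have hm : MeasurableSet {X : Euc (n + 1) | horiz X ∈ A ∧ height X ∈ T} :=
    (continuous_horiz.measurable hA).inter (continuous_height.measurable hT)
  rw [← lintegral_indicator hm, lintegral_join (hf.indicator hm), ← lintegral_indicator hT]
  refine lintegral_congr fun t => ?_
  by_cases ht : t ∈ T
  · simp only [indicator, ht, if_true]
    rw [← lintegral_indicator hA]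
    refine lintegral_congr fun x => ?_
    by_cases hx : x ∈ A <;> simp [indicator, hx, ht]
  · simp [indicator, ht]

end ExtensionEnergy

end HalfLap

/-! ### Mollification on the half-space -/

namespace HalfLap

section Mollify

/-- Translations are continuous in `L²`. -/
theorem tendsto_eLpNorm_translate {d : ℕ} {E : Type*} [NormedAddCommGroup E] {f : Euc d → E}
    (hf : MemLp f 2) :
    Tendsto (fun y => eLpNorm (fun x => f (x - y) - f x) 2) (𝓝 0) (𝓝 0) := by
  let g : Euc d → C(Euc d, Euc d) := fun y => ⟨fun x => x - y, by fun_prop⟩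
  have hg : Continuous g := by
    refine ContinuousMap.continuous_of_continuous_uncurry _ ?_
    simp only [g, Function.uncurry_def, ContinuousMap.coe_mk]
    fun_prop
  have hgm : ∀ y, MeasurePreserving (g y) volume volume := fun y =>
    measurePreserving_sub_right volume y
  have h : Continuous fun y => Lp.compMeasurePreserving (g y) (hgm y) (hf.toLp f) :=
    continuous_const.compMeasurePreservingLp hg hgm (by simp)
  have h2 := (h.tendsto 0).sub (tendsto_const_nhds (x := hf.toLp f))
  have h0 : Lp.compMeasurePreserving (g 0) (hgm 0) (hf.toLp f) = hf.toLp f := by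
    rw [Lp.toLp_compMeasurePreserving]
    congr 1
    ext x; simp [g]
  rw [h0, sub_self] at h2
  have h3 := (continuous_enorm.tendsto _).comp h2
  rw [enorm_zero] at h3
  refine h3.congr fun y => ?_
  simp only [Function.comp]
  rw [Lp.toLp_compMeasurePreserving, ← MemLp.toLp_sub, Lp.enorm_toLp]
  rfl

/-- An average of translations of `f` is as close to `f` in `L²` as the translations are. -/
theorem eLpNorm_average_translate_sub_le {d : ℕ} {E : Type*} [NormedAddCommGroup E]
    [NormedSpace ℝ E] [CompleteSpace E] {f : Euc d → E}
    (hf : MemLp f 2) {ρ : Euc d → ℝ} (hρ : Continuous ρ) (hc : HasCompactSupport ρ)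
    (h0 : ∀ y, 0 ≤ ρ y) (h1 : ∫ y, ρ y = 1) {ε : ℝ≥0∞}
    (hε : ∀ y, ρ y ≠ 0 → eLpNorm (fun x => f (x - y) - f x) 2 ≤ ε) :
    eLpNorm (fun x => (∫ y, ρ y • f (x - y)) - f x) 2 ≤ ε := by
  have hfm := hf.aestronglyMeasurable
  have hρi : Integrable ρ := hρ.integrable_of_hasCompactSupport hc
  have hρ1 : ∫⁻ y, ‖ρ y‖ₑ = 1 := by
    have : ∫⁻ y, ‖ρ y‖ₑ = ∫⁻ y, ENNReal.ofReal (ρ y) :=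
      lintegral_congr fun y => Real.enorm_eq_ofReal (h0 y)
    rw [this, ← ofReal_integral_eq_lintegral_ofReal hρi (Eventually.of_forall h0), h1,
      ENNReal.ofReal_one]
  have hloc : ∀ x, Integrable fun y => ρ y • f (x - y) := fun x => by
    have hli : LocallyIntegrable (fun y => f (x - y)) :=
      (hf.comp_measurePreserving (Measure.measurePreserving_sub_left volume x)).locallyIntegrable
        one_le_two
    exact hli.integrable_smul_left_of_hasCompactSupport hρ hc
  have hm : AEStronglyMeasurable (fun p : Euc d × Euc d => f (p.1 - p.2) - f p.1)
      (volume.prod volume) := by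
    refine AEStronglyMeasurable.sub ?_ hfm.comp_fst
    exact hfm.comp_quasiMeasurePreserving
      (quasiMeasurePreserving_sub_of_right_invariant volume volume)
  rw [← ENNReal.pow_le_pow_left_iff two_ne_zero, eLpNorm_two_sq]
  calc ∫⁻ x, ‖(∫ y, ρ y • f (x - y)) - f x‖ₑ ^ 2
      ≤ ∫⁻ x, ∫⁻ y, ‖ρ y‖ₑ * ‖f (x - y) - f x‖ₑ ^ 2 := by
        refine lintegral_mono fun x => ?_
        have e : (∫ y, ρ y • f (x - y)) - f x = ∫ y, ρ y • (f (x - y) - f x) := by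
          simp only [smul_sub]
          rw [integral_sub (hloc x) (hρi.smul_const _), integral_smul_const, h1, one_smul]
        simp only [e]
        refine enorm_integral_smul_sq_le hρ.measurable.aemeasurable ?_ hρ1.le
        refine AEStronglyMeasurable.sub ?_ aestronglyMeasurable_const
        exact hfm.comp_measurePreserving (Measure.measurePreserving_sub_left volume x)
    _ = ∫⁻ y, ∫⁻ x, ‖ρ y‖ₑ * ‖f (x - y) - f x‖ₑ ^ 2 := by
        apply lintegral_lintegral_swap
        exact (hρ.measurable.comp measurable_snd).enorm.aemeasurable.mul (hm.enorm.pow_const 2)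
    _ ≤ ∫⁻ y, ‖ρ y‖ₑ * ε ^ 2 := by
        refine lintegral_mono fun y => ?_
        simp only
        rw [lintegral_const_mul' _ _ (by finiteness)]
        rcases eq_or_ne (ρ y) 0 with hy | hy
        · simp [hy]
        · refine mul_le_mul_right ?_ _
          rw [← eLpNorm_two_sq]
          exact pow_le_pow_left' (hε y hy) 2
    _ = ε ^ 2 := by
        rw [lintegral_mul_const _ hρ.measurable.enorm, hρ1, one_mul]

variable {n m : ℕ}

/-- A map of class `H¹` on the half-space vanishing outside a compact set is approximated in `H¹`
by smooth compactly supported maps on the whole space. The mollifier is supported in the lower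
half-space, so that only values in the open half-space are averaged. -/
theorem exists_smooth_approx {f : Euc (n + 1) → Euc m} {G : Euc (n + 1) → Fin (n + 1) → Euc m}
    (hf : MemLp f 2) (hG : ∀ i, MemLp (fun X => G X i) 2)
    (hfH : ∀ X ∉ upperHalf n, f X = 0) (hGH : ∀ X ∉ upperHalf n, ∀ i, G X i = 0)
    (hw : IsWeakGrad (upperHalf n) f G) {K : Set (Euc (n + 1))} (hK : IsCompact K)
    (hfK : ∀ X ∉ K, f X = 0) {ε : ℝ} (hε : 0 < ε) :
    ∃ φ : Euc (n + 1) → Euc m, ContDiff ℝ ∞ φ ∧ HasCompactSupport φ ∧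
      tsupport φ ⊆ Metric.cthickening ε K ∧
      eLpNorm (fun X => φ X - f X) 2 (volume.restrict (upperHalf n)) ≤ ENNReal.ofReal ε ∧
      ∀ i, eLpNorm (fun X => partialDeriv i φ X - G X i) 2 (volume.restrict (upperHalf n)) ≤
        ENNReal.ofReal ε := by
  have hε' : 0 < ENNReal.ofReal ε := by simpa using hε
  -- a radius such that small translations change `f` and `G` by at most `ε` in norm
  obtain ⟨η₀, hη₀, H⟩ : ∃ η₀ > 0, ∀ y : Euc (n + 1), ‖y‖ < η₀ →
      eLpNorm (fun x => f (x - y) - f x) 2 ≤ ENNReal.ofReal ε ∧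
      ∀ i, eLpNorm (fun x => G (x - y) i - G x i) 2 ≤ ENNReal.ofReal ε := by
    have h1 := (tendsto_eLpNorm_translate hf).eventually (ge_mem_nhds hε')
    have h2 : ∀ᶠ y in 𝓝 (0 : Euc (n + 1)), ∀ i,
        eLpNorm (fun x => G (x - y) i - G x i) 2 ≤ ENNReal.ofReal ε :=
      eventually_all.2 fun i => (tendsto_eLpNorm_translate (hG i)).eventually (ge_mem_nhds hε')
    obtain ⟨η₀, hη₀, H⟩ := Metric.eventually_nhds_iff.1 (h1.and h2)
    exact ⟨η₀, hη₀, fun y hy => H (by simpa using hy)⟩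
  set η : ℝ := min η₀ ε / 2 with hη
  have hmin : 0 < min η₀ ε := lt_min hη₀ hε
  have hηpos : 0 < η := by positivity
  set e : Euc (n + 1) := join 0 (-η) with he
  have hen : ‖e‖ = η := by
    have h := norm_sq_join (0 : Euc n) (-η)
    rw [← he] at h
    have h2 : ‖e‖ ^ 2 = η ^ 2 := by simpa using h
    exact (pow_left_inj₀ (norm_nonneg _) hηpos.le two_ne_zero).1 h2
  let b : ContDiffBump e := ⟨η / 4, η / 2, by positivity, by linarith⟩
  set ρ : Euc (n + 1) → ℝ := b.normed volume with hρ
  have hρc : HasCompactSupport ρ := b.hasCompactSupport_normed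
  have hρs : ∀ y, y ∈ tsupport ρ → ‖y - e‖ ≤ η / 2 := fun y hy => by
    rw [hρ, b.tsupport_normed_eq, Metric.mem_closedBall, dist_eq_norm] at hy
    exact hy
  have hρ0 : ∀ y, ρ y ≠ 0 → y ∈ tsupport ρ := fun y hy => subset_tsupport _ hy
  have hsmall : ∀ y ∈ tsupport ρ, ‖y‖ < min η₀ ε := fun y hy => by
    calc ‖y‖ = ‖(y - e) + e‖ := by rw [sub_add_cancel]
      _ ≤ ‖y - e‖ + ‖e‖ := norm_add_le _ _
      _ ≤ η / 2 + η := by rw [hen]; linarith [hρs y hy]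
      _ < min η₀ ε := by rw [hη]; linarith
  have hlow : ∀ y ∈ tsupport ρ, height y < 0 := fun y hy => by
    have h1 := abs_height_le (y - e)
    rw [height_sub, he, height_join] at h1
    have h2 := le_abs_self (height y - -η)
    linarith [hρs y hy]
  have hρcd : ContDiff ℝ ∞ ρ := b.contDiff_normed
  have hfl : LocallyIntegrable f := hf.locallyIntegrable one_le_two
  set L := (ContinuousLinearMap.lsmul ℝ ℝ : ℝ →L[ℝ] Euc m →L[ℝ] Euc m).flip with hL
  set φ : Euc (n + 1) → Euc m := convolution f ρ L volume with hφ
  have hφe : ∀ X, φ X = ∫ y, ρ y • f (X - y) := fun X => by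
    rw [hφ, convolution_eq_swap]
    rfl
  have hφd : ∀ i X, partialDeriv i φ X = ∫ t, partialDeriv i ρ (X - t) • f t := fun i X => by
    have h := hρc.hasFDerivAt_convolution_right L hfl (hρcd.of_le (by exact_mod_cast le_top)) X
    rw [partialDeriv, h.fderiv, convolution_precompR_apply L hfl (hρc.fderiv ℝ)
      ((hρcd.of_le (by exact_mod_cast le_top : (1 : WithTop ℕ∞) ≤ (⊤ : ℕ∞))).continuous_fderiv one_ne_zero)]
    rfl
  have hsuppφ : tsupport φ ⊆ Metric.cthickening ε K := by
    refine closure_minimal (fun X hX => ?_) Metric.isClosed_cthickening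
    have hX : φ X ≠ 0 := hX
    rw [hφe] at hX
    obtain ⟨y, hy⟩ : ∃ y, ρ y • f (X - y) ≠ 0 := by
      by_contra h
      push Not at h
      exact hX (by simp [h])
    have hy1 := left_ne_zero_of_smul hy
    have hy2 := right_ne_zero_of_smul hy
    have hyK : X - y ∈ K := by
      by_contra h; exact hy2 (hfK _ h)
    refine Metric.mem_cthickening_of_dist_le X (X - y) ε K hyK ?_
    rw [dist_eq_norm, sub_sub_cancel]
    exact ((hsmall y (hρ0 y hy1)).le).trans (min_le_right _ _)
  refine ⟨φ, hρc.contDiff_convolution_right L hfl hρcd, ?_, hsuppφ, ?_, fun i => ?_⟩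
  · exact (hK.cthickening).of_isClosed_subset (isClosed_tsupport _) hsuppφ
  · refine (eLpNorm_mono_measure _ Measure.restrict_le_self).trans ?_
    simp only [hφe]
    exact eLpNorm_average_translate_sub_le hf hρcd.continuous hρc (fun y => b.nonneg_normed y)
      b.integral_normed fun y hy =>
        (H y ((hsmall y (hρ0 y hy)).trans_le (min_le_left _ _))).1
  · have hd : ∀ X ∈ upperHalf n, partialDeriv i φ X = ∫ y, ρ y • G (X - y) i := by
      intro X hX
      have hX : 0 < height X := hX
      rw [hφd]
      have hψcd : ContDiff ℝ ∞ fun Z => ρ (X - Z) := hρcd.comp (by fun_prop)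
      have hψt : tsupport (fun Z => ρ (X - Z)) = (fun Z => X - Z) ⁻¹' tsupport ρ :=
        tsupport_comp_eq_preimage ρ (Homeomorph.subLeft X)
      have hψc : HasCompactSupport fun Z => ρ (X - Z) :=
        hρc.comp_homeomorph (Homeomorph.subLeft X)
      have hψs : tsupport (fun Z => ρ (X - Z)) ⊆ upperHalf n := by
        rw [hψt]
        intro Z hZ
        have := hlow _ hZ
        rw [height_sub] at this
        change 0 < height Z
        linarith
      have hψd : ∀ Z, partialDeriv i (fun Z => ρ (X - Z)) Z = -partialDeriv i ρ (X - Z) := by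
        intro Z
        have h1 : HasFDerivAt ρ (fderiv ℝ ρ (X - Z)) (X - Z) :=
          (hρcd.differentiable (by simp) _).hasFDerivAt
        have h2 := h1.comp Z ((hasFDerivAt_id Z).const_sub X)
        have h3 : fderiv ℝ (fun Z => ρ (X - Z)) Z = _ := h2.fderiv
        rw [partialDeriv, h3, partialDeriv]
        simp
      have h := hw _ hψcd hψc hψs i
      rw [setIntegral_eq_integral_of_forall_compl_eq_zero (fun Z hZ => by rw [hfH Z hZ, smul_zero]),
        setIntegral_eq_integral_of_forall_compl_eq_zero
          (fun Z hZ => by rw [hGH Z hZ, smul_zero])] at h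
      simp only [hψd, neg_smul, integral_neg, neg_inj] at h
      rw [h, ← integral_sub_left_eq_self (fun y => ρ y • G (X - y) i) volume X]
      simp
    refine (eLpNorm_congr_ae ?_).trans_le ((eLpNorm_mono_measure _ Measure.restrict_le_self).trans
      (eLpNorm_average_translate_sub_le (hG i) hρcd.continuous hρc (fun y => b.nonneg_normed y)
      b.integral_normed fun y hy =>
        (H y ((hsmall y (hρ0 y hy)).trans_le (min_le_left _ _))).2 i))
    filter_upwards [ae_restrict_mem measurableSet_upperHalf] with X hX
    rw [hd X hX]

end Mollify

end HalfLap

/-! ### Traces on the boundary hyperplane -/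

namespace HalfLap

section Trace

/-- The one-dimensional trace inequality: integrate the derivative of `‖g‖²` over the half-line. -/
theorem enorm_sq_le_lintegral_Ioi {E : Type*} [NormedAddCommGroup E] [InnerProductSpace ℝ E]
    {g g' : ℝ → E} (hg : ∀ s, HasDerivAt g (g' s) s) (hg' : Continuous g')
    (hc : HasCompactSupport g) (hc' : HasCompactSupport g') :
    ‖g 0‖ₑ ^ 2 ≤ (∫⁻ s in Ioi (0 : ℝ), ‖g s‖ₑ ^ 2) + ∫⁻ s in Ioi (0 : ℝ), ‖g' s‖ₑ ^ 2 := by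
  have hgc : Continuous g := continuous_iff_continuousAt.2 fun s => (hg s).continuousAt
  have hd : ∀ s ∈ Ici (0 : ℝ), HasDerivAt (fun s => ‖g s‖ ^ 2) (2 * inner ℝ (g s) (g' s)) s :=
    fun s _ => (hg s).norm_sq
  have hi : IntegrableOn (fun s => 2 * inner ℝ (g s) (g' s)) (Ioi 0) := by
    refine (Continuous.integrable_of_hasCompactSupport (by fun_prop) ?_).integrableOn
    refine hc.mono fun s hs => ?_
    intro h0
    exact hs (by simp [h0])
  have hlim : Tendsto (fun s => ‖g s‖ ^ 2) atTop (𝓝 0) := by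
    have hc2 : HasCompactSupport fun s => ‖g s‖ ^ 2 := hc.comp_left (g := fun x => ‖x‖ ^ 2) (by simp)
    exact hc2.is_zero_at_infty.mono_left atTop_le_cocompact
  have h := integral_Ioi_of_hasDerivAt_of_tendsto' hd hi hlim
  have i1 : IntegrableOn (fun s => ‖g s‖ ^ 2) (Ioi 0) :=
    (Continuous.integrable_of_hasCompactSupport (by fun_prop)
      (hc.comp_left (g := fun x => ‖x‖ ^ 2) (by simp))).integrableOn
  have i2 : IntegrableOn (fun s => ‖g' s‖ ^ 2) (Ioi 0) :=
    (Continuous.integrable_of_hasCompactSupport (by fun_prop)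
      (hc'.comp_left (g := fun x => ‖x‖ ^ 2) (by simp))).integrableOn
  have hle : ‖g 0‖ ^ 2 ≤ (∫ s in Ioi (0 : ℝ), ‖g s‖ ^ 2) + ∫ s in Ioi (0 : ℝ), ‖g' s‖ ^ 2 := by
    rw [← integral_add i1 i2]
    have : ‖g 0‖ ^ 2 = ∫ s in Ioi (0 : ℝ), -(2 * inner ℝ (g s) (g' s)) := by
      rw [integral_neg, h]; ring
    rw [this]
    refine integral_mono hi.neg (i1.add i2) fun s => ?_
    have h1 := norm_add_sq_real (g s) (g' s)
    have h2 := sq_nonneg ‖g s + g' s‖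
    simp only
    linarith
  have e : ∀ a : E, ‖a‖ₑ ^ 2 = ENNReal.ofReal (‖a‖ ^ 2) := fun a => by
    rw [← ofReal_norm, ENNReal.ofReal_pow (norm_nonneg _)]
  simp only [e]
  rw [← ofReal_integral_eq_lintegral_ofReal i1 (Eventually.of_forall fun s => by positivity),
    ← ofReal_integral_eq_lintegral_ofReal i2 (Eventually.of_forall fun s => by positivity),
    ← ENNReal.ofReal_add (integral_nonneg fun s => by positivity)
      (integral_nonneg fun s => by positivity)]
  exact ENNReal.ofReal_le_ofReal hle

/-- The fundamental theorem of calculus and the Cauchy-Schwarz inequality on `(0, t)`. -/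
theorem enorm_sub_sq_le_lintegral_Ioi {E : Type*} [NormedAddCommGroup E] [InnerProductSpace ℝ E]
    [CompleteSpace E] {g g' : ℝ → E} (hg : ∀ s, HasDerivAt g (g' s) s) (hg' : Continuous g')
    {t : ℝ} (ht : 0 < t) :
    ‖g t - g 0‖ₑ ^ 2 ≤ ENNReal.ofReal t * ∫⁻ s in Ioi (0 : ℝ), ‖g' s‖ₑ ^ 2 := by
  have h := intervalIntegral.integral_eq_sub_of_hasDerivAt (fun s _ => hg s)
    (hg'.intervalIntegrable 0 t)
  rw [← h, intervalIntegral.integral_of_le ht.le]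
  calc ‖∫ s in Ioc 0 t, g' s‖ₑ ^ 2 ≤ (∫⁻ s in Ioc 0 t, 1 * ‖g' s‖ₑ) ^ 2 := by
        simp only [one_mul]
        exact pow_le_pow_left' (enorm_integral_le_lintegral_enorm _) 2
    _ ≤ _ := sq_lintegral_mul_le aemeasurable_const
        (continuous_enorm.comp hg').measurable.aemeasurable
    _ ≤ _ := by
        simp only [one_pow, lintegral_one, Measure.restrict_apply MeasurableSet.univ, univ_inter,
          Real.volume_Ioc, sub_zero]
        gcongr
        exact Ioc_subset_Ioi_self

variable {n m : ℕ}

theorem lintegral_upperHalf {f : Euc (n + 1) → ℝ≥0∞} (hf : Measurable f) :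
    ∫⁻ X in upperHalf n, f X = ∫⁻ x, ∫⁻ s in Ioi (0 : ℝ), f (join x s) := by
  have h := setLIntegral_cylinder hf.aemeasurable (MeasurableSet.univ (α := Euc n))
    (measurableSet_Ioi (a := (0 : ℝ)))
  simp only [mem_univ, true_and, Measure.restrict_univ] at h
  have e : {X : Euc (n + 1) | height X ∈ Ioi (0 : ℝ)} = upperHalf n := rfl
  rw [e] at h
  rw [h]
  refine lintegral_lintegral_swap (Measurable.aemeasurable ?_)
  exact hf.comp (continuous_join.comp continuous_swap).measurable

theorem hasDerivAt_join_of_contDiff {φ : Euc (n + 1) → Euc m} (hφ : ContDiff ℝ 1 φ) (x : Euc n)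
    (s : ℝ) : HasDerivAt (fun s => φ (join x s)) (partialDeriv (Fin.last n) φ (join x s)) s :=
  hasDerivAt_join_of_hasLineDerivAt
    (partialDeriv_hasLineDerivAt (hφ.differentiable one_ne_zero) (Fin.last n) (join x s))

theorem continuous_join_right (x : Euc n) : Continuous fun s : ℝ => join x s :=
  continuous_join.comp (by fun_prop : Continuous fun s : ℝ => (x, s))

theorem hasCompactSupport_join_right {E : Type*} [Zero E] {φ : Euc (n + 1) → E}
    (hc : HasCompactSupport φ) (x : Euc n) : HasCompactSupport fun s : ℝ => φ (join x s) := by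
  refine HasCompactSupport.intro (hc.isCompact.image continuous_height) fun s hs => ?_
  exact image_eq_zero_of_notMem_tsupport fun h => hs ⟨_, h, by simp⟩

theorem hasCompactSupport_incl {E : Type*} [Zero E] {φ : Euc (n + 1) → E}
    (hc : HasCompactSupport φ) : HasCompactSupport fun x : Euc n => φ (incl x) := by
  refine HasCompactSupport.intro (hc.isCompact.image continuous_horiz) fun s hs => ?_
  exact image_eq_zero_of_notMem_tsupport fun h => hs ⟨_, h, by simp⟩

/-- The trace inequality for smooth compactly supported maps. -/
theorem lintegral_trace_le {φ : Euc (n + 1) → Euc m} (hφ : ContDiff ℝ 1 φ)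
    (hc : HasCompactSupport φ) :
    ∫⁻ x, ‖φ (incl x)‖ₑ ^ 2 ≤ (∫⁻ X in upperHalf n, ‖φ X‖ₑ ^ 2) +
      ∫⁻ X in upperHalf n, ‖partialDeriv (Fin.last n) φ X‖ₑ ^ 2 := by
  have m1 : Measurable fun X => ‖φ X‖ₑ ^ 2 := hφ.continuous.measurable.enorm.pow_const 2
  have m2 : Measurable fun X => ‖partialDeriv (Fin.last n) φ X‖ₑ ^ 2 :=
    (continuous_partialDeriv hφ _).measurable.enorm.pow_const 2
  rw [lintegral_upperHalf m1, lintegral_upperHalf m2, ← lintegral_add_left]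
  · refine lintegral_mono fun x => ?_
    exact enorm_sq_le_lintegral_Ioi (fun s => hasDerivAt_join_of_contDiff hφ x s)
      ((continuous_partialDeriv hφ _).comp (continuous_join_right x))
      (hasCompactSupport_join_right hc x)
      (hasCompactSupport_join_right (hasCompactSupport_partialDeriv hc _) x)
  · exact Measurable.lintegral_prod_right' (f := fun p : Euc n × ℝ => ‖φ (join p.1 p.2)‖ₑ ^ 2)
      (m1.comp continuous_join.measurable)

/-- The slices at height `t` of a smooth map converge to its boundary values in `L²` at the rate `√t`,
with a constant given by the vertical part of its Dirichlet energy. -/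
theorem lintegral_sub_trace_le {φ : Euc (n + 1) → Euc m} (hφ : ContDiff ℝ 1 φ) {t : ℝ}
    (ht : 0 < t) :
    ∫⁻ x, ‖φ (join x t) - φ (incl x)‖ₑ ^ 2 ≤
      ENNReal.ofReal t * ∫⁻ X in upperHalf n, ‖partialDeriv (Fin.last n) φ X‖ₑ ^ 2 := by
  have m2 : Measurable fun X => ‖partialDeriv (Fin.last n) φ X‖ₑ ^ 2 :=
    (continuous_partialDeriv hφ _).measurable.enorm.pow_const 2
  rw [lintegral_upperHalf m2, ← lintegral_const_mul' _ _ ENNReal.ofReal_ne_top]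
  refine lintegral_mono fun x => ?_
  exact enorm_sub_sq_le_lintegral_Ioi (fun s => hasDerivAt_join_of_contDiff hφ x s)
    ((continuous_partialDeriv hφ _).comp (continuous_join_right x)) ht

/-- A sequence of smooth compactly supported maps converging to `f` in `H¹` of the half-space, with
gradients converging to `G` and boundary values converging to `τ`. -/
structure IsHalfApprox (f : Euc (n + 1) → Euc m) (G : Euc (n + 1) → Fin (n + 1) → Euc m)
    (τ : Euc n → Euc m) (φ : ℕ → Euc (n + 1) → Euc m) : Prop where
  contDiff : ∀ k, ContDiff ℝ ∞ (φ k)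
  hasCompactSupport : ∀ k, HasCompactSupport (φ k)
  tendsto : Tendsto (fun k => eLpNorm (fun X => φ k X - f X) 2 (volume.restrict (upperHalf n)))
    atTop (𝓝 0)
  tendsto_grad : ∀ i, Tendsto (fun k => eLpNorm (fun X => partialDeriv i (φ k) X - G X i) 2
    (volume.restrict (upperHalf n))) atTop (𝓝 0)
  tendsto_trace : Tendsto (fun k => eLpNorm (fun x => φ k (incl x) - τ x) 2) atTop (𝓝 0)

theorem contDiff_one_of_infty {E F : Type*} [NormedAddCommGroup E] [NormedSpace ℝ E]
    [NormedAddCommGroup F] [NormedSpace ℝ F] {φ : E → F} (h : ContDiff ℝ ∞ φ) : ContDiff ℝ 1 φ :=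
  h.of_le (by exact_mod_cast le_top)

theorem partialDeriv_sub {d : ℕ} {E : Type*} [NormedAddCommGroup E] [NormedSpace ℝ E]
    {φ ψ : Euc d → E} (hφ : ContDiff ℝ 1 φ) (hψ : ContDiff ℝ 1 ψ) (i : Fin d) (X : Euc d) :
    partialDeriv i (fun Y => φ Y - ψ Y) X = partialDeriv i φ X - partialDeriv i ψ X := by
  have := fderiv_sub (hφ.differentiable one_ne_zero X) (hψ.differentiable one_ne_zero X)
  unfold partialDeriv
  change (fderiv ℝ (φ - ψ) X) _ = _
  rw [this]; rfl

/-- The trace inequality for smooth compactly supported maps, in terms of `L²` norms. -/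
theorem eLpNorm_trace_le {φ : Euc (n + 1) → Euc m} (hφ : ContDiff ℝ 1 φ)
    (hc : HasCompactSupport φ) :
    eLpNorm (fun x => φ (incl x)) 2 ≤ eLpNorm φ 2 (volume.restrict (upperHalf n)) +
      eLpNorm (partialDeriv (Fin.last n) φ) 2 (volume.restrict (upperHalf n)) := by
  rw [← ENNReal.pow_le_pow_left_iff two_ne_zero, eLpNorm_two_sq]
  refine (lintegral_trace_le hφ hc).trans ?_
  rw [← eLpNorm_two_sq, ← eLpNorm_two_sq, add_sq]
  exact add_le_add_left le_self_add _

/-- A compactly supported `H¹` map of the half-space has smooth approximations whose supports shrink to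
its own; their boundary values form a Cauchy sequence by the trace inequality. -/
theorem exists_isHalfApprox {f : Euc (n + 1) → Euc m} {G : Euc (n + 1) → Fin (n + 1) → Euc m}
    (hf : MemLp f 2) (hG : ∀ i, MemLp (fun X => G X i) 2)
    (hfH : ∀ X ∉ upperHalf n, f X = 0) (hGH : ∀ X ∉ upperHalf n, ∀ i, G X i = 0)
    (hw : IsWeakGrad (upperHalf n) f G) {K : Set (Euc (n + 1))} (hK : IsCompact K)
    (hfK : ∀ X ∉ K, f X = 0) :
    ∃ τ φ, MemLp τ 2 ∧ IsHalfApprox f G τ φ ∧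
      ∀ ε > 0, ∀ᶠ k in atTop, tsupport (φ k) ⊆ Metric.cthickening ε K := by
  set r : ℕ → ℝ := fun k => (1 / 2) ^ k with hr
  have hr0 : ∀ k, 0 < r k := fun k => by positivity
  have hrlim : Tendsto r atTop (𝓝 0) := tendsto_pow_atTop_nhds_zero_of_lt_one (by norm_num)
    (by norm_num)
  have hrlim' : Tendsto (fun k => ENNReal.ofReal (r k)) atTop (𝓝 0) := by
    simpa using ENNReal.tendsto_ofReal hrlim
  have hra : ∀ {N k}, N ≤ k → r k ≤ r N := fun h =>
    pow_le_pow_of_le_one (by norm_num) (by norm_num) h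
  choose φ h1 h2 h3 h4 h5 using fun k => exists_smooth_approx hf hG hfH hGH hw hK hfK (hr0 k)
  have hd : ∀ k, ContDiff ℝ 1 (φ k) := fun k => contDiff_one_of_infty (h1 k)
  have hmem : ∀ k, MemLp (fun x => φ k (incl x)) 2 := fun k =>
    ((h1 k).continuous.comp continuous_incl).memLp_of_hasCompactSupport
      (hasCompactSupport_incl (h2 k))
  -- the boundary values form a Cauchy sequence in `L²`, with summable rates
  have key : ∀ N k l : ℕ, N ≤ k → N ≤ l →
      eLpNorm ((fun x => φ k (incl x)) - fun x => φ l (incl x)) 2 < ENNReal.ofReal (5 * r N) := by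
    intro N k l hk hl
    have e1 : (fun X => φ k X - φ l X) = (fun X => φ k X - f X) - fun X => φ l X - f X := by
      ext1 X; simp
    have e2 : partialDeriv (Fin.last n) (fun X => φ k X - φ l X) =
        (fun X => partialDeriv (Fin.last n) (φ k) X - G X (Fin.last n)) -
          fun X => partialDeriv (Fin.last n) (φ l) X - G X (Fin.last n) := by
      ext1 X; simp [partialDeriv_sub (hd k) (hd l)]
    have mf := hf.aestronglyMeasurable.mono_measure
      (Measure.restrict_le_self (s := upperHalf n))
    have mG := (hG (Fin.last n)).aestronglyMeasurable.mono_measure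
      (Measure.restrict_le_self (s := upperHalf n))
    have mφ : ∀ k, AEStronglyMeasurable (φ k) (volume.restrict (upperHalf n)) := fun k =>
      (h1 k).continuous.aestronglyMeasurable
    have mdφ : ∀ k, AEStronglyMeasurable (partialDeriv (Fin.last n) (φ k))
        (volume.restrict (upperHalf n)) := fun k =>
      (continuous_partialDeriv (hd k) _).aestronglyMeasurable
    have hrk : ∀ {k}, N ≤ k → ENNReal.ofReal (r k) ≤ ENNReal.ofReal (r N) := fun h =>
      ENNReal.ofReal_le_ofReal (hra h)
    have b1 : eLpNorm (fun X => φ k X - φ l X) 2 (volume.restrict (upperHalf n)) ≤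
        ENNReal.ofReal (r N) + ENNReal.ofReal (r N) := by
      rw [e1]
      exact (eLpNorm_sub_le ((mφ k).sub mf) ((mφ l).sub mf) one_le_two).trans
        (add_le_add ((h4 k).trans (hrk hk)) ((h4 l).trans (hrk hl)))
    have b2 : eLpNorm (partialDeriv (Fin.last n) (fun X => φ k X - φ l X)) 2
        (volume.restrict (upperHalf n)) ≤ ENNReal.ofReal (r N) + ENNReal.ofReal (r N) := by
      rw [e2]
      exact (eLpNorm_sub_le ((mdφ k).sub mG) ((mdφ l).sub mG) one_le_two).trans
        (add_le_add ((h5 k _).trans (hrk hk)) ((h5 l _).trans (hrk hl)))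
    have b3 := eLpNorm_trace_le ((hd k).sub (hd l)) ((h2 k).sub (h2 l))
    refine (b3.trans (add_le_add b1 b2)).trans_lt ?_
    rw [← ENNReal.ofReal_add (hr0 N).le (hr0 N).le,
      ← ENNReal.ofReal_add (by have := hr0 N; positivity) (by have := hr0 N; positivity)]
    refine (ENNReal.ofReal_lt_ofReal_iff (by have := hr0 N; positivity)).2 ?_
    linarith [hr0 N]
  have hsum : ∑' k, ENNReal.ofReal (5 * r k) ≠ ⊤ := by
    have hs : Summable fun k => 5 * r k :=
      (summable_geometric_of_lt_one (by norm_num) (by norm_num)).mul_left 5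
    exact hs.tsum_ofReal_ne_top
  obtain ⟨τ, hτ, hlim⟩ := Lp.cauchy_complete_eLpNorm one_le_two hmem hsum key
  refine ⟨τ, φ, hτ, ⟨h1, h2, ?_, fun i => ?_, hlim⟩, fun ε hε => ?_⟩
  · exact tendsto_of_tendsto_of_tendsto_of_le_of_le tendsto_const_nhds hrlim' (fun _ => zero_le)
      h4
  · exact tendsto_of_tendsto_of_tendsto_of_le_of_le tendsto_const_nhds hrlim' (fun _ => zero_le)
      fun k => h5 k i
  · filter_upwards [hrlim.eventually (ge_mem_nhds hε)] with k hk
    exact (h3 k).trans (Metric.cthickening_mono hk K)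

theorem enorm_add_sq_le {E : Type*} [NormedAddCommGroup E] (a b : E) :
    ‖a + b‖ₑ ^ 2 ≤ 2 * (‖a‖ₑ ^ 2 + ‖b‖ₑ ^ 2) := by
  have e : ∀ a : E, ‖a‖ₑ ^ 2 = ENNReal.ofReal (‖a‖ ^ 2) := fun a => by
    rw [← ofReal_norm, ENNReal.ofReal_pow (norm_nonneg _)]
  have h2 : (2 : ℝ≥0∞) = ENNReal.ofReal 2 := by simp
  rw [e, e, e, h2, ← ENNReal.ofReal_add (by positivity) (by positivity),
    ← ENNReal.ofReal_mul (by norm_num)]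
  refine ENNReal.ofReal_le_ofReal ?_
  have := norm_add_le a b
  nlinarith [norm_nonneg a, norm_nonneg b, norm_nonneg (a + b), sq_nonneg (‖a‖ - ‖b‖)]

/-- The trace is characterized by the convergence of the averages of `f` on thin layers. -/
theorem IsHalfApprox.trace_eq {f : Euc (n + 1) → Euc m} {G : Euc (n + 1) → Fin (n + 1) → Euc m}
    {τ σ : Euc n → Euc m} {φ : ℕ → Euc (n + 1) → Euc m} (h : IsHalfApprox f G τ φ)
    (hf : AEStronglyMeasurable f) (hτ : AEStronglyMeasurable τ) (hσ : AEStronglyMeasurable σ)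
    (hG : MemLp (fun X => G X (Fin.last n)) 2 (volume.restrict (upperHalf n)))
    {δ₀ C : ℝ} (hδ₀ : 0 < δ₀)
    (hfσ : ∀ t, 0 < t → t < δ₀ → ∫⁻ x, ‖f (join x t) - σ x‖ₑ ^ 2 ≤ ENNReal.ofReal (C * t)) :
    τ =ᵐ[volume] σ := by
  have hd : ∀ k, ContDiff ℝ 1 (φ k) := fun k => contDiff_one_of_infty (h.contDiff k)
  set a := ∫⁻ x, ‖τ x - σ x‖ₑ ^ 2 with ha
  set A : ℕ → ℝ≥0∞ := fun k => ∫⁻ x, ‖φ k (incl x) - τ x‖ₑ ^ 2 with hA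
  set B : ℕ → ℝ≥0∞ := fun k => ∫⁻ X in upperHalf n, ‖φ k X - f X‖ₑ ^ 2 with hB
  set M : ℕ → ℝ≥0∞ := fun k =>
    ∫⁻ X in upperHalf n, ‖partialDeriv (Fin.last n) (φ k) X‖ₑ ^ 2 with hM
  set g := ∫⁻ X in upperHalf n, ‖G X (Fin.last n)‖ₑ ^ 2 with hg
  have hgfin : g ≠ ⊤ := by
    rw [hg, ← eLpNorm_two_sq]
    exact ENNReal.pow_ne_top hG.eLpNorm_ne_top
  have sq_lim : ∀ {u : ℕ → ℝ≥0∞}, Tendsto u atTop (𝓝 0) →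
      Tendsto (fun k => u k ^ 2) atTop (𝓝 0) := fun hu => by
    have h := ((ENNReal.continuous_pow 2).tendsto 0).comp hu
    rwa [zero_pow two_ne_zero] at h
  have hA0 : Tendsto A atTop (𝓝 0) := by
    have := sq_lim h.tendsto_trace
    simpa only [eLpNorm_two_sq] using this
  have hB0 : Tendsto B atTop (𝓝 0) := by
    have := sq_lim h.tendsto
    simpa only [eLpNorm_two_sq] using this
  have hM1 : ∀ᶠ k in atTop, M k ≤ 2 * (1 + g) := by
    have := sq_lim (h.tendsto_grad (Fin.last n))
    simp only [eLpNorm_two_sq] at this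
    filter_upwards [this.eventually (ge_mem_nhds one_pos)] with k hk
    calc M k ≤ ∫⁻ X in upperHalf n, 2 * (‖partialDeriv (Fin.last n) (φ k) X - G X (Fin.last n)‖ₑ ^ 2
          + ‖G X (Fin.last n)‖ₑ ^ 2) := by
          refine lintegral_mono fun X => ?_
          simpa using enorm_add_sq_le (partialDeriv (Fin.last n) (φ k) X - G X (Fin.last n))
            (G X (Fin.last n))
      _ = 2 * ((∫⁻ X in upperHalf n, ‖partialDeriv (Fin.last n) (φ k) X - G X (Fin.last n)‖ₑ ^ 2)
          + g) := by
          rw [lintegral_const_mul' _ _ (by simp), lintegral_add_right' _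
            (hG.aestronglyMeasurable.enorm.pow_const 2)]
      _ ≤ _ := by gcongr
  have mA : ∀ k, AEMeasurable (fun x => ‖φ k (incl x) - τ x‖ₑ ^ 2) := fun k =>
    ((((hd k).continuous.comp continuous_incl).aestronglyMeasurable).sub hτ).enorm.pow_const 2
  have hfslice : ∀ᵐ t : ℝ, AEStronglyMeasurable fun x => f (join x t) := by
    have h1 : AEStronglyMeasurable (fun p : ℝ × Euc n => f (join p.2 p.1))
        (volume.prod volume) :=
      (hf.comp_measurePreserving (measurePreserving_join n)).comp_measurePreserving
        Measure.measurePreserving_swap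
    exact h1.prodMk_left
  -- the comparison on the layer of height `δ`
  have main : ∀ δ, 0 < δ → δ < δ₀ → ∀ k, ENNReal.ofReal δ * a ≤ 4 * (ENNReal.ofReal δ * A k + B k +
      ENNReal.ofReal δ * (ENNReal.ofReal δ * M k + ENNReal.ofReal (|C| * δ))) := by
    intro δ hδ hδ' k
    have pt : ∀ᵐ t, t ∈ Ioo 0 δ → a ≤ 4 * (A k + ENNReal.ofReal δ * M k +
        (∫⁻ x, ‖φ k (join x t) - f (join x t)‖ₑ ^ 2) + ENNReal.ofReal (|C| * δ)) := by
      filter_upwards [hfslice] with t hft ht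
      have hjt : Continuous fun x : Euc n => join x t :=
        continuous_join.comp (by fun_prop : Continuous fun x : Euc n => (x, t))
      have c1 : Continuous fun x => φ k (join x t) - φ k (incl x) :=
        ((hd k).continuous.comp hjt).sub ((hd k).continuous.comp continuous_incl)
      calc a ≤ ∫⁻ x, 4 * ((‖φ k (incl x) - τ x‖ₑ ^ 2 + ‖φ k (join x t) - φ k (incl x)‖ₑ ^ 2) +
            (‖φ k (join x t) - f (join x t)‖ₑ ^ 2 + ‖f (join x t) - σ x‖ₑ ^ 2)) := by
            refine lintegral_mono fun x => ?_
            simp only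
            have e1 := enorm_add_sq_le (-(φ k (incl x) - τ x) - (φ k (join x t) - φ k (incl x)))
              ((φ k (join x t) - f (join x t)) + (f (join x t) - σ x))
            have e2 := enorm_add_sq_le (-(φ k (incl x) - τ x)) (-(φ k (join x t) - φ k (incl x)))
            have e3 := enorm_add_sq_le (φ k (join x t) - f (join x t)) (f (join x t) - σ x)
            rw [enorm_neg, enorm_neg, ← sub_eq_add_neg] at e2
            have e4 : -(φ k (incl x) - τ x) - (φ k (join x t) - φ k (incl x)) +
              ((φ k (join x t) - f (join x t)) + (f (join x t) - σ x)) = τ x - σ x := by abel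
            rw [e4] at e1
            refine e1.trans ((mul_le_mul_right (add_le_add e2 e3) 2).trans_eq ?_)
            ring
        _ ≤ 4 * ((A k + ENNReal.ofReal t * M k) +
            ((∫⁻ x, ‖φ k (join x t) - f (join x t)‖ₑ ^ 2) + ENNReal.ofReal (C * t))) := by
            rw [lintegral_const_mul' _ _ (by simp)]
            refine mul_le_mul_right ?_ _
            have m1 : AEMeasurable (fun x => ‖φ k (incl x) - τ x‖ₑ ^ 2 +
                ‖φ k (join x t) - φ k (incl x)‖ₑ ^ 2) :=
              (mA k).add (c1.measurable.enorm.pow_const 2).aemeasurable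
            have m2 : AEMeasurable (fun x => ‖φ k (join x t) - f (join x t)‖ₑ ^ 2) :=
              ((((hd k).continuous.comp hjt).aestronglyMeasurable).sub hft).enorm.pow_const 2
            rw [lintegral_add_left' m1, lintegral_add_left' (mA k), lintegral_add_left' m2]
            exact add_le_add (add_le_add le_rfl (lintegral_sub_trace_le (hd k) ht.1))
              (add_le_add le_rfl (hfσ t ht.1 (ht.2.trans hδ')))
        _ ≤ _ := by
            refine mul_le_mul_right ?_ _
            rw [← add_assoc]
            refine add_le_add (add_le_add (add_le_add le_rfl ?_) le_rfl) ?_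
            · exact mul_le_mul_left (ENNReal.ofReal_le_ofReal ht.2.le) _
            · refine ENNReal.ofReal_le_ofReal ?_
              have := le_abs_self C
              have := abs_nonneg C
              nlinarith [ht.1, ht.2]
    have mj : AEMeasurable (fun X => ‖φ k X - f X‖ₑ ^ 2) :=
      ((hd k).continuous.aestronglyMeasurable.sub hf).enorm.pow_const 2
    calc ENNReal.ofReal δ * a = ∫⁻ t in Ioo 0 δ, a := by
          rw [setLIntegral_const, Real.volume_Ioo, sub_zero, mul_comm]
      _ ≤ ∫⁻ t in Ioo 0 δ, 4 * ((∫⁻ x, ‖φ k (join x t) - f (join x t)‖ₑ ^ 2) +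
            (A k + ENNReal.ofReal δ * M k + ENNReal.ofReal (|C| * δ))) := by
          refine setLIntegral_mono_ae' measurableSet_Ioo ?_
          filter_upwards [pt] with t h1 h2
          refine (h1 h2).trans_eq ?_
          ring
      _ ≤ 4 * (B k + (A k + ENNReal.ofReal δ * M k + ENNReal.ofReal (|C| * δ)) *
            ENNReal.ofReal δ) := by
          rw [lintegral_const_mul' _ _ (by simp), lintegral_add_right' _ aemeasurable_const,
            setLIntegral_const, Real.volume_Ioo, sub_zero]
          refine mul_le_mul_right (add_le_add ?_ le_rfl) _
          have hcyl := setLIntegral_cylinder mj MeasurableSet.univ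
            (measurableSet_Ioo (a := (0 : ℝ)) (b := δ))
          simp only [mem_univ, true_and, Measure.restrict_univ] at hcyl
          rw [← hcyl]
          exact lintegral_mono_set fun X hX => hX.1
      _ = _ := by ring
  have main2 : ∀ δ, 0 < δ → δ < δ₀ → a ≤ ENNReal.ofReal δ * (4 * (2 * (1 + g) +
      ENNReal.ofReal |C|)) := by
    intro δ hδ hδ'
    have hδe : ENNReal.ofReal δ ≠ 0 := by simpa using hδ
    have l1 : Tendsto (fun k => 4 * (ENNReal.ofReal δ * A k + B k + ENNReal.ofReal δ *
        (ENNReal.ofReal δ * (2 * (1 + g)) + ENNReal.ofReal (|C| * δ)))) atTop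
        (𝓝 (4 * (ENNReal.ofReal δ * 0 + 0 + ENNReal.ofReal δ *
        (ENNReal.ofReal δ * (2 * (1 + g)) + ENNReal.ofReal (|C| * δ))))) := by
      refine ENNReal.Tendsto.const_mul ?_ (Or.inr (by simp))
      refine Tendsto.add (Tendsto.add ?_ hB0) tendsto_const_nhds
      exact ENNReal.Tendsto.const_mul hA0 (Or.inr ENNReal.ofReal_ne_top)
    have l2 := ge_of_tendsto l1 (b := ENNReal.ofReal δ * a) (by
      filter_upwards [hM1] with k hk
      refine (main δ hδ hδ' k).trans ?_
      gcongr)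
    rw [mul_zero, zero_add, zero_add, ENNReal.ofReal_mul (abs_nonneg C)] at l2
    rw [← ENNReal.mul_le_mul_iff_right hδe ENNReal.ofReal_ne_top]
    refine l2.trans_eq ?_
    ring
  have ha0 : a = 0 := by
    have l1 : Tendsto (fun δ : ℝ => ENNReal.ofReal δ * (4 * (2 * (1 + g) + ENNReal.ofReal |C|)))
        (𝓝[>] 0) (𝓝 (ENNReal.ofReal 0 * (4 * (2 * (1 + g) + ENNReal.ofReal |C|)))) := by
      refine ENNReal.Tendsto.mul_const ?_ (Or.inr (by finiteness))
      exact (ENNReal.tendsto_ofReal tendsto_id).mono_left nhdsWithin_le_nhds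
    have l2 := ge_of_tendsto l1 (b := a) (by
      filter_upwards [Ioo_mem_nhdsGT hδ₀] with δ hδ using main2 δ hδ.1 hδ.2)
    simpa using l2
  have hz := (lintegral_eq_zero_iff' ((hτ.sub hσ).enorm.pow_const 2)).1 ha0
  filter_upwards [hz] with x hx
  have : ‖τ x - σ x‖ₑ ^ 2 = 0 := hx
  rw [pow_eq_zero_iff two_ne_zero, enorm_eq_zero, sub_eq_zero] at this
  exact this

end Trace

end HalfLap

/-! ### Weak gradients: uniqueness, localization and extension by zero -/

namespace HalfLap

section WeakGrad

variable {n m d : ℕ}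

/-- A smooth cutoff that equals one near `K` (so that its derivatives vanish there) and is compactly
supported in `O`. -/
theorem exists_smooth_cutoff {K O : Set (Euc d)} (hK : IsCompact K) (hO : IsOpen O)
    (hKO : K ⊆ O) : ∃ χ : Euc d → ℝ, ContDiff ℝ ∞ χ ∧ HasCompactSupport χ ∧ tsupport χ ⊆ O ∧
      (∀ᶠ x in 𝓝ˢ K, χ x = 1) ∧ ∀ x, χ x ∈ Icc (0 : ℝ) 1 := by
  obtain ⟨L, hL, hKL, hLO⟩ := exists_compact_between hK hO hKO
  obtain ⟨f, h1, h0, hf⟩ := exists_contMDiffMap_one_nhds_of_subset_interior (n := (⊤ : ℕ∞))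
    (modelWithCornersSelf ℝ (Euc d)) hK.isClosed hKL
  have hs : tsupport (f : Euc d → ℝ) ⊆ L := by
    refine closure_minimal (fun x hx => ?_) hL.isClosed
    by_contra h
    exact hx (h0 x h)
  exact ⟨f, f.contMDiff.contDiff, hL.of_isClosed_subset (isClosed_tsupport _) hs, hs.trans hLO,
    h1, hf⟩

theorem partialDeriv_mul {χ ψ : Euc d → ℝ} (hχ : ContDiff ℝ 1 χ) (hψ : ContDiff ℝ 1 ψ)
    (i : Fin d) (X : Euc d) : partialDeriv i (fun Y => χ Y * ψ Y) X =
      χ X * partialDeriv i ψ X + partialDeriv i χ X * ψ X := by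
  have := fderiv_mul (hχ.differentiable one_ne_zero X) (hψ.differentiable one_ne_zero X)
  unfold partialDeriv
  change (fderiv ℝ (χ * ψ) X) _ = _
  rw [this]
  simp [mul_comm]

theorem integrableOn_smul_of_hasCompactSupport {Ω : Set (Euc d)} (hΩ : MeasurableSet Ω)
    {f : Euc d → Euc m} (hf : ∀ K, IsCompact K → K ⊆ Ω → IntegrableOn f K)
    {a : Euc d → ℝ} (ha : Continuous a) (hc : HasCompactSupport a) (hs : tsupport a ⊆ Ω) :
    IntegrableOn (fun x => a x • f x) Ω := by
  have h1 : IntegrableOn (fun x => a x • f x) (tsupport a) :=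
    (hf _ hc.isCompact hs).continuousOn_smul ha.continuousOn hc.isCompact
  refine h1.of_forall_sdiff_eq_zero hΩ fun X hX => ?_
  rw [image_eq_zero_of_notMem_tsupport hX.2, zero_smul]

theorem integrableOn_of_memLp_two {Ω : Set (Euc d)} {f : Euc d → Euc m}
    (hf : MemLp f 2 (volume.restrict Ω)) (K : Set (Euc d)) (hK : IsCompact K) (hKΩ : K ⊆ Ω) :
    IntegrableOn f K := by
  have h : MemLp f 2 (volume.restrict K) := hf.mono_measure (Measure.restrict_mono_set _ hKΩ)
  have : IsFiniteMeasure (volume.restrict K) := ⟨by simpa using hK.measure_lt_top⟩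
  exact h.integrable one_le_two

/-- Locally integrable weak gradients are unique. -/
theorem IsWeakGrad.ae_eq {Ω : Set (Euc d)} (hΩ : IsOpen Ω) {u : Euc d → Euc m}
    {G G' : Euc d → Fin d → Euc m} (h : IsWeakGrad Ω u G) (h' : IsWeakGrad Ω u G')
    (hG : ∀ i K, IsCompact K → K ⊆ Ω → IntegrableOn (fun x => G x i) K)
    (hG' : ∀ i K, IsCompact K → K ⊆ Ω → IntegrableOn (fun x => G' x i) K) (i : Fin d) :
    ∀ᵐ x, x ∈ Ω → G x i = G' x i := by
  have key := hΩ.ae_eq_zero_of_integral_contDiff_smul_eq_zero (μ := volume)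
    (f := fun x => G x i - G' x i) ?_ ?_
  · filter_upwards [key] with x hx hxΩ using sub_eq_zero.1 (hx hxΩ)
  · refine (locallyIntegrableOn_iff hΩ.isLocallyClosed).2 fun K hKΩ hK => ?_
    exact (hG i K hK hKΩ).sub (hG' i K hK hKΩ)
  · intro φ hφ hc hs
    have e1 := h φ hφ hc hs i
    rw [h' φ hφ hc hs i, neg_inj] at e1
    have i1 := integrableOn_smul_of_hasCompactSupport hΩ.measurableSet (hG i) hφ.continuous hc hs
    have i2 := integrableOn_smul_of_hasCompactSupport hΩ.measurableSet (hG' i) hφ.continuous hc hs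
    have e2 : ∫ x, φ x • (G x i - G' x i) = ∫ x in Ω, φ x • (G x i - G' x i) := by
      refine (setIntegral_eq_integral_of_forall_compl_eq_zero fun x hx => ?_).symm
      rw [image_eq_zero_of_notMem_tsupport fun h => hx (hs h), zero_smul]
    rw [e2]
    simp only [smul_sub]
    rw [integral_sub i1 i2, e1, sub_self]

theorem IsWeakGrad.sub {Ω : Set (Euc d)} (hΩ : MeasurableSet Ω) {u u' : Euc d → Euc m}
    {G G' : Euc d → Fin d → Euc m} (h : IsWeakGrad Ω u G) (h' : IsWeakGrad Ω u' G')
    (hu : ∀ K, IsCompact K → K ⊆ Ω → IntegrableOn u K)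
    (hu' : ∀ K, IsCompact K → K ⊆ Ω → IntegrableOn u' K)
    (hG : ∀ i K, IsCompact K → K ⊆ Ω → IntegrableOn (fun x => G x i) K)
    (hG' : ∀ i K, IsCompact K → K ⊆ Ω → IntegrableOn (fun x => G' x i) K) :
    IsWeakGrad Ω (fun x => u x - u' x) (fun x i => G x i - G' x i) := by
  intro φ hφ hc hs i
  have hφ1 := contDiff_one_of_infty hφ
  have hd := continuous_partialDeriv hφ1 i
  have hdc := hasCompactSupport_partialDeriv hc i
  have hds := (tsupport_partialDeriv_subset φ i).trans hs
  simp only [smul_sub]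
  rw [integral_sub (integrableOn_smul_of_hasCompactSupport hΩ hu hd hdc hds)
      (integrableOn_smul_of_hasCompactSupport hΩ hu' hd hdc hds),
    integral_sub (integrableOn_smul_of_hasCompactSupport hΩ (hG i) hφ.continuous hc hs)
      (integrableOn_smul_of_hasCompactSupport hΩ (hG' i) hφ.continuous hc hs),
    h φ hφ hc hs i, h' φ hφ hc hs i]
  abel

theorem IsWeakGrad.mono {Ω U : Set (Euc d)} (hU : U ⊆ Ω) {u : Euc d → Euc m}
    {G : Euc d → Fin d → Euc m} (h : IsWeakGrad Ω u G) : IsWeakGrad U u G := by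
  intro φ hφ hc hs i
  have e1 : ∫ x in U, partialDeriv i φ x • u x = ∫ x in Ω, partialDeriv i φ x • u x := by
    rw [setIntegral_eq_integral_of_forall_compl_eq_zero fun x hx => ?_,
      setIntegral_eq_integral_of_forall_compl_eq_zero fun x hx => ?_]
    · rw [image_eq_zero_of_notMem_tsupport fun h =>
        hx (hU (hs (tsupport_partialDeriv_subset φ i h))), zero_smul]
    · rw [image_eq_zero_of_notMem_tsupport fun h =>
        hx (hs (tsupport_partialDeriv_subset φ i h)), zero_smul]
  have e2 : ∫ x in U, φ x • G x i = ∫ x in Ω, φ x • G x i := by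
    rw [setIntegral_eq_integral_of_forall_compl_eq_zero fun x hx => ?_,
      setIntegral_eq_integral_of_forall_compl_eq_zero fun x hx => ?_]
    · rw [image_eq_zero_of_notMem_tsupport fun h => hx (hU (hs h)), zero_smul]
    · rw [image_eq_zero_of_notMem_tsupport fun h => hx (hs h), zero_smul]
  rw [e1, e2, h φ hφ hc (hs.trans hU) i]

/-- The product rule for a smooth cutoff, followed by the extension by zero to a larger domain. -/
theorem IsWeakGrad.cutoff {Ω D : Set (Euc d)} (hΩ : MeasurableSet Ω)
    (hΩD : Ω ⊆ D) {f : Euc d → Euc m} {G : Euc d → Fin d → Euc m} (h : IsWeakGrad Ω f G)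
    (hf : ∀ K, IsCompact K → K ⊆ Ω → IntegrableOn f K)
    (hG : ∀ i K, IsCompact K → K ⊆ Ω → IntegrableOn (fun x => G x i) K)
    {χ : Euc d → ℝ} (hχ : ContDiff ℝ ∞ χ) (hχD : tsupport χ ∩ D ⊆ Ω) :
    IsWeakGrad D (Ω.indicator fun x => χ x • f x)
      (fun x i => Ω.indicator (fun x => χ x • G x i + partialDeriv i χ x • f x) x) := by
  intro ψ hψ hc hs i
  have hχ1 := contDiff_one_of_infty hχ
  have hψ1 := contDiff_one_of_infty hψ
  -- the cutoff is moved to the test function, whose support then lies in `Ω`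
  have hp := h (fun x => χ x * ψ x) (hχ.mul hψ) hc.mul_left
    (fun x hx => hχD ⟨tsupport_mul_subset_left hx, hs (tsupport_mul_subset_right hx)⟩) i
  have hsub : ∀ {a : Euc d → ℝ}, tsupport a ⊆ tsupport χ → tsupport a ⊆ tsupport ψ →
      tsupport a ⊆ Ω := fun h1 h2 x hx => hχD ⟨h1 hx, hs (h2 hx)⟩
  have dχ := continuous_partialDeriv hχ1 i
  have dψ := continuous_partialDeriv hψ1 i
  have i1 := integrableOn_smul_of_hasCompactSupport hΩ hf
    (a := fun x => χ x * partialDeriv i ψ x) (hχ.continuous.mul dψ)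
    (hasCompactSupport_partialDeriv hc i).mul_left
    (hsub (tsupport_mul_subset_left)
      (tsupport_mul_subset_right.trans (tsupport_partialDeriv_subset ψ i)))
  have i2 := integrableOn_smul_of_hasCompactSupport hΩ hf
    (a := fun x => partialDeriv i χ x * ψ x) (dχ.mul hψ.continuous) hc.mul_left
    (hsub (tsupport_mul_subset_left.trans (tsupport_partialDeriv_subset χ i))
      tsupport_mul_subset_right)
  have i3 := integrableOn_smul_of_hasCompactSupport hΩ (hG i)
    (a := fun x => χ x * ψ x) (hχ.continuous.mul hψ.continuous) hc.mul_left
    (hsub tsupport_mul_subset_left tsupport_mul_subset_right)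
  have e1 : ∫ x in D, partialDeriv i ψ x • Ω.indicator (fun x => χ x • f x) x =
      ∫ x in Ω, (χ x * partialDeriv i ψ x) • f x := by
    have : ∀ x, partialDeriv i ψ x • Ω.indicator (fun x => χ x • f x) x =
        Ω.indicator (fun x => (χ x * partialDeriv i ψ x) • f x) x := fun x => by
      by_cases hx : x ∈ Ω <;> simp [hx, smul_smul, mul_comm]
    simp only [this]
    rw [setIntegral_indicator hΩ, inter_eq_right.2 hΩD]
  have e2 : ∫ x in D, ψ x • Ω.indicator (fun x => χ x • G x i + partialDeriv i χ x • f x) x =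
      ∫ x in Ω, ((χ x * ψ x) • G x i + (partialDeriv i χ x * ψ x) • f x) := by
    have : ∀ x, ψ x • Ω.indicator (fun x => χ x • G x i + partialDeriv i χ x • f x) x =
        Ω.indicator (fun x => (χ x * ψ x) • G x i + (partialDeriv i χ x * ψ x) • f x) x :=
      fun x => by by_cases hx : x ∈ Ω <;> simp [hx, smul_smul, mul_comm]
    simp only [this]
    rw [setIntegral_indicator hΩ, inter_eq_right.2 hΩD]
  rw [e1, e2, integral_add i3 i2, neg_add, ← hp]
  simp only [partialDeriv_mul hχ1 hψ1, add_smul]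
  rw [integral_add i1 i2]
  abel

/-- The interior of `Ω ∪ (upperHalf n)ᶜ` serves as the open set, relative to the closed half-space, in
which supports reaching the flat part of the boundary are taken. -/
theorem interior_union_compl_inter_subset (Ω : Set (Euc (n + 1))) :
    interior (Ω ∪ (upperHalf n)ᶜ) ∩ upperHalf n ⊆ Ω := fun _ hX =>
  (interior_subset hX.1).resolve_right fun h => h hX.2

/-- The union of `Ω` and the flat part of its boundary has an open neighbourhood whose trace on the
half-space is contained in `Ω`. -/
theorem union_flatBdry_subset {Ω : Set (Euc (n + 1))} (hΩ : IsOpen Ω) :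
    Ω ∪ incl '' flatBdry Ω ⊆ interior (Ω ∪ (upperHalf n)ᶜ) := by
  rintro X (hX | ⟨x, ⟨_, r, hr, h⟩, rfl⟩)
  · exact interior_mono subset_union_left (hΩ.interior_eq.symm ▸ hX)
  · refine mem_interior.2 ⟨Metric.ball (incl x) r, fun Y hY => ?_, Metric.isOpen_ball,
      Metric.mem_ball_self hr⟩
    by_cases hYH : Y ∈ upperHalf n
    · exact Or.inl (h ⟨hY, hYH⟩)
    · exact Or.inr hYH

/-- A map on `Ω` that is compactly supported up to the flat part of the boundary is extended by zero
to the half-space, together with its weak gradient. -/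
theorem IsWeakGrad.extend_zero {Ω : Set (Euc (n + 1))} (hΩ : IsOpen Ω) (hΩH : Ω ⊆ upperHalf n)
    {f : Euc (n + 1) → Euc m} {G : Euc (n + 1) → Fin (n + 1) → Euc m} (h : IsWeakGrad Ω f G)
    (hf : ∀ K, IsCompact K → K ⊆ Ω → IntegrableOn f K)
    (hG : ∀ i K, IsCompact K → K ⊆ Ω → IntegrableOn (fun x => G x i) K)
    {K : Set (Euc (n + 1))} (hK : IsCompact K) (hKΩ : K ⊆ Ω ∪ incl '' flatBdry Ω)
    (hfK : ∀ᵐ x, x ∈ Ω → x ∉ K → f x = 0) :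
    IsWeakGrad (upperHalf n) ((Ω ∩ K).indicator f) (fun x i => Ω.indicator (fun x => G x i) x) := by
  obtain ⟨χ, hχ, hχc, hχs, hχ1, -⟩ := exists_smooth_cutoff hK isOpen_interior
    (hKΩ.trans (union_flatBdry_subset hΩ))
  have hc := h.cutoff hΩ.measurableSet hΩH hf hG hχ
    (fun X hX => interior_union_compl_inter_subset Ω ⟨hχs hX.1, hX.2⟩)
  have hU : IsOpen (Ω \ K) := hΩ.sdiff hK.isClosed
  -- the gradient vanishes where the map does
  have hG0 : ∀ i, ∀ᵐ x, x ∈ Ω \ K → G x i = 0 := by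
    intro i
    refine IsWeakGrad.ae_eq hU (u := f) (h.mono sdiff_subset) (G' := 0) ?_
      (fun i L hL hLU => hG i L hL (hLU.trans sdiff_subset))
      (fun i L hL hLU => integrableOn_zero) i
    intro φ hφ hc hs i
    have : ∫ x in Ω \ K, partialDeriv i φ x • f x = 0 := by
      refine setIntegral_eq_zero_of_ae_eq_zero ?_
      filter_upwards [hfK] with x hx hxU
      rw [hx hxU.1 hxU.2, smul_zero]
    simp [this]
  have hK1 : ∀ x ∈ K, χ x = 1 ∧ ∀ i, partialDeriv i χ x = 0 := fun x hx => by
    have h1 : ∀ᶠ y in 𝓝 x, χ y = 1 := hχ1.filter_mono (nhds_le_nhdsSet hx)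
    refine ⟨h1.self_of_nhds, fun i => ?_⟩
    have : fderiv ℝ χ x = fderiv ℝ (fun _ => (1 : ℝ)) x := Filter.EventuallyEq.fderiv_eq h1
    simp [partialDeriv, this]
  intro ψ hψ hψc hψs i
  have key := hc ψ hψ hψc hψs i
  rw [show ∫ x in upperHalf n, partialDeriv i ψ x • (Ω ∩ K).indicator f x =
      ∫ x in upperHalf n, partialDeriv i ψ x • Ω.indicator (fun x => χ x • f x) x from ?_, key]
  · congr 1
    refine integral_congr_ae (ae_restrict_of_ae ?_)
    filter_upwards [hfK, hG0 i] with x h1 h2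
    by_cases hxΩ : x ∈ Ω
    · by_cases hxK : x ∈ K
      · simp [hxΩ, hK1 x hxK]
      · simp [hxΩ, h1 hxΩ hxK, h2 ⟨hxΩ, hxK⟩]
    · simp [hxΩ]
  · refine integral_congr_ae (ae_restrict_of_ae ?_)
    filter_upwards [hfK] with x h1
    by_cases hxΩ : x ∈ Ω
    · by_cases hxK : x ∈ K
      · simp [hxΩ, hxK, (hK1 x hxK).1]
      · simp [hxΩ, hxK, h1 hxΩ hxK]
    · simp [hxΩ]

theorem MemH1.isWeakGrad {Ω : Set (Euc d)} {u : Euc d → Euc m} (h : MemH1 Ω u) :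
    (∀ i, MemLp (fun x => weakGrad Ω u x i) 2 (volume.restrict Ω)) ∧
      IsWeakGrad Ω u (weakGrad Ω u) := by
  unfold weakGrad
  rw [dif_pos h]
  exact h.2.choose_spec

/-- The gradient chosen in the definition of `weakGrad` agrees with any square integrable weak gradient. -/
theorem IsWeakGrad.weakGrad_ae_eq {Ω : Set (Euc d)} (hΩ : IsOpen Ω) {u : Euc d → Euc m}
    {G : Euc d → Fin d → Euc m} (hG : IsWeakGrad Ω u G) (hu : MemLp u 2 (volume.restrict Ω))
    (hG2 : ∀ i, MemLp (fun x => G x i) 2 (volume.restrict Ω)) (i : Fin d) :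
    ∀ᵐ x, x ∈ Ω → weakGrad Ω u x i = G x i := by
  have h : MemH1 Ω u := ⟨hu, G, hG2, hG⟩
  exact IsWeakGrad.ae_eq hΩ h.isWeakGrad.2 hG
    (fun i => integrableOn_of_memLp_two (h.isWeakGrad.1 i))
    (fun i => integrableOn_of_memLp_two (hG2 i)) i

end WeakGrad

end HalfLap

/-! ### Square integrability up to the boundary -/

namespace HalfLap

section SquareIntegrability

variable {n m : ℕ}

/-- The complement of the part of the boundary hyperplane that lies outside `A`. -/
def slitSpace (A : Set (Euc n)) : Set (Euc (n + 1)) := {X | height X ≠ 0 ∨ horiz X ∈ A}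

theorem isOpen_slitSpace {A : Set (Euc n)} (hA : IsOpen A) : IsOpen (slitSpace A) :=
  (isOpen_ne_fun continuous_height continuous_const).union (hA.preimage continuous_horiz)

theorem slitSpace_univ : slitSpace (univ : Set (Euc n)) = univ := by
  simp [slitSpace]

/-- A compact subset of `slitSpace A` splits in a part above or below `A` and a part at positive distance
from the boundary hyperplane. -/
theorem exists_bounds_of_subset_slitSpace {A : Set (Euc n)} (hA : IsOpen A)
    {K : Set (Euc (n + 1))} (hK : IsCompact K) (hKA : K ⊆ slitSpace A) :
    ∃ R δ : ℝ, 0 < δ ∧ ∀ X ∈ K, ‖X‖ ≤ R ∧ (horiz X ∈ A ∨ δ ≤ |height X|) := by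
  obtain ⟨R, hR⟩ := hK.isBounded.subset_closedBall 0
  have hL : IsCompact (K \ horiz ⁻¹' A) := hK.diff (hA.preimage continuous_horiz)
  obtain ⟨δ, hδ, h⟩ := hL.exists_forall_le' continuous_height.abs.continuousOn (a := 0)
    fun X hX => abs_pos.2 ((hKA hX.1).resolve_right hX.2)
  refine ⟨R, δ, hδ, fun X hX => ⟨by simpa using hR hX, ?_⟩⟩
  by_cases hXA : horiz X ∈ A
  · exact Or.inl hXA
  · exact Or.inr (h X ⟨hX, hXA⟩)

theorem memLp_two_of_lintegral {α E : Type*} [MeasurableSpace α] [NormedAddCommGroup E]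
    {μ : Measure α} {f : α → E} (hf : AEStronglyMeasurable f μ) (h : ∫⁻ x, ‖f x‖ₑ ^ 2 ∂μ ≠ ⊤) :
    MemLp f 2 μ := by
  refine ⟨hf, ?_⟩
  rw [← eLpNorm_two_sq] at h
  exact (ENNReal.pow_ne_top_iff.1 h |>.resolve_right (by simp)).lt_top

theorem lintegral_two_ne_top {α E : Type*} [MeasurableSpace α] [NormedAddCommGroup E]
    {μ : Measure α} {f : α → E} (h : MemLp f 2 μ) : ∫⁻ x, ‖f x‖ₑ ^ 2 ∂μ ≠ ⊤ := by
  rw [← eLpNorm_two_sq]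
  exact ENNReal.pow_ne_top h.2.ne

/-- Square integrability up to the part `A` of the boundary follows from local bounds in the half-space
and square integrability on the cylinders over `A`. -/
theorem memLp_inter_upperHalf {A : Set (Euc n)} (hA : IsOpen A) {K : Set (Euc (n + 1))}
    (hK : IsCompact K) (hKA : K ⊆ slitSpace A) {f : Euc (n + 1) → Euc m}
    (hf : AEStronglyMeasurable f)
    (hloc : ∀ R δ : ℝ, 0 < δ → ∃ C : ℝ, ∀ X, ‖X‖ ≤ R → δ ≤ height X → ‖f X‖ ≤ C)
    (hcyl : ∀ R : ℝ, ∫⁻ t in Ioc 0 R, ∫⁻ x in A, ‖f (join x t)‖ₑ ^ 2 ≠ ⊤) :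
    MemLp f 2 (volume.restrict (K ∩ upperHalf n)) := by
  refine memLp_two_of_lintegral hf.restrict ?_
  obtain ⟨R, δ, hδ, h⟩ := exists_bounds_of_subset_slitSpace hA hK hKA
  obtain ⟨C, hC⟩ := hloc R δ hδ
  have hsub : K ∩ upperHalf n ⊆ {X | horiz X ∈ A ∧ height X ∈ Ioc 0 R} ∪
      (K ∩ {X | δ ≤ height X}) := by
    rintro X ⟨hX, hXH⟩
    have hXH' : 0 < height X := hXH
    obtain ⟨h1, h2 | h2⟩ := h X hX
    · exact Or.inl ⟨h2, hXH', ((le_abs_self _).trans (abs_height_le X)).trans h1⟩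
    · rw [abs_of_pos hXH'] at h2
      exact Or.inr ⟨hX, h2⟩
  refine ((lintegral_mono_set hsub).trans (lintegral_union_le _ _ _)).trans_lt
    (ENNReal.add_lt_top.2 ⟨?_, ?_⟩) |>.ne
  · rw [setLIntegral_cylinder (hf.enorm.pow_const 2) hA.measurableSet measurableSet_Ioc]
    exact (hcyl R).lt_top
  · have hm : MeasurableSet (K ∩ {X : Euc (n + 1) | δ ≤ height X}) :=
      hK.measurableSet.inter (measurableSet_le measurable_const measurable_height)
    refine (setLIntegral_mono (g := fun _ => ENNReal.ofReal C ^ 2) measurable_const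
      fun X hX => ?_).trans_lt ?_
    · gcongr
      rw [← ofReal_norm]
      exact ENNReal.ofReal_le_ofReal (hC X (h X hX.1).1 hX.2)
    · rw [setLIntegral_const]
      refine ENNReal.mul_lt_top (by finiteness) ?_
      exact (measure_mono inter_subset_left).trans_lt hK.measure_lt_top

variable {v : Euc n → Euc m} (hv : Integrable (fun z => wt z • v z))

include hv in
theorem memLp_harmGrad {A : Set (Euc n)} (hA : IsOpen A)
    (hfin : ∫⁻ x in A, ∫⁻ z, gagDens v x z ≠ ⊤) {K : Set (Euc (n + 1))} (hK : IsCompact K)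
    (hKA : K ⊆ slitSpace A) (i : Fin (n + 1)) :
    MemLp (fun X => harmGrad v X i) 2 (volume.restrict (K ∩ upperHalf n)) := by
  refine memLp_inter_upperHalf hA hK hKA
    (aestronglyMeasurable_harmGrad (aestronglyMeasurable_of_wt hv) i) (fun R δ hδ => ?_)
    fun R => ?_
  · obtain ⟨C, h⟩ := exists_norm_harmExt_le hv R hδ
    exact ⟨C, fun X h1 h2 => (h X h1 h2).2 i⟩
  · obtain ⟨C, _, h⟩ := exists_lintegral_harmGrad_le n
    refine ((lintegral_mono_set Ioc_subset_Ioi_self).trans (h hv i A)).trans_lt ?_ |>.ne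
    exact ENNReal.mul_lt_top ENNReal.ofReal_lt_top hfin.lt_top

include hv in
/-- The harmonic extension is close to its boundary value on thin layers. -/
theorem lintegral_harmExt_sub_le (A : Set (Euc n)) {t : ℝ} (ht : 0 < t) :
    ∫⁻ x in A, ‖harmExt v (join x t) - v x‖ₑ ^ 2 ≤
      ENNReal.ofReal (gammaConst n * t) * ∫⁻ x in A, ∫⁻ z, gagDens v x z := by
  rw [← lintegral_const_mul' _ _ ENNReal.ofReal_ne_top]
  exact lintegral_mono fun x => enorm_harmExt_sub_self_sq_le hv ht x

include hv in
theorem memLp_harmExt {A : Set (Euc n)} (hA : IsOpen A)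
    (hfin : ∫⁻ x in A, ∫⁻ z, gagDens v x z ≠ ⊤) (hvA : MemLp v 2 (volume.restrict A))
    {K : Set (Euc (n + 1))} (hK : IsCompact K) (hKA : K ⊆ slitSpace A) :
    MemLp (harmExt v) 2 (volume.restrict (K ∩ upperHalf n)) := by
  have hγ := gammaConst_pos n
  refine memLp_inter_upperHalf hA hK hKA
    (aestronglyMeasurable_harmExt (aestronglyMeasurable_of_wt hv)) (fun R δ hδ => ?_)
    fun R => ?_
  · obtain ⟨C, h⟩ := exists_norm_harmExt_le hv R hδ
    exact ⟨C, fun X h1 h2 => (h X h1 h2).1⟩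
  · set I := ∫⁻ x in A, ∫⁻ z, gagDens v x z with hI
    set J := ∫⁻ x in A, ‖v x‖ₑ ^ 2 with hJ
    have hJt : J ≠ ⊤ := lintegral_two_ne_top hvA
    refine (setLIntegral_mono (g := fun _ => 2 * (ENNReal.ofReal (gammaConst n * R) * I + J))
      measurable_const fun t ht => ?_).trans_lt ?_ |>.ne
    · calc ∫⁻ x in A, ‖harmExt v (join x t)‖ₑ ^ 2
          ≤ ∫⁻ x in A, 2 * (‖harmExt v (join x t) - v x‖ₑ ^ 2 + ‖v x‖ₑ ^ 2) := by
            refine lintegral_mono fun x => ?_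
            simpa using enorm_add_sq_le (harmExt v (join x t) - v x) (v x)
        _ = 2 * ((∫⁻ x in A, ‖harmExt v (join x t) - v x‖ₑ ^ 2) + J) := by
            rw [lintegral_const_mul' _ _ (by simp), hJ,
              lintegral_add_right' _ (hvA.1.enorm.pow_const 2)]
        _ ≤ _ := by
            gcongr
            refine (lintegral_harmExt_sub_le hv A ht.1).trans ?_
            gcongr
            exact ht.2
    · rw [setLIntegral_const]
      refine ENNReal.mul_lt_top (ENNReal.mul_lt_top (by simp) (ENNReal.add_lt_top.2
        ⟨ENNReal.mul_lt_top ENNReal.ofReal_lt_top hfin.lt_top, hJt.lt_top⟩)) (by simp)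

end SquareIntegrability

/-! ### The interaction measure -/

section Interaction

variable {n m : ℕ}

/-- The measure on pairs of points with density `1 / |x - y|^(n+1)`. -/
noncomputable def interMeasure (n : ℕ) : Measure (Euc n × Euc n) :=
  (volume.prod volume).withDensity fun p => ENNReal.ofReal (1 / ‖p.1 - p.2‖ ^ (n + 1))

/-- The difference of the values of `v` at the two points of a pair. -/
def pairDiff (v : Euc n → Euc m) (p : Euc n × Euc n) : Euc m := v p.1 - v p.2

theorem measurable_interDens :
    Measurable fun p : Euc n × Euc n => ENNReal.ofReal (1 / ‖p.1 - p.2‖ ^ (n + 1)) := by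
  fun_prop

theorem interMeasure_absolutelyContinuous :
    interMeasure n ≪ (volume : Measure (Euc n)).prod volume :=
  withDensity_absolutelyContinuous _ _

theorem aestronglyMeasurable_pairDiff' {v : Euc n → Euc m} (hv : AEStronglyMeasurable v) :
    AEStronglyMeasurable (pairDiff v) (volume.prod volume) :=
  (hv.comp_fst (ν := (volume : Measure (Euc n)))).sub
    (hv.comp_snd (μ := (volume : Measure (Euc n))))

theorem aestronglyMeasurable_pairDiff {v : Euc n → Euc m} (hv : AEStronglyMeasurable v) :
    AEStronglyMeasurable (pairDiff v) (interMeasure n) :=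
  (aestronglyMeasurable_pairDiff' hv).mono_ac interMeasure_absolutelyContinuous

theorem setLIntegral_interMeasure {f : Euc n × Euc n → ℝ≥0∞}
    {S : Set (Euc n × Euc n)} (hS : MeasurableSet S) :
    ∫⁻ p in S, f p ∂(interMeasure n) = ∫⁻ p in S,
      ENNReal.ofReal (1 / ‖p.1 - p.2‖ ^ (n + 1)) * f p ∂(volume.prod volume) := by
  rw [interMeasure, setLIntegral_withDensity_eq_setLIntegral_mul_non_measurable _
    measurable_interDens _ hS (Eventually.of_forall fun _ => ENNReal.ofReal_lt_top)]
  rfl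

theorem gagliardo_eq_interMeasure {v : Euc n → Euc m} (hv : AEStronglyMeasurable v)
    {A B : Set (Euc n)} (hA : MeasurableSet A) (hB : MeasurableSet B) :
    gagliardo v A B = ∫⁻ p in A ×ˢ B, ‖pairDiff v p‖ₑ ^ 2 ∂(interMeasure n) := by
  rw [setLIntegral_interMeasure (hA.prod hB), ← Measure.prod_restrict, lintegral_prod]
  · simp only [gagliardo_eq, gagDens_eq, pairDiff]
  · rw [Measure.prod_restrict]
    exact (measurable_interDens.aemeasurable.mul
      ((aestronglyMeasurable_pairDiff' hv).enorm.pow_const 2)).mono_measure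
        Measure.restrict_le_self

theorem lintegral_gagDens_eq {v : Euc n → Euc m} (hv : AEStronglyMeasurable v)
    {A : Set (Euc n)} (hA : MeasurableSet A) :
    ∫⁻ x in A, ∫⁻ z, gagDens v x z =
      ∫⁻ p in A ×ˢ univ, ‖pairDiff v p‖ₑ ^ 2 ∂(interMeasure n) := by
  rw [← gagliardo_eq_interMeasure hv hA MeasurableSet.univ, gagliardo_eq]
  simp

theorem gagliardo_symm {v : Euc n → Euc m} (hv : AEStronglyMeasurable v) (A B : Set (Euc n)) :
    gagliardo v A B = gagliardo v B A := by
  rw [gagliardo_eq, gagliardo_eq, lintegral_lintegral_swap]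
  · simp only [gagDens_symm]
  · rw [Measure.prod_restrict]
    exact (aemeasurable_gagDens hv).mono_measure Measure.restrict_le_self

/-- The pairs of points at least one of which lies in `A`. -/
def touching (A : Set (Euc n)) : Set (Euc n × Euc n) := {p | p.1 ∈ A ∨ p.2 ∈ A}

theorem measurableSet_touching {A : Set (Euc n)} (hA : MeasurableSet A) :
    MeasurableSet (touching A) :=
  (measurable_fst hA).union (measurable_snd hA)

/-- The energy in `W` is the energy of all the pairs of points that touch `W`. -/
theorem fracEnergy_eq {v : Euc n → Euc m} (hv : AEStronglyMeasurable v) {W : Set (Euc n)}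
    (hW : MeasurableSet W) : fracEnergy v W = ENNReal.ofReal (gammaConst n / 4) *
      ∫⁻ p in touching W, ‖pairDiff v p‖ₑ ^ 2 ∂(interMeasure n) := by
  have hγ := gammaConst_pos n
  have h1 : touching W = (W ×ˢ W ∪ W ×ˢ Wᶜ) ∪ Wᶜ ×ˢ W := by
    ext p
    simp only [touching, mem_ofPred_eq, mem_union, mem_prod, mem_compl_iff]
    tauto
  have d1 : Disjoint (W ×ˢ W) (W ×ˢ Wᶜ) := by
    rw [disjoint_left]
    rintro p ⟨-, h⟩ ⟨-, h'⟩
    exact h' h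
  have d2 : Disjoint (W ×ˢ W ∪ W ×ˢ Wᶜ) (Wᶜ ×ˢ W) := by
    rw [disjoint_left]
    rintro p (⟨h, -⟩ | ⟨h, -⟩) ⟨h', -⟩ <;> exact h' h
  rw [h1, lintegral_union (hW.compl.prod hW) d2, lintegral_union (hW.prod hW.compl) d1,
    ← gagliardo_eq_interMeasure hv hW hW, ← gagliardo_eq_interMeasure hv hW hW.compl,
    ← gagliardo_eq_interMeasure hv hW.compl hW, gagliardo_symm hv Wᶜ W, fracEnergy, add_assoc,
    ← two_mul, mul_add, ← mul_assoc]
  congr 2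
  rw [show (2 : ℝ≥0∞) = ENNReal.ofReal 2 by simp, ← ENNReal.ofReal_mul (by positivity)]
  congr 1; ring

theorem aestronglyMeasurable_of_memLp_compact {v : Euc n → Euc m}
    (hv : ∀ K : Set (Euc n), IsCompact K → MemLp v 2 (volume.restrict K)) :
    AEStronglyMeasurable v := by
  have : LocallyIntegrable v := (locallyIntegrable_iff).2 fun K hK => by
    have : IsFiniteMeasure (volume.restrict K) := ⟨by simpa using hK.measure_lt_top⟩
    exact (hv K hK).integrable one_le_two
  exact this.aestronglyMeasurable

theorem MemHhat.aestronglyMeasurable {W : Set (Euc n)} {v : Euc n → Euc m} (h : MemHhat W v) :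
    AEStronglyMeasurable v := aestronglyMeasurable_of_memLp_compact h.1

theorem MemHhat.memLp_pairDiff {W : Set (Euc n)} (hW : MeasurableSet W) {v : Euc n → Euc m}
    (h : MemHhat W v) : MemLp (pairDiff v) 2 ((interMeasure n).restrict (touching W)) := by
  have hγ := gammaConst_pos n
  refine memLp_two_of_lintegral (aestronglyMeasurable_pairDiff h.aestronglyMeasurable).restrict ?_
  have h2 := h.2
  rw [fracEnergy_eq h.aestronglyMeasurable hW] at h2
  intro htop
  rw [htop, ENNReal.mul_top (by simpa using hγ)] at h2
  exact lt_irrefl _ h2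

theorem MemHhat.lintegral_gagDens_ne_top {W : Set (Euc n)} (hW : MeasurableSet W)
    {v : Euc n → Euc m} (h : MemHhat W v) : ∫⁻ x in W, ∫⁻ z, gagDens v x z ≠ ⊤ := by
  rw [lintegral_gagDens_eq h.aestronglyMeasurable hW]
  refine ((lintegral_mono_set fun p hp => ?_).trans_lt
    (lintegral_two_ne_top (h.memLp_pairDiff hW)).lt_top).ne
  exact Or.inl hp.1

theorem MemHhat.memLp {W : Set (Euc n)} (hW : Bornology.IsBounded W) {v : Euc n → Euc m}
    (h : MemHhat W v) : MemLp v 2 (volume.restrict W) :=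
  (h.1 _ hW.isCompact_closure).mono_measure (Measure.restrict_mono_set _ subset_closure)

end Interaction

end HalfLap

/-! ### The weak form of the Dirichlet-to-Neumann identity -/

namespace HalfLap

section InteractionIntegrals

variable {n m : ℕ}

theorem integrable_interMeasure_iff {E : Type*} [NormedAddCommGroup E] [NormedSpace ℝ E]
    {f : Euc n × Euc n → E} : Integrable f (interMeasure n) ↔
      Integrable (fun p => (1 / ‖p.1 - p.2‖ ^ (n + 1)) • f p) (volume.prod volume) := by
  rw [interMeasure, integrable_withDensity_iff_integrable_smul' measurable_interDens
    (Eventually.of_forall fun _ => ENNReal.ofReal_lt_top)]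
  have e : ∀ p : Euc n × Euc n, (ENNReal.ofReal (1 / ‖p.1 - p.2‖ ^ (n + 1))).toReal =
      1 / ‖p.1 - p.2‖ ^ (n + 1) := fun p => ENNReal.toReal_ofReal (by positivity)
  simp only [e]

theorem integral_interMeasure {E : Type*} [NormedAddCommGroup E] [NormedSpace ℝ E]
    (f : Euc n × Euc n → E) : ∫ p, f p ∂(interMeasure n) =
      ∫ p, (1 / ‖p.1 - p.2‖ ^ (n + 1)) • f p ∂(volume.prod volume) := by
  rw [interMeasure, integral_withDensity_eq_integral_toReal_smul measurable_interDens
    (Eventually.of_forall fun _ => ENNReal.ofReal_lt_top)]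
  have e : ∀ p : Euc n × Euc n, (ENNReal.ofReal (1 / ‖p.1 - p.2‖ ^ (n + 1))).toReal =
      1 / ‖p.1 - p.2‖ ^ (n + 1) := fun p => ENNReal.toReal_ofReal (by positivity)
  simp only [e]

/-- In polar coordinates the integrand is `(min (L * r) M / r) ^ 2`: bounded near `0` and of order
`r ^ (-2)` at infinity. -/
theorem integrable_min_div (hn : 1 ≤ n) {L M : ℝ} (hL : 0 ≤ L) (hM : 0 ≤ M) :
    Integrable fun y : Euc n => 1 / ‖y‖ ^ (n + 1) * min (L * ‖y‖) M ^ 2 := by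
  have hnt : Nontrivial (Euc n) := Module.nontrivial_of_finrank_pos (R := ℝ) (by
    rw [finrank_euclideanSpace, Fintype.card_fin]; exact hn)
  refine (integrable_fun_norm_addHaar volume
    (f := fun r : ℝ => 1 / r ^ (n + 1) * min (L * r) M ^ 2)).2 ?_
  rw [finrank_euclideanSpace, Fintype.card_fin, ← Ioc_union_Ioi_eq_Ioi zero_le_one]
  have hm : Measurable fun y : ℝ => y ^ (n - 1) • (1 / y ^ (n + 1) * min (L * y) M ^ 2) := by
    fun_prop
  have key : ∀ y : ℝ, 0 < y →
      y ^ (n - 1) • (1 / y ^ (n + 1) * min (L * y) M ^ 2) = min (L * y) M ^ 2 / y ^ 2 := by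
    intro y hy
    obtain ⟨k, rfl⟩ := Nat.exists_eq_add_of_le' hn
    rw [Nat.add_sub_cancel, smul_eq_mul]
    field_simp
    ring
  refine IntegrableOn.union ?_ ?_
  · refine (integrableOn_const (C := L ^ 2) (by simp)).mono' hm.aestronglyMeasurable ?_
    filter_upwards [ae_restrict_mem measurableSet_Ioc] with y hy
    have h0 : 0 ≤ min (L * y) M := le_min (by have := hy.1.le; positivity) hM
    rw [key y hy.1, Real.norm_of_nonneg (by positivity), div_le_iff₀ (by have := hy.1; positivity),
      ← mul_pow]
    exact pow_le_pow_left₀ h0 (min_le_left _ _) 2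
  · refine ((integrableOn_Ioi_rpow_of_lt (a := -2) (by norm_num) one_pos).const_mul
      (M ^ 2)).mono' hm.aestronglyMeasurable ?_
    filter_upwards [ae_restrict_mem measurableSet_Ioi] with y hy
    have hy0 : 0 < y := lt_trans one_pos hy
    have h0 : 0 ≤ min (L * y) M := le_min (by positivity) hM
    rw [key y hy0, Real.norm_of_nonneg (by positivity), Real.rpow_neg hy0.le, div_eq_mul_inv]
    norm_num
    gcongr
    exact min_le_right _ _

/-- Lipschitz bounded maps supported in a set of finite measure have finite interaction energy; this
is the dominating function. -/
theorem memLp_min (hn : 1 ≤ n) {L M : ℝ} (hL : 0 ≤ L) (hM : 0 ≤ M) {B : Set (Euc n)}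
    (hB : MeasurableSet B) (hBf : volume B ≠ ⊤) :
    MemLp (fun p => (touching B).indicator (fun p => min (L * ‖p.1 - p.2‖) M) p) 2
      (interMeasure n) := by
  have hm : Measurable fun p : Euc n × Euc n => min (L * ‖p.1 - p.2‖) M :=
    (by fun_prop : Continuous fun p : Euc n × Euc n => min (L * ‖p.1 - p.2‖) M).measurable
  refine (memLp_two_iff_integrable_sq
    ((hm.indicator (measurableSet_touching hB)).aestronglyMeasurable)).2 ?_
  rw [integrable_interMeasure_iff]
  have h1 : Integrable fun x : Euc n => B.indicator (fun _ => (1 : ℝ)) x :=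
    (integrable_indicator_iff hB).2 (integrableOn_const hBf)
  have h2 := integrable_min_div hn hL hM
  have h3 := h1.convolution_integrand (ContinuousLinearMap.mul ℝ ℝ) h2
  have h4 := h3.add h3.swap
  refine h4.mono' ?_ (Eventually.of_forall fun p => ?_)
  · refine Measurable.aestronglyMeasurable (Measurable.smul (f := fun p : Euc n × Euc n =>
      1 / ‖p.1 - p.2‖ ^ (n + 1)) (by fun_prop) ?_)
    exact (hm.indicator (measurableSet_touching hB)).pow_const 2
  · simp only [ContinuousLinearMap.mul_apply', Pi.add_apply, Function.comp_apply, Prod.fst_swap,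
      Prod.snd_swap, smul_eq_mul]
    rw [norm_sub_rev p.2 p.1, Real.norm_of_nonneg (by positivity)]
    have h0 : 0 ≤ 1 / ‖p.1 - p.2‖ ^ (n + 1) * min (L * ‖p.1 - p.2‖) M ^ 2 := by positivity
    by_cases h1 : p.1 ∈ B
    · have : p ∈ touching B := Or.inl h1
      by_cases h2 : p.2 ∈ B
      · simp only [indicator, this, h1, h2, if_true]; linarith
      · simp only [indicator, this, h1, h2, if_true, if_false]; linarith
    · by_cases h2 : p.2 ∈ B
      · have : p ∈ touching B := Or.inr h2
        simp only [indicator, this, h1, h2, if_true, if_false]; linarith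
      · have : p ∉ touching B := fun h => h.elim h1 h2
        simp [indicator, this, h1, h2]

theorem pairDiff_eq_zero_of_notMem {η : Euc n → Euc m} {B : Set (Euc n)}
    (h : ∀ x ∉ B, η x = 0) {p : Euc n × Euc n} (hp : p ∉ touching B) : pairDiff η p = 0 := by
  have h1 : p.1 ∉ B := fun h => hp (Or.inl h)
  have h2 : p.2 ∉ B := fun h => hp (Or.inr h)
  rw [pairDiff, h _ h1, h _ h2, sub_zero]

theorem norm_pairDiff_le {η : Euc n → Euc m} {L M : ℝ}
    (hL : ∀ x z, ‖η x - η z‖ ≤ L * ‖x - z‖) (hM : ∀ x, ‖η x‖ ≤ M) {B : Set (Euc n)}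
    (h : ∀ x ∉ B, η x = 0) (p : Euc n × Euc n) :
    ‖pairDiff η p‖ ≤ (touching B).indicator (fun p => min (L * ‖p.1 - p.2‖) (2 * M)) p := by
  by_cases hp : p ∈ touching B
  · rw [indicator_of_mem hp]
    refine le_min (hL _ _) ((norm_sub_le _ _).trans ?_)
    linarith [hM p.1, hM p.2]
  · rw [indicator_of_notMem hp, pairDiff_eq_zero_of_notMem h hp, norm_zero]

end InteractionIntegrals

section WeakForm

variable {n m : ℕ} {v : Euc n → Euc m} (hv : Integrable (fun z => wt z • v z))

include hv in
theorem integrable_inner_harmGrad {A : Set (Euc n)} (hA : IsOpen A)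
    (hfin : ∫⁻ x in A, ∫⁻ z, gagDens v x z ≠ ⊤) {φ : Euc (n + 1) → Euc m}
    (hφ : ContDiff ℝ 1 φ) (hc : HasCompactSupport φ) (hA' : tsupport φ ⊆ slitSpace A)
    (i : Fin (n + 1)) :
    IntegrableOn (fun X => inner ℝ (partialDeriv i φ X) (harmGrad v X i)) (upperHalf n) := by
  have hd := continuous_partialDeriv hφ i
  obtain ⟨M, hM⟩ := hd.bounded_above_of_compact_support (hasCompactSupport_partialDeriv hc i)
  have hmeas := aestronglyMeasurable_harmGrad (aestronglyMeasurable_of_wt hv) i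
  have hfinm : IsFiniteMeasure (volume.restrict (tsupport φ ∩ upperHalf n)) :=
    ⟨by simpa using (measure_mono inter_subset_left).trans_lt hc.isCompact.measure_lt_top⟩
  have h1 := (memLp_harmGrad hv hA hfin hc.isCompact hA' i).integrable one_le_two
  have h2 : IntegrableOn (fun X => inner ℝ (partialDeriv i φ X) (harmGrad v X i))
      (tsupport φ ∩ upperHalf n) := by
    refine (h1.norm.const_mul M).mono' (hd.aestronglyMeasurable.restrict.inner hmeas.restrict)
      (Eventually.of_forall fun X => (norm_inner_le_norm _ _).trans ?_)
    gcongr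
    exact hM X
  refine h2.of_forall_sdiff_eq_zero measurableSet_upperHalf fun X hX => ?_
  have : partialDeriv i φ X = 0 := image_eq_zero_of_notMem_tsupport fun h =>
    hX.2 ⟨tsupport_partialDeriv_subset φ i h, hX.1⟩
  rw [this, inner_zero_left]

include hv in
/-- Green's formula in the half-space above the height `t`. -/
theorem integral_inner_harmGrad_height {φ : Euc (n + 1) → Euc m} (hφ : ContDiff ℝ 1 φ)
    (hc : HasCompactSupport φ) {t : ℝ} (ht : 0 < t) :
    ∫ X in {X | t < height X}, ∑ i, inner ℝ (partialDeriv i φ X) (harmGrad v X i) =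
      -∫ x, inner ℝ (φ (join x t)) (harmGrad v (join x t) (Fin.last n)) := by
  set S : Set (Euc (n + 1)) := {X | t < height X} with hS
  have hSm : MeasurableSet S := measurableSet_lt measurable_const measurable_height
  obtain ⟨R, hR⟩ := hc.isCompact.isBounded.subset_closedBall 0
  obtain ⟨C, _, H⟩ := exists_abs_dpker_le n (R := R) ht
  have hR' : ∀ X ∈ tsupport φ, ‖X‖ ≤ R := fun X hX => by simpa using hR hX
  have hd : ∀ i, Continuous (partialDeriv i φ) := fun i => continuous_partialDeriv hφ i
  have hdi : ∀ i, Integrable (partialDeriv i φ) := fun i =>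
    (hd i).integrable_of_hasCompactSupport (hasCompactSupport_partialDeriv hc i)
  -- Fubini's theorem moves the integration in `z` outside, on both sides of the identity
  have E1 := fun i => integral_bilin_kernel (innerSL ℝ (E := Euc m)) hv (measurable_dpker i)
    (μ := volume.restrict S) (ξ := fun X => X) measurable_id (b := partialDeriv i φ)
    (hdi i).restrict (C := C) (by
      filter_upwards [ae_restrict_mem hSm] with X hX h0 z
      have hX' : t < height X := hX
      exact H X (hR' X (tsupport_partialDeriv_subset φ i (subset_tsupport _ h0))) hX'.le z i)
  have hjt : Continuous fun x : Euc n => join x t :=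
    continuous_join.comp (by fun_prop : Continuous fun x : Euc n => (x, t))
  have hφt : HasCompactSupport fun x : Euc n => φ (join x t) := by
    refine HasCompactSupport.intro (hc.isCompact.image continuous_horiz) fun s hs => ?_
    exact image_eq_zero_of_notMem_tsupport fun h => hs ⟨_, h, by simp⟩
  have E2 := integral_bilin_kernel (innerSL ℝ (E := Euc m)) hv (measurable_dpker (Fin.last n))
    (μ := volume) (ξ := fun x : Euc n => join x t) hjt.measurable (b := fun x => φ (join x t))
    ((hφ.continuous.comp hjt).integrable_of_hasCompactSupport hφt) (C := C) (by
      refine Eventually.of_forall fun x h0 z => ?_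
      exact H _ (hR' _ (subset_tsupport _ h0)) (by simp) z _)
  have E1' : ∀ i, Integrable (fun z => inner ℝ
      (∫ X in S, dpker i (X - incl z) • partialDeriv i φ X) (v z)) := fun i => (E1 i).1
  have hint : ∀ i, IntegrableOn (fun X => inner ℝ (partialDeriv i φ X) (harmGrad v X i)) S := by
    intro i
    obtain ⟨C', hC'⟩ := exists_norm_harmExt_le hv R ht
    refine ((hdi i).norm.mul_const C').integrableOn.mono'
      ((hd i).aestronglyMeasurable.restrict.inner
        (aestronglyMeasurable_harmGrad (aestronglyMeasurable_of_wt hv) i).restrict) ?_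
    filter_upwards [ae_restrict_mem hSm] with X hX
    refine (norm_inner_le_norm _ _).trans ?_
    by_cases h0 : partialDeriv i φ X = 0
    · simp [h0]
    · gcongr
      have hX' : t < height X := hX
      exact (hC' X (hR' X (tsupport_partialDeriv_subset φ i (subset_tsupport _ h0))) hX'.le).2 i
  have e3 : ∀ z, ∫ X in S, ∑ i, dpker i (X - incl z) • partialDeriv i φ X =
      ∑ i, ∫ X in S, dpker i (X - incl z) • partialDeriv i φ X := by
    intro z
    refine integral_finsetSum _ fun i _ => ?_
    refine ((hdi i).norm.const_mul (C * wt z)).integrableOn.mono' ?_ ?_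
    · have hk : Measurable fun X : Euc (n + 1) => dpker i (X - incl z) :=
        (measurable_dpker i).comp (continuous_id.sub continuous_const).measurable
      exact hk.aestronglyMeasurable.smul (hd i).aestronglyMeasurable.restrict
    · filter_upwards [ae_restrict_mem hSm] with X hX
      by_cases h0 : partialDeriv i φ X = 0
      · simp [h0]
      · have hX' : t < height X := hX
        rw [norm_smul, Real.norm_eq_abs]
        gcongr
        exact H X (hR' X (tsupport_partialDeriv_subset φ i (subset_tsupport _ h0))) hX'.le z i
  rw [integral_finsetSum _ fun i _ => hint i]
  calc ∑ i, ∫ X in S, inner ℝ (partialDeriv i φ X) (harmGrad v X i)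
      = ∑ i, ∫ z, inner ℝ (∫ X in S, dpker i (X - incl z) • partialDeriv i φ X) (v z) :=
        Finset.sum_congr rfl fun i _ => (E1 i).2
    _ = ∫ z, inner ℝ (∫ X in S, ∑ i, dpker i (X - incl z) • partialDeriv i φ X) (v z) := by
        rw [← integral_finsetSum _ fun i _ => E1' i]
        simp only [e3, sum_inner]
    _ = ∫ z, -inner ℝ (∫ x, dpker (Fin.last n) (join x t - incl z) • φ (join x t)) (v z) := by
        simp only [hS, integral_dpker_smul_partialDeriv hφ hc _ ht, inner_neg_left]
    _ = _ := by
        rw [integral_neg]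
        exact congrArg _ E2.2.symm

end WeakForm

end HalfLap

namespace HalfLap

section WeakForm

variable {n m : ℕ}

/-- The vertical derivative of the Poisson kernel, divided by the interaction kernel `1 / ‖y‖^(n+1)`.
It is bounded uniformly in `t` and tends to `gammaConst n` as `t → 0`. -/
noncomputable def normKer (t : ℝ) (y : Euc n) : ℝ :=
  ‖y‖ ^ (n + 1) * dpker (Fin.last n) (join y t)

theorem dpker_last_join_neg (y : Euc n) (t : ℝ) :
    dpker (Fin.last n) (join (-y) t) = dpker (Fin.last n) (join y t) := by
  have h1 : ∀ y : Euc n, (join y t) (Fin.last n) = t := fun y => height_join y t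
  simp only [dpker, norm_sq_join, norm_neg, height_join, h1]

theorem abs_normKer_le (t : ℝ) (y : Euc n) : |normKer t y| ≤ gammaConst n * (n + 2) := by
  have hγ := gammaConst_pos n
  rcases eq_or_ne y 0 with rfl | hy
  · simp only [normKer, norm_zero, zero_pow (Nat.succ_ne_zero n), zero_mul, abs_zero]
    positivity
  · have hy0 : 0 < ‖y‖ := norm_pos_iff.2 hy
    rw [normKer, abs_mul, abs_of_nonneg (by positivity)]
    have h1 : (‖join y t‖ ^ 2) ^ (-(((n : ℝ) + 1) / 2)) ≤ 1 / ‖y‖ ^ (n + 1) := by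
      rw [← rpow_normSq_eq]
      refine Real.rpow_le_rpow_of_nonpos (by positivity) ?_ (by
        have : (0 : ℝ) < (((n : ℝ) + 1) / 2) := by positivity
        linarith)
      rw [norm_sq_join]
      nlinarith [sq_nonneg t]
    calc ‖y‖ ^ (n + 1) * |dpker (Fin.last n) (join y t)|
        ≤ ‖y‖ ^ (n + 1) * (gammaConst n * (n + 2) * (1 / ‖y‖ ^ (n + 1))) := by
          gcongr
          exact (abs_dpker_le _ _).trans (by gcongr)
      _ = _ := by field_simp

theorem continuous_join_left (t : ℝ) : Continuous fun x : Euc n => join x t :=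
  continuous_join.comp (by fun_prop : Continuous fun x : Euc n => (x, t))

theorem measurable_normKer (t : ℝ) : Measurable (normKer (n := n) t) := by
  have h1 : Measurable fun y : Euc n => dpker (Fin.last n) (join y t) :=
    (measurable_dpker _).comp (continuous_join_left t).measurable
  have h2 : Measurable fun y : Euc n => ‖y‖ ^ (n + 1) := by fun_prop
  exact h2.mul h1

/-- The normalized vertical derivative of the kernel converges to the constant `γ`. -/
theorem tendsto_normKer {y : Euc n} (hy : y ≠ 0) :
    Tendsto (fun t => normKer t y) (𝓝[>] 0) (𝓝 (gammaConst n)) := by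
  have hy0 : 0 < ‖y‖ := norm_pos_iff.2 hy
  have hj : join y (0 : ℝ) ∈ ({0}ᶜ : Set (Euc (n + 1))) := by
    intro h
    have h0 : join y (0 : ℝ) = 0 := h
    have := norm_sq_join y (0 : ℝ)
    rw [h0] at this
    have h1 : ‖y‖ ^ 2 = 0 := by simpa using this.symm
    exact hy0.ne' (pow_eq_zero_iff two_ne_zero |>.1 h1)
  have hc : ContinuousAt (fun t => dpker (Fin.last n) (join y t)) 0 :=
    ((continuousOn_dpker (Fin.last n)).continuousAt (isOpen_compl_singleton.mem_nhds hj)).comp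
      (continuous_join_right y).continuousAt
  have h0 : ‖y‖ ^ (n + 1) * dpker (Fin.last n) (join y 0) = gammaConst n := by
    rw [dpker, norm_sq_join, height_join]
    simp only [if_true, one_mul, zero_mul, mul_zero, sub_zero]
    rw [zero_pow two_ne_zero, add_zero, rpow_normSq_eq]
    field_simp
  have := (hc.tendsto.const_mul (‖y‖ ^ (n + 1))).mono_left
    (nhdsWithin_le_nhds (s := Ioi (0 : ℝ)))
  rwa [h0] at this

theorem memLp_pairDiff_of_lintegral {v : Euc n → Euc m} (hv : AEStronglyMeasurable v)
    {A : Set (Euc n)} (hA : MeasurableSet A) (hfin : ∫⁻ x in A, ∫⁻ z, gagDens v x z ≠ ⊤) :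
    MemLp (pairDiff v) 2 ((interMeasure n).restrict (A ×ˢ univ)) := by
  refine memLp_two_of_lintegral (aestronglyMeasurable_pairDiff hv).restrict ?_
  rwa [← lintegral_gagDens_eq hv hA]

theorem memLp_pairDiff_touching {v : Euc n → Euc m} (hv : AEStronglyMeasurable v)
    {A : Set (Euc n)} (hA : MeasurableSet A) (hfin : ∫⁻ x in A, ∫⁻ z, gagDens v x z ≠ ⊤) :
    MemLp (pairDiff v) 2 ((interMeasure n).restrict (touching A)) := by
  refine memLp_two_of_lintegral (aestronglyMeasurable_pairDiff hv).restrict ?_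
  have h1 : touching A = A ×ˢ univ ∪ univ ×ˢ A := by
    ext p; simp [touching]
  have h2 := lintegral_gagDens_eq hv hA
  rw [← gagliardo_eq_interMeasure hv hA MeasurableSet.univ] at h2
  have h3 := gagliardo_symm hv A univ
  rw [h1]
  refine ((lintegral_union_le _ _ _).trans_lt (ENNReal.add_lt_top.2 ⟨?_, ?_⟩)).ne
  · rw [← gagliardo_eq_interMeasure hv hA MeasurableSet.univ, ← h2]
    exact hfin.lt_top
  · rw [← gagliardo_eq_interMeasure hv MeasurableSet.univ hA, ← h3, ← h2]
    exact hfin.lt_top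

variable {v : Euc n → Euc m} (hv : Integrable (fun z => wt z • v z))

include hv in
/-- Absolute convergence of the double integral defining the flux at height `t`. It is dominated by the
interaction energy of `v` over `A` and by the mass of the kernel, since `a ≤ 1 + a²`. -/
theorem integrable_pairing {A : Set (Euc n)} (hA : MeasurableSet A)
    (hfin : ∫⁻ x in A, ∫⁻ z, gagDens v x z ≠ ⊤) {ψ : Euc n → Euc m} (hψ : Continuous ψ)
    (hc : HasCompactSupport ψ) (hψA : ∀ x ∉ A, ψ x = 0) {t : ℝ} (ht : 0 < t) :
    Integrable (fun p : Euc n × Euc n => dpker (Fin.last n) (join (p.1 - p.2) t) *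
      inner ℝ (ψ p.1) (pairDiff v p)) (volume.prod volume) := by
  have hγ := gammaConst_pos n
  have hvm := aestronglyMeasurable_of_wt hv
  obtain ⟨M, hM⟩ := hψ.bounded_above_of_compact_support hc
  have hM0 : 0 ≤ M := (norm_nonneg _).trans (hM 0)
  have hka : Measurable fun y : Euc n => dpker (Fin.last n) (join y t) :=
    (measurable_dpker _).comp (continuous_join_left t).measurable
  have h1 := (hψ.integrable_of_hasCompactSupport hc).norm.convolution_integrand
    (ContinuousLinearMap.mul ℝ ℝ) (integrable_dpker_join (Fin.last n) ht).norm
    (μ := volume) (ν := volume)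
  have h2 : Integrable (fun p => (A ×ˢ univ).indicator (fun p => ‖pairDiff v p‖ ^ 2) p)
      (interMeasure n) :=
    (integrable_indicator_iff (hA.prod MeasurableSet.univ)).2
      ((memLp_pairDiff_of_lintegral hvm hA hfin).integrable_norm_pow two_ne_zero)
  rw [integrable_interMeasure_iff] at h2
  refine (h1.swap.add (h2.const_mul (M * (gammaConst n * (n + 2))))).mono' ?_
    (Eventually.of_forall fun p => ?_)
  · refine AEStronglyMeasurable.mul
      (hka.comp (measurable_fst.sub measurable_snd)).aestronglyMeasurable ?_
    exact (hψ.comp continuous_fst).aestronglyMeasurable.inner (aestronglyMeasurable_pairDiff' hvm)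
  · simp only [Function.comp_apply, Pi.add_apply, Prod.fst_swap, Prod.snd_swap,
      ContinuousLinearMap.mul_apply', smul_eq_mul]
    set a := dpker (Fin.last n) (join (p.1 - p.2) t) with ha
    have ha' : dpker (Fin.last n) (join (p.2 - p.1) t) = a := by
      rw [ha, ← dpker_last_join_neg, neg_sub]
    rw [ha', norm_mul]
    by_cases hpA : p.1 ∈ A
    · have hmem : p ∈ A ×ˢ (univ : Set (Euc n)) := ⟨hpA, mem_univ _⟩
      rw [indicator_of_mem hmem]
      have e1 : ‖(inner ℝ (ψ p.1) (pairDiff v p) : ℝ)‖ ≤ ‖ψ p.1‖ * ‖pairDiff v p‖ :=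
        norm_inner_le_norm _ _
      have e2 : ‖a‖ * ‖pairDiff v p‖ ^ 2 ≤
          gammaConst n * (n + 2) * (1 / ‖p.1 - p.2‖ ^ (n + 1) * ‖pairDiff v p‖ ^ 2) := by
        -- on the diagonal `1 / 0 = 0`, but there the difference of the values vanishes as well
        by_cases h0 : p.1 - p.2 = 0
        · have : pairDiff v p = 0 := by rw [pairDiff, sub_eq_zero.1 h0, sub_self]
          simp [this]
        · have hpos : 0 < ‖p.1 - p.2‖ ^ (n + 1) := by
            have := norm_pos_iff.2 h0
            positivity
          have := abs_normKer_le t (p.1 - p.2)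
          rw [normKer, abs_mul, abs_of_pos hpos, ← ha] at this
          rw [← mul_assoc]
          gcongr
          rw [mul_one_div, le_div_iff₀ hpos, mul_comm, Real.norm_eq_abs]
          exact this
      have e3 := hM p.1
      have e4 : ‖pairDiff v p‖ ≤ 1 + ‖pairDiff v p‖ ^ 2 := by
        nlinarith [sq_nonneg (‖pairDiff v p‖ - 1), norm_nonneg (pairDiff v p)]
      calc ‖a‖ * ‖(inner ℝ (ψ p.1) (pairDiff v p) : ℝ)‖
          ≤ ‖a‖ * (‖ψ p.1‖ * (1 + ‖pairDiff v p‖ ^ 2)) := by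
            gcongr; exact e1.trans (by gcongr)
        _ = ‖ψ p.1‖ * ‖a‖ + ‖ψ p.1‖ * (‖a‖ * ‖pairDiff v p‖ ^ 2) := by ring
        _ ≤ ‖ψ p.1‖ * ‖a‖ + M * (gammaConst n * (n + 2) *
              (1 / ‖p.1 - p.2‖ ^ (n + 1) * ‖pairDiff v p‖ ^ 2)) := by gcongr
        _ = _ := by ring
    · simp [hψA _ hpA, indicator, hpA]

include hv in
/-- The flux of the harmonic extension at height `t`, symmetrized. -/
theorem neg_integral_inner_harmGrad_last {A : Set (Euc n)} (hA : MeasurableSet A)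
    (hfin : ∫⁻ x in A, ∫⁻ z, gagDens v x z ≠ ⊤) {ψ : Euc n → Euc m} (hψ : Continuous ψ)
    (hc : HasCompactSupport ψ) (hψA : ∀ x ∉ A, ψ x = 0) {t : ℝ} (ht : 0 < t) :
    -∫ x, inner ℝ (ψ x) (harmGrad v (join x t) (Fin.last n)) = (1 / 2) *
      ∫ p, normKer t (p.1 - p.2) * inner ℝ (pairDiff ψ p) (pairDiff v p) ∂(interMeasure n) := by
  have hQ := integrable_pairing hv hA hfin hψ hc hψA ht
  set Q : Euc n × Euc n → ℝ := fun p => dpker (Fin.last n) (join (p.1 - p.2) t) *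
    inner ℝ (ψ p.1) (pairDiff v p) with hQdef
  -- subtracting `v x` from the data turns the flux into a double integral of differences
  have e1 : -∫ x, inner ℝ (ψ x) (harmGrad v (join x t) (Fin.last n)) =
      ∫ p, Q p ∂(volume.prod volume) := by
    rw [integral_prod _ hQ, ← integral_neg]
    refine integral_congr_ae (Eventually.of_forall fun x => ?_)
    have hi : Integrable fun z => dpker (Fin.last n) (join x t - incl z) • (v z - v x) := by
      simp only [smul_sub]
      exact (integrable_dpker_smul hv (by simpa using ht) _).sub
        ((integrable_dpker_sub ht x _).smul_const _)
    simp only [hQdef]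
    rw [harmGrad_eq_sub_const hv ht x _ (v x), ← integral_inner hi, ← integral_neg]
    refine integral_congr_ae (Eventually.of_forall fun z => ?_)
    simp only [pairDiff]
    rw [sub_incl_join, inner_smul_right, ← neg_sub (v x) (v z), inner_neg_right]
    ring
  -- the kernel is even, so that exchanging the two points puts a difference on `ψ` too
  have e2 : ∫ p, Q p ∂(volume.prod volume) = (1 / 2) *
      ∫ p, (Q p + Q p.swap) ∂(volume.prod volume) := by
    have h1 := integral_add hQ hQ.swap
    simp only [Function.comp_apply] at h1
    rw [h1, integral_prod_swap]
    ring
  rw [e1, e2, integral_interMeasure]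
  congr 1
  refine integral_congr_ae (Eventually.of_forall fun p => ?_)
  simp only [hQdef, Prod.fst_swap, Prod.snd_swap, smul_eq_mul]
  have hs : pairDiff v p.swap = -pairDiff v p := by simp [pairDiff]
  have ha' : dpker (Fin.last n) (join (p.2 - p.1) t) =
      dpker (Fin.last n) (join (p.1 - p.2) t) := by
    rw [← dpker_last_join_neg, neg_sub]
  rw [hs, ha', inner_neg_right, show pairDiff ψ p = ψ p.1 - ψ p.2 from rfl, inner_sub_left]
  by_cases h0 : p.1 - p.2 = 0
  · have : pairDiff v p = 0 := by rw [pairDiff, sub_eq_zero.1 h0, sub_self]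
    simp [this]
  · have hpos : 0 < ‖p.1 - p.2‖ := norm_pos_iff.2 h0
    rw [normKer]
    field_simp
    ring

include hv in
/-- The weak form of the identity between the fractional energy and the Dirichlet energy of the
harmonic extension: the pairing of the gradient of the extension with that of a test map is
the interaction form of the boundary values. -/
theorem integral_inner_harmGrad (hn : 1 ≤ n) {A : Set (Euc n)} (hA : IsOpen A)
    (hfin : ∫⁻ x in A, ∫⁻ z, gagDens v x z ≠ ⊤) {φ : Euc (n + 1) → Euc m}
    (hφ : ContDiff ℝ 1 φ) (hc : HasCompactSupport φ) (hA' : tsupport φ ⊆ slitSpace A) :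
    ∫ X in upperHalf n, ∑ i, inner ℝ (partialDeriv i φ X) (harmGrad v X i) =
      (gammaConst n / 2) * ∫ p, inner ℝ (pairDiff (fun x => φ (incl x)) p) (pairDiff v p)
        ∂(interMeasure n) := by
  have hγ := gammaConst_pos n
  have hvm := aestronglyMeasurable_of_wt hv
  obtain ⟨R, δ, hδ, hK⟩ := exists_bounds_of_subset_slitSpace hA hc.isCompact hA'
  obtain ⟨M, hM⟩ := hφ.continuous.bounded_above_of_compact_support hc
  have hM0 : 0 ≤ M := (norm_nonneg _).trans (hM 0)
  obtain ⟨L, hL⟩ := hφ.lipschitzWith_of_hasCompactSupport hc one_ne_zero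
  set F : Euc (n + 1) → ℝ := fun X => ∑ i, inner ℝ (partialDeriv i φ X) (harmGrad v X i) with hF
  have hFi : IntegrableOn F (upperHalf n) :=
    integrable_finsetSum _ fun i _ => integrable_inner_harmGrad hv hA hfin hφ hc hA' i
  -- the integral over the half-space is the limit of the integrals above the height `t`
  have hm : ∀ t : ℝ, MeasurableSet {X : Euc (n + 1) | t < height X} := fun t =>
    measurableSet_lt measurable_const measurable_height
  have lim1 : Tendsto (fun t => ∫ X in {X | t < height X}, F X) (𝓝[>] 0)
      (𝓝 (∫ X in upperHalf n, F X)) := by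
    have : ∀ t : ℝ, ∫ X in {X | t < height X}, F X =
        ∫ X, {X : Euc (n + 1) | t < height X}.indicator F X := fun t =>
      (integral_indicator (hm t)).symm
    simp only [this]
    rw [← integral_indicator measurableSet_upperHalf]
    have hFi' : Integrable ((upperHalf n).indicator F) :=
      (integrable_indicator_iff measurableSet_upperHalf).2 hFi
    refine tendsto_integral_filter_of_dominated_convergence
      (fun X => ‖(upperHalf n).indicator F X‖) ?_ ?_ hFi'.norm ?_
    · filter_upwards [self_mem_nhdsWithin] with t ht
      have hsub : {X : Euc (n + 1) | t < height X} ⊆ upperHalf n := fun X (hX : t < height X) =>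
        lt_trans (mem_Ioi.1 ht) hX
      exact ((integrable_indicator_iff (hm t)).2 (hFi.mono_set hsub)).aestronglyMeasurable
    · filter_upwards [self_mem_nhdsWithin] with t ht
      refine Eventually.of_forall fun X => ?_
      exact norm_indicator_le_of_subset (fun X (hX : t < height X) =>
        show 0 < height X from lt_trans (mem_Ioi.1 ht) hX) F X
    · refine Eventually.of_forall fun X => ?_
      refine tendsto_const_nhds.congr' ?_
      by_cases hX : 0 < height X
      · filter_upwards [Ioo_mem_nhdsGT hX] with t ht
        have h1 : X ∈ {X : Euc (n + 1) | t < height X} := ht.2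
        have h2 : X ∈ upperHalf n := hX
        rw [indicator_of_mem h1, indicator_of_mem h2]
      · filter_upwards [self_mem_nhdsWithin] with t ht
        have h1 : X ∉ {X : Euc (n + 1) | t < height X} := fun h => hX (lt_trans (mem_Ioi.1 ht) h)
        have h2 : X ∉ upperHalf n := hX
        rw [indicator_of_notMem h1, indicator_of_notMem h2]
  -- the slices of the test map
  have hsl : ∀ t : ℝ, Continuous fun x : Euc n => φ (join x t) := fun t =>
    hφ.continuous.comp (continuous_join_left t)
  have hslc : ∀ t : ℝ, HasCompactSupport fun x : Euc n => φ (join x t) := fun t => by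
    refine HasCompactSupport.intro (hc.isCompact.image continuous_horiz) fun s hs => ?_
    exact image_eq_zero_of_notMem_tsupport fun h => hs ⟨_, h, by simp⟩
  have hslA : ∀ t : ℝ, 0 ≤ t → t < δ → ∀ x ∉ A, φ (join x t) = 0 := fun t ht htδ x hx => by
    refine image_eq_zero_of_notMem_tsupport fun h => ?_
    obtain h1 | h1 := (hK _ h).2
    · exact hx (by simpa using h1)
    · rw [height_join, abs_of_nonneg ht] at h1
      exact absurd h1 (not_le.2 htδ)
  have hslB : ∀ t : ℝ, ∀ x ∉ Metric.closedBall (0 : Euc n) R, φ (join x t) = 0 := fun t x hx => by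
    refine image_eq_zero_of_notMem_tsupport fun h => hx ?_
    have h1 := (hK _ h).1
    have h2 := norm_horiz_le (join x t)
    rw [horiz_join] at h2
    simpa using h2.trans h1
  have hslL : ∀ t : ℝ, ∀ x z : Euc n, ‖φ (join x t) - φ (join z t)‖ ≤ L * ‖x - z‖ := by
    intro t x z
    refine (hL.norm_sub_le _ _).trans_eq ?_
    rw [← join_sub, sub_self, ← incl_eq_join, norm_incl]
  -- the differences of the slices are dominated, uniformly in `t`, by a square integrable function
  set B := Metric.closedBall (0 : Euc n) R with hB
  have hdom := memLp_min hn L.2 (by positivity : 0 ≤ 2 * M) (B := B)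
    Metric.isClosed_closedBall.measurableSet (isCompact_closedBall _ _).measure_lt_top.ne
  have hdv : MemLp (fun p => (touching A).indicator (fun p => ‖pairDiff v p‖) p) 2
      (interMeasure n) :=
    (memLp_indicator_iff_restrict (measurableSet_touching hA.measurableSet)).2
      (memLp_pairDiff_touching hvm hA.measurableSet hfin).norm
  -- the symmetrized flux converges to the interaction form of the boundary values
  have lim2 : Tendsto (fun t => ∫ p, normKer t (p.1 - p.2) *
      inner ℝ (pairDiff (fun x => φ (join x t)) p) (pairDiff v p) ∂(interMeasure n)) (𝓝[>] 0)
      (𝓝 (∫ p, gammaConst n * inner ℝ (pairDiff (fun x => φ (incl x)) p) (pairDiff v p)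
        ∂(interMeasure n))) := by
    refine tendsto_integral_filter_of_dominated_convergence
      (fun p => (gammaConst n * (n + 2)) * (_ * _)) ?_ ?_
      ((hdom.integrable_mul hdv).const_mul (gammaConst n * (n + 2))) ?_
    · refine Eventually.of_forall fun t => AEStronglyMeasurable.mul ?_ ?_
      · exact ((measurable_normKer t).comp (measurable_fst.sub measurable_snd)).aestronglyMeasurable
      · exact (aestronglyMeasurable_pairDiff (hsl t).aestronglyMeasurable).inner
          (aestronglyMeasurable_pairDiff hvm)
    · filter_upwards [Ioo_mem_nhdsGT hδ] with t ht
      refine Eventually.of_forall fun p => ?_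
      rw [norm_mul]
      refine mul_le_mul (abs_normKer_le _ _) ?_ (norm_nonneg _) (by positivity)
      by_cases hp : p ∈ touching A
      · rw [indicator_of_mem hp]
        refine (norm_inner_le_norm _ _).trans ?_
        gcongr
        exact norm_pairDiff_le (hslL t) (fun x => hM _) (hslB t) p
      · rw [pairDiff_eq_zero_of_notMem (hslA t ht.1.le ht.2) hp, inner_zero_left, norm_zero,
          indicator_of_notMem hp, mul_zero]
    · refine Eventually.of_forall fun p => ?_
      by_cases h0 : p.1 - p.2 = 0
      · have : pairDiff v p = 0 := by rw [pairDiff, sub_eq_zero.1 h0, sub_self]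
        simp [this]
      · refine (tendsto_normKer h0).mul (Tendsto.inner ?_ tendsto_const_nhds)
        have hx : ∀ x : Euc n, Tendsto (fun t => φ (join x t)) (𝓝[>] 0) (𝓝 (φ (incl x))) :=
          fun x => by
            rw [incl_eq_join]
            exact ((hφ.continuous.comp (continuous_join_right x)).tendsto 0).mono_left
              nhdsWithin_le_nhds
        exact (hx p.1).sub (hx p.2)
  rw [integral_const_mul] at lim2
  refine tendsto_nhds_unique lim1 ?_
  have := lim2.const_mul (1 / 2)
  rw [← mul_assoc, one_div_mul_eq_div] at this
  refine this.congr' ?_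
  filter_upwards [Ioo_mem_nhdsGT hδ] with t ht
  rw [hF, integral_inner_harmGrad_height hv hφ hc ht.1,
    neg_integral_inner_harmGrad_last hv hA.measurableSet hfin (hsl t) (hslc t)
      (hslA t ht.1.le ht.2) ht.1]

end WeakForm

end HalfLap

/-! ### Convergence of energies -/

namespace HalfLap

section Convergence

variable {n m : ℕ}

/-- Pairings of strongly convergent sequences in `L²` converge. -/
theorem tendsto_integral_inner {α E : Type*} [MeasurableSpace α] {μ : Measure α}
    [NormedAddCommGroup E] [InnerProductSpace ℝ E] {F G : α → E} {Fk Gk : ℕ → α → E}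
    (hF : MemLp F 2 μ) (hG : MemLp G 2 μ) (hFk : ∀ k, MemLp (Fk k) 2 μ)
    (hGk : ∀ k, MemLp (Gk k) 2 μ)
    (hFt : Tendsto (fun k => eLpNorm (fun x => Fk k x - F x) 2 μ) atTop (𝓝 0))
    (hGt : Tendsto (fun k => eLpNorm (fun x => Gk k x - G x) 2 μ) atTop (𝓝 0)) :
    Tendsto (fun k => ∫ x, inner ℝ (Fk k x) (Gk k x) ∂μ) atTop
      (𝓝 (∫ x, inner ℝ (F x) (G x) ∂μ)) := by
  have e : ∀ {f g : α → E} (hf : MemLp f 2 μ) (hg : MemLp g 2 μ),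
      ∫ x, inner ℝ (f x) (g x) ∂μ = inner ℝ hf.toLp hg.toLp := fun hf hg => by
    rw [L2.inner_def]
    refine integral_congr_ae ?_
    filter_upwards [hf.coeFn_toLp, hg.coeFn_toLp] with x h1 h2
    rw [h1, h2]
  have t1 : Tendsto (fun k => (hFk k).toLp) atTop (𝓝 hF.toLp) :=
    (Lp.tendsto_Lp_iff_tendsto_eLpNorm'' Fk hFk F hF).2 hFt
  have t2 : Tendsto (fun k => (hGk k).toLp) atTop (𝓝 hG.toLp) :=
    (Lp.tendsto_Lp_iff_tendsto_eLpNorm'' Gk hGk G hG).2 hGt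
  have := Tendsto.inner (𝕜 := ℝ) t1 t2
  rw [e hF hG]
  exact this.congr fun k => (e (hFk k) (hGk k)).symm

theorem integrable_inner_of_memLp {α E : Type*} [MeasurableSpace α] {μ : Measure α}
    [NormedAddCommGroup E] [InnerProductSpace ℝ E] {F G : α → E}
    (hF : MemLp F 2 μ) (hG : MemLp G 2 μ) : Integrable (fun x => inner ℝ (F x) (G x)) μ := by
  refine ((hF.norm.integrable_mul hG.norm)).mono' (hF.1.inner hG.1) ?_
  exact Eventually.of_forall fun x => norm_inner_le_norm _ _

/-- Young's inequality with parameter `c` for the pairing of two square integrable maps. -/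
theorem integral_inner_le {α E : Type*} [MeasurableSpace α] {μ : Measure α}
    [NormedAddCommGroup E] [InnerProductSpace ℝ E] {F G : α → E}
    (hF : MemLp F 2 μ) (hG : MemLp G 2 μ) {c : ℝ} (hc : 0 < c) :
    ∫ x, inner ℝ (F x) (G x) ∂μ ≤
      c / 2 * (∫ x, ‖F x‖ ^ 2 ∂μ) + 1 / (2 * c) * ∫ x, ‖G x‖ ^ 2 ∂μ := by
  have h1 : Integrable (fun x => ‖F x‖ ^ 2) μ := hF.integrable_norm_pow two_ne_zero
  have h2 : Integrable (fun x => ‖G x‖ ^ 2) μ := hG.integrable_norm_pow two_ne_zero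
  rw [← integral_const_mul, ← integral_const_mul, ← integral_add (h1.const_mul _) (h2.const_mul _)]
  refine integral_mono (integrable_inner_of_memLp hF hG) ((h1.const_mul _).add (h2.const_mul _))
    fun x => (real_inner_le_norm _ _).trans ?_
  have : 0 ≤ (c * ‖F x‖ - ‖G x‖) ^ 2 / (2 * c) := by positivity
  have e : c / 2 * ‖F x‖ ^ 2 + 1 / (2 * c) * ‖G x‖ ^ 2 - ‖F x‖ * ‖G x‖ =
      (c * ‖F x‖ - ‖G x‖) ^ 2 / (2 * c) := by field_simp; ring
  linarith

theorem ofReal_integral_norm_sq {α E : Type*} [MeasurableSpace α] {μ : Measure α}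
    [NormedAddCommGroup E] {F : α → E} (hF : MemLp F 2 μ) :
    ENNReal.ofReal (∫ x, ‖F x‖ ^ 2 ∂μ) = ∫⁻ x, ‖F x‖ₑ ^ 2 ∂μ := by
  rw [ofReal_integral_eq_lintegral_ofReal (hF.integrable_norm_pow two_ne_zero)
    (Eventually.of_forall fun x => by positivity)]
  refine lintegral_congr fun x => ?_
  rw [← ofReal_norm, ENNReal.ofReal_pow (norm_nonneg _)]

theorem ae_pairDiff {P : Euc n → Prop} (h : ∀ᵐ x, P x) :
    ∀ᵐ p ∂(interMeasure n), P p.1 ∧ P p.2 := by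
  refine interMeasure_absolutelyContinuous.ae_le ?_
  filter_upwards [Measure.quasiMeasurePreserving_fst.ae h,
    Measure.quasiMeasurePreserving_snd.ae h] with p h1 h2 using ⟨h1, h2⟩

theorem pairDiff_congr {u w : Euc n → Euc m} (h : u =ᵐ[volume] w) :
    pairDiff u =ᵐ[interMeasure n] pairDiff w := by
  filter_upwards [ae_pairDiff h] with p hp
  rw [pairDiff, pairDiff, hp.1, hp.2]

/-- Lower semicontinuity of the interaction energy under convergence in `L²`. -/
theorem lintegral_pairDiff_le_of_tendsto {u : Euc n → Euc m} {uk : ℕ → Euc n → Euc m}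
    (hu : AEStronglyMeasurable u) (huk : ∀ k, AEStronglyMeasurable (uk k))
    (h : Tendsto (fun k => eLpNorm (fun x => uk k x - u x) 2) atTop (𝓝 0))
    (S : Set (Euc n × Euc n)) {a : ℕ → ℝ≥0∞} {b : ℝ≥0∞} (ha : Tendsto a atTop (𝓝 b))
    (hle : ∀ k, ∫⁻ p in S, ‖pairDiff (uk k) p‖ₑ ^ 2 ∂(interMeasure n) ≤ a k) :
    ∫⁻ p in S, ‖pairDiff u p‖ₑ ^ 2 ∂(interMeasure n) ≤ b := by
  obtain ⟨ns, hns, hae⟩ :=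
    (tendstoInMeasure_of_tendsto_eLpNorm two_ne_zero huk hu h).exists_seq_tendsto_ae
  have h1 : ∀ᵐ p ∂((interMeasure n).restrict S),
      Tendsto (fun k => ‖pairDiff (uk (ns k)) p‖ₑ ^ 2) atTop (𝓝 (‖pairDiff u p‖ₑ ^ 2)) := by
    refine ae_restrict_of_ae ?_
    filter_upwards [ae_pairDiff hae] with p hp
    exact ENNReal.Tendsto.pow ((hp.1.sub hp.2).enorm)
  calc ∫⁻ p in S, ‖pairDiff u p‖ₑ ^ 2 ∂(interMeasure n)
      = ∫⁻ p in S, liminf (fun k => ‖pairDiff (uk (ns k)) p‖ₑ ^ 2) atTop ∂(interMeasure n) :=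
        lintegral_congr_ae (h1.mono fun p hp => hp.liminf_eq.symm)
    _ ≤ liminf (fun k => ∫⁻ p in S, ‖pairDiff (uk (ns k)) p‖ₑ ^ 2 ∂(interMeasure n)) atTop :=
        lintegral_liminf_le' fun k =>
          ((aestronglyMeasurable_pairDiff (huk _)).enorm.pow_const 2).restrict
    _ ≤ liminf (fun k => a (ns k)) atTop := liminf_le_liminf (Eventually.of_forall fun k => hle _)
    _ = b := (ha.comp hns.tendsto_atTop).liminf_eq

end Convergence

/-! ### Boundary values of truncated harmonic extensions -/

section Truncation

variable {n m : ℕ}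

theorem memLp_indicator_smul {f : Euc (n + 1) → Euc m} {χ : Euc (n + 1) → ℝ} (hχ : Continuous χ)
    (hc : HasCompactSupport χ) {K : Set (Euc (n + 1))} (hK : MeasurableSet K)
    (hχK : ∀ X ∉ K, χ X = 0)
    (hf : MemLp f 2 (volume.restrict (K ∩ upperHalf n))) :
    MemLp ((upperHalf n).indicator fun X => χ X • f X) 2 := by
  obtain ⟨M, hM⟩ := hχ.bounded_above_of_compact_support hc
  rw [memLp_indicator_iff_restrict measurableSet_upperHalf]
  have h1 : MemLp (fun X => χ X • f X) 2 (volume.restrict (K ∩ upperHalf n)) :=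
    MemLp.of_le_mul (c := M) hf (hχ.aestronglyMeasurable.restrict.smul hf.1)
      (Eventually.of_forall fun X => by
        rw [norm_smul]
        exact mul_le_mul_of_nonneg_right (hM X) (norm_nonneg _))
  have h2 : (upperHalf n).indicator (fun X => χ X • f X) =
      (K ∩ upperHalf n).indicator (fun X => χ X • f X) := by
    ext1 X
    by_cases hX : X ∈ K
    · by_cases hH : X ∈ upperHalf n <;> simp [indicator, hX, hH]
    · simp [indicator, hX, hχK X hX]
  rw [← memLp_indicator_iff_restrict measurableSet_upperHalf, h2,
    memLp_indicator_iff_restrict (hK.inter measurableSet_upperHalf)]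
  exact h1

/-- The truncation of the harmonic extension by a cutoff `χ`, extended by zero below the boundary
hyperplane. -/
noncomputable def truncExt (χ : Euc (n + 1) → ℝ) (v : Euc n → Euc m) : Euc (n + 1) → Euc m :=
  (upperHalf n).indicator fun X => χ X • harmExt v X

/-- The gradient of the truncated harmonic extension, by the product rule, extended by zero below the
boundary hyperplane. -/
noncomputable def truncGrad (χ : Euc (n + 1) → ℝ) (v : Euc n → Euc m) (X : Euc (n + 1))
    (i : Fin (n + 1)) : Euc m :=
  (upperHalf n).indicator (fun X => χ X • harmGrad v X i + partialDeriv i χ X • harmExt v X) X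

theorem integrableOn_harmExt_of_isCompact {v : Euc n → Euc m}
    (hv : Integrable (fun z => wt z • v z)) {K : Set (Euc (n + 1))} (hK : IsCompact K)
    (hKH : K ⊆ upperHalf n) :
    IntegrableOn (harmExt v) K ∧ ∀ i, IntegrableOn (fun X => harmGrad v X i) K := by
  obtain ⟨R, δ, hδ, h⟩ := exists_bounds_of_isCompact hK hKH
  obtain ⟨C, hC⟩ := exists_norm_harmExt_le hv R hδ
  have hvm := aestronglyMeasurable_of_wt hv
  refine ⟨?_, fun i => ?_⟩
  · refine (integrableOn_const (C := C) hK.measure_lt_top.ne).mono'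
      (aestronglyMeasurable_harmExt hvm).restrict ?_
    filter_upwards [ae_restrict_mem hK.measurableSet] with X hX
    exact (hC X (h X hX).1 (h X hX).2).1
  · refine (integrableOn_const (C := C) hK.measure_lt_top.ne).mono'
      (aestronglyMeasurable_harmGrad hvm i).restrict ?_
    filter_upwards [ae_restrict_mem hK.measurableSet] with X hX
    exact (hC X (h X hX).1 (h X hX).2).2 i

variable {v : Euc n → Euc m} (hv : Integrable (fun z => wt z • v z))

include hv in
theorem memLp_truncExt {A : Set (Euc n)} (hA : IsOpen A)
    (hfin : ∫⁻ x in A, ∫⁻ z, gagDens v x z ≠ ⊤) (hvA : MemLp v 2 (volume.restrict A))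
    {χ : Euc (n + 1) → ℝ} (hχ : ContDiff ℝ ∞ χ) (hc : HasCompactSupport χ)
    (hχA : tsupport χ ⊆ slitSpace A) :
    MemLp (truncExt χ v) 2 ∧ ∀ i, MemLp (fun X => truncGrad χ v X i) 2 := by
  have hχ1 := contDiff_one_of_infty hχ
  have hK := hc.isCompact
  have h0 : ∀ X ∉ tsupport χ, χ X = 0 := fun X hX => image_eq_zero_of_notMem_tsupport hX
  refine ⟨memLp_indicator_smul hχ.continuous hc hK.measurableSet h0
    (memLp_harmExt hv hA hfin hvA hK hχA), fun i => ?_⟩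
  have h1 := memLp_indicator_smul hχ.continuous hc hK.measurableSet h0
    (memLp_harmGrad hv hA hfin hK hχA i)
  have h2 := memLp_indicator_smul (continuous_partialDeriv hχ1 i)
    (hasCompactSupport_partialDeriv hc i) hK.measurableSet
    (fun X hX => image_eq_zero_of_notMem_tsupport fun h => hX (tsupport_partialDeriv_subset χ i h))
    (memLp_harmExt hv hA hfin hvA hK hχA)
  refine (h1.add h2).ae_eq (Eventually.of_forall fun X => ?_)
  by_cases hX : X ∈ upperHalf n <;> simp [truncGrad, hX]

include hv in
/-- The truncated harmonic extension has the expected boundary values. -/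
theorem exists_isHalfApprox_truncExt {A : Set (Euc n)} (hA : IsOpen A)
    (hfin : ∫⁻ x in A, ∫⁻ z, gagDens v x z ≠ ⊤) (hvA : MemLp v 2 (volume.restrict A))
    {χ : Euc (n + 1) → ℝ} (hχ : ContDiff ℝ ∞ χ) (hc : HasCompactSupport χ)
    (hχA : tsupport χ ⊆ slitSpace A) :
    ∃ V, IsHalfApprox (truncExt χ v) (truncGrad χ v) (fun x => χ (incl x) • v x) V := by
  have hγ := gammaConst_pos n
  have hvm := aestronglyMeasurable_of_wt hv
  have hχ1 := contDiff_one_of_infty hχ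
  obtain ⟨hf2, hG2⟩ := memLp_truncExt hv hA hfin hvA hχ hc hχA
  have hw : IsWeakGrad (upperHalf n) (truncExt χ v) (truncGrad χ v) :=
    (isWeakGrad_harmExt hv).cutoff measurableSet_upperHalf subset_rfl
      (fun K hK hKH => (integrableOn_harmExt_of_isCompact hv hK hKH).1)
      (fun i K hK hKH => (integrableOn_harmExt_of_isCompact hv hK hKH).2 i) hχ
      inter_subset_right
  obtain ⟨τ, V, hτ, hV, -⟩ := exists_isHalfApprox hf2 hG2
    (fun X hX => indicator_of_notMem hX _) (fun X hX i => indicator_of_notMem hX _) hw hc.isCompact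
    (fun X hX => by
      by_cases hXH : X ∈ upperHalf n
      · rw [truncExt, indicator_of_mem hXH, image_eq_zero_of_notMem_tsupport hX, zero_smul]
      · exact indicator_of_notMem hXH _)
  obtain ⟨R, δ, hδ, hK⟩ := exists_bounds_of_subset_slitSpace hA hc.isCompact hχA
  obtain ⟨M, hM⟩ := hχ.continuous.bounded_above_of_compact_support hc
  obtain ⟨L, hL⟩ := hχ1.lipschitzWith_of_hasCompactSupport hc one_ne_zero
  have hM0 : 0 ≤ M := (norm_nonneg _).trans (hM 0)
  set I := ∫⁻ x in A, ∫⁻ z, gagDens v x z with hI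
  set J := ∫⁻ x in A, ‖v x‖ₑ ^ 2 with hJ
  have hJt : J ≠ ⊤ := lintegral_two_ne_top hvA
  have hsl : ∀ t : ℝ, 0 ≤ t → t < δ → ∀ x ∉ A, χ (join x t) = 0 := fun t ht htδ x hx => by
    refine image_eq_zero_of_notMem_tsupport fun h => ?_
    obtain h1 | h1 := (hK _ h).2
    · exact hx (by simpa using h1)
    · rw [height_join, abs_of_nonneg ht] at h1
      exact absurd h1 (not_le.2 htδ)
  have hχm : AEStronglyMeasurable fun x : Euc n => χ (incl x) • v x :=
    (hχ.continuous.comp continuous_incl).aestronglyMeasurable.smul hvm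
  have htr : τ =ᵐ[volume] fun x => χ (incl x) • v x := by
    refine hV.trace_eq hf2.1 hτ.1 hχm ((hG2 _).restrict _) (lt_min hδ one_pos)
      (C := 2 * (M ^ 2 * (gammaConst n * I.toReal) + L ^ 2 * J.toReal)) fun t ht htδ => ?_
    have ht1 : t ≤ 1 := (htδ.trans_le (min_le_right _ _)).le
    have htδ' : t < δ := htδ.trans_le (min_le_left _ _)
    have hpt : ∀ x, ‖truncExt χ v (join x t) - χ (incl x) • v x‖ₑ ^ 2 ≤
        A.indicator (fun x => 2 * (ENNReal.ofReal (M ^ 2) * ‖harmExt v (join x t) - v x‖ₑ ^ 2 +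
          ENNReal.ofReal (L ^ 2 * t) * ‖v x‖ₑ ^ 2)) x := by
      intro x
      have hjH : join x t ∈ upperHalf n := by
        show 0 < height (join x t)
        rwa [height_join]
      rw [truncExt, indicator_of_mem hjH]
      by_cases hx : x ∈ A
      · rw [indicator_of_mem hx]
        have e : χ (join x t) • harmExt v (join x t) - χ (incl x) • v x =
            χ (join x t) • (harmExt v (join x t) - v x) +
              (χ (join x t) - χ (incl x)) • v x := by
          rw [smul_sub, sub_smul]; abel
        rw [e]
        refine (enorm_add_sq_le _ _).trans ?_
        simp only [enorm_smul, mul_pow]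
        have b1 : ‖χ (join x t)‖ₑ ^ 2 ≤ ENNReal.ofReal (M ^ 2) := by
          rw [ENNReal.ofReal_pow hM0, ← ofReal_norm]
          gcongr
          exact hM _
        have b2 : ‖χ (join x t) - χ (incl x)‖ₑ ^ 2 ≤ ENNReal.ofReal (L ^ 2 * t) := by
          rw [← ofReal_norm, ← ENNReal.ofReal_pow (norm_nonneg _)]
          refine ENNReal.ofReal_le_ofReal ?_
          have b3 := hL.norm_sub_le (join x t) (incl x)
          have b4 : ‖join x t - incl x‖ = t := by
            rw [incl_eq_join, ← join_sub, sub_self, sub_zero]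
            have := norm_sq_join (0 : Euc n) t
            rw [norm_zero, zero_pow two_ne_zero, zero_add] at this
            exact (sq_eq_sq₀ (norm_nonneg _) ht.le).1 this
          rw [b4] at b3
          calc ‖χ (join x t) - χ (incl x)‖ ^ 2 ≤ (L * t) ^ 2 := by gcongr
            _ = (L : ℝ) ^ 2 * (t * t) := by ring
            _ ≤ (L : ℝ) ^ 2 * t := by
              gcongr
              nlinarith
        gcongr
      · rw [hsl t ht.le htδ' x hx, incl_eq_join, hsl 0 le_rfl hδ x hx]
        simp
    have hvmA : AEMeasurable (fun x => ‖v x‖ₑ ^ 2) (volume.restrict A) :=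
      (hvm.enorm.pow_const 2).restrict
    refine (lintegral_mono hpt).trans ?_
    rw [lintegral_indicator hA.measurableSet, lintegral_const_mul' _ _ (by simp),
      lintegral_add_right' _ (hvmA.const_mul _), lintegral_const_mul' _ _ ENNReal.ofReal_ne_top,
      lintegral_const_mul' _ _ ENNReal.ofReal_ne_top]
    calc 2 * (ENNReal.ofReal (M ^ 2) * (∫⁻ x in A, ‖harmExt v (join x t) - v x‖ₑ ^ 2) +
          ENNReal.ofReal (L ^ 2 * t) * J)
        ≤ 2 * (ENNReal.ofReal (M ^ 2) * (ENNReal.ofReal (gammaConst n * t) * I) +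
          ENNReal.ofReal (L ^ 2 * t) * J) := by
          gcongr
          exact lintegral_harmExt_sub_le hv A ht
      _ = 2 * (ENNReal.ofReal (M ^ 2) * (ENNReal.ofReal (gammaConst n * t) *
          ENNReal.ofReal I.toReal) + ENNReal.ofReal (L ^ 2 * t) * ENNReal.ofReal J.toReal) := by
          rw [ENNReal.ofReal_toReal hfin, ENNReal.ofReal_toReal hJt]
      _ = ENNReal.ofReal (2 * (M ^ 2 * (gammaConst n * t * I.toReal) +
          L ^ 2 * t * J.toReal)) := by
          rw [ENNReal.ofReal_mul zero_le_two, ENNReal.ofReal_add (by positivity) (by positivity),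
            ENNReal.ofReal_mul (p := M ^ 2) (by positivity),
            ENNReal.ofReal_mul (p := gammaConst n * t) (by positivity),
            ENNReal.ofReal_mul (p := (L : ℝ) ^ 2 * t) (by positivity), ENNReal.ofReal_ofNat]
      _ ≤ _ := ENNReal.ofReal_le_ofReal (le_of_eq (by ring))
  refine ⟨V, hV.contDiff, hV.hasCompactSupport, hV.tendsto, hV.tendsto_grad, ?_⟩
  refine hV.tendsto_trace.congr fun k => ?_
  refine eLpNorm_congr_ae ?_
  filter_upwards [htr] with x hx
  rw [hx]

end Truncation

end HalfLap

/-! ### The sharp trace inequality -/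

namespace HalfLap

section SharpTrace

variable {n m : ℕ}

theorem tendsto_eLpNorm_two_zero_iff {α E : Type*} [MeasurableSpace α] [NormedAddCommGroup E]
    {μ : Measure α} {f : ℕ → α → E} :
    Tendsto (fun k => eLpNorm (f k) 2 μ) atTop (𝓝 0) ↔
      Tendsto (fun k => ∫⁻ x, ‖f k x‖ₑ ^ 2 ∂μ) atTop (𝓝 0) := by
  simp only [← eLpNorm_two_sq]
  constructor
  · intro h
    simpa using ENNReal.Tendsto.pow (n := 2) h
  · intro h
    have h1 := (ENNReal.continuous_rpow_const (y := 1 / 2)).tendsto 0 |>.comp h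
    rw [ENNReal.zero_rpow_of_pos (by norm_num)] at h1
    refine h1.congr fun k => ?_
    simp only [Function.comp_apply]
    rw [← ENNReal.rpow_natCast, ← ENNReal.rpow_mul]
    norm_num

theorem contDiff_incl {k : WithTop ℕ∞} : ContDiff ℝ k (incl : Euc n → Euc (n + 1)) :=
  contDiff_join.comp (contDiff_id.prodMk contDiff_const)

theorem memLp_pairDiff_of_contDiff (hn : 1 ≤ n) {η : Euc n → Euc m} (hη : ContDiff ℝ 1 η)
    (hc : HasCompactSupport η) : MemLp (pairDiff η) 2 (interMeasure n) := by
  obtain ⟨M, hM⟩ := hη.continuous.bounded_above_of_compact_support hc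
  have hM0 : 0 ≤ M := (norm_nonneg _).trans (hM 0)
  obtain ⟨L, hL⟩ := hη.lipschitzWith_of_hasCompactSupport hc one_ne_zero
  have hd := memLp_min hn L.2 (by positivity : 0 ≤ 2 * M) hc.isCompact.measurableSet
    hc.isCompact.measure_lt_top.ne
  exact hd.mono' (aestronglyMeasurable_pairDiff hη.continuous.aestronglyMeasurable)
    (Eventually.of_forall fun p => norm_pairDiff_le (fun x z => hL.norm_sub_le x z) hM
      (fun x hx => image_eq_zero_of_notMem_tsupport hx) p)

theorem lintegral_gagDens_univ {η : Euc n → Euc m} (hη : AEStronglyMeasurable η) :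
    ∫⁻ x in univ, ∫⁻ z, gagDens η x z = ∫⁻ p, ‖pairDiff η p‖ₑ ^ 2 ∂(interMeasure n) := by
  rw [lintegral_gagDens_eq hη MeasurableSet.univ, univ_prod_univ, Measure.restrict_univ]

theorem integrable_wt_smul_of_hasCompactSupport {η : Euc n → Euc m} (hη : Continuous η)
    (hc : HasCompactSupport η) : Integrable (fun z => wt z • η z) :=
  (continuous_wt.smul hη).integrable_of_hasCompactSupport hc.smul_left

/-- The Dirichlet energy of the harmonic extension is controlled by the interaction energy. -/
theorem exists_memLp_harmGrad (hn : 1 ≤ n) : ∃ C : ℝ, 0 < C ∧ ∀ {m : ℕ} {η : Euc n → Euc m},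
    ContDiff ℝ 1 η → HasCompactSupport η → ∀ i,
      MemLp (fun X => harmGrad η X i) 2 (volume.restrict (upperHalf n)) ∧
      ∫ X in upperHalf n, ‖harmGrad η X i‖ ^ 2 ≤ C * ∫ p, ‖pairDiff η p‖ ^ 2 ∂(interMeasure n) := by
  obtain ⟨C, hC, h⟩ := exists_lintegral_harmGrad_le n
  refine ⟨C, hC, fun {m η} hη hc i => ?_⟩
  have hd := memLp_pairDiff_of_contDiff hn hη hc
  have hv := integrable_wt_smul_of_hasCompactSupport hη.continuous hc
  have hηm : AEStronglyMeasurable η := hη.continuous.aestronglyMeasurable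
  have hm := aestronglyMeasurable_harmGrad hηm i
  have h1 : ∫⁻ X in upperHalf n, ‖harmGrad η X i‖ₑ ^ 2 ≤
      ENNReal.ofReal C * ∫⁻ p, ‖pairDiff η p‖ₑ ^ 2 ∂(interMeasure n) := by
    have e := setLIntegral_cylinder (hm.enorm.pow_const 2) (MeasurableSet.univ (α := Euc n))
      (measurableSet_Ioi (a := (0 : ℝ)))
    simp only [mem_univ, true_and] at e
    have e' : {X : Euc (n + 1) | height X ∈ Ioi (0 : ℝ)} = upperHalf n := rfl
    rw [e'] at e
    rw [e, ← lintegral_gagDens_univ hηm]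
    exact h hv i univ
  have h2 : MemLp (fun X => harmGrad η X i) 2 (volume.restrict (upperHalf n)) :=
    memLp_two_of_lintegral hm.restrict (h1.trans_lt
      (ENNReal.mul_lt_top ENNReal.ofReal_lt_top (lintegral_two_ne_top hd).lt_top)).ne
  refine ⟨h2, ?_⟩
  rw [← ofReal_integral_norm_sq h2, ← ofReal_integral_norm_sq hd,
    ← ENNReal.ofReal_mul hC.le] at h1
  exact (ENNReal.ofReal_le_ofReal_iff (mul_nonneg hC.le
    (integral_nonneg fun p => by positivity))).1 h1

theorem memLp_partialDeriv {φ : Euc (n + 1) → Euc m} (hφ : ContDiff ℝ 1 φ)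
    (hc : HasCompactSupport φ) (i : Fin (n + 1)) (S : Set (Euc (n + 1))) :
    MemLp (partialDeriv i φ) 2 (volume.restrict S) :=
  ((continuous_partialDeriv hφ i).memLp_of_hasCompactSupport
    (hasCompactSupport_partialDeriv hc i)).restrict S

/-- The Dirichlet-to-Neumann identity for the harmonic extension of smooth data. -/
theorem integral_inner_harmGrad_of_contDiff (hn : 1 ≤ n) {η : Euc n → Euc m} (hη : ContDiff ℝ 1 η)
    (hηc : HasCompactSupport η) {φ : Euc (n + 1) → Euc m} (hφ : ContDiff ℝ 1 φ)
    (hc : HasCompactSupport φ) :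
    ∑ i, ∫ X in upperHalf n, inner ℝ (partialDeriv i φ X) (harmGrad η X i) =
      (gammaConst n / 2) * ∫ p, inner ℝ (pairDiff (fun x => φ (incl x)) p) (pairDiff η p)
        ∂(interMeasure n) := by
  have hd := memLp_pairDiff_of_contDiff hn hη hηc
  have hηm : AEStronglyMeasurable η := hη.continuous.aestronglyMeasurable
  have hv := integrable_wt_smul_of_hasCompactSupport hη.continuous hηc
  have hfin : ∫⁻ x in univ, ∫⁻ z, gagDens η x z ≠ ⊤ := by
    rw [lintegral_gagDens_univ hηm]
    exact lintegral_two_ne_top hd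
  have hs : tsupport φ ⊆ slitSpace (univ : Set (Euc n)) := by simp [slitSpace_univ]
  rw [← integral_inner_harmGrad hv hn isOpen_univ hfin hφ hc hs]
  exact (integral_finsetSum _ fun i _ =>
    integrable_inner_harmGrad hv isOpen_univ hfin hφ hc hs i).symm

/-- The trace inequality in the energy space, with a constant that is not sharp. -/
theorem exists_lintegral_pairDiff_le (hn : 1 ≤ n) : ∃ C : ℝ, 0 < C ∧ ∀ {m : ℕ}
    {φ : Euc (n + 1) → Euc m}, ContDiff ℝ 1 φ → HasCompactSupport φ →
      ∫⁻ p, ‖pairDiff (fun x => φ (incl x)) p‖ₑ ^ 2 ∂(interMeasure n) ≤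
        ENNReal.ofReal C * ∑ i, ∫⁻ X in upperHalf n, ‖partialDeriv i φ X‖ₑ ^ 2 := by
  obtain ⟨C, hC, h⟩ := exists_memLp_harmGrad hn
  have hγ := gammaConst_pos n
  -- the parameter in Young's inequality for which half of the interaction energy is absorbed
  set c : ℝ := 2 * ((n + 1) * C) / gammaConst n with hc
  have hc0 : 0 < c := by positivity
  refine ⟨2 * c / gammaConst n, by positivity, fun {m φ} hφ hcs => ?_⟩
  have hη : ContDiff ℝ 1 fun x : Euc n => φ (incl x) := hφ.comp contDiff_incl
  have hηc := hasCompactSupport_incl hcs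
  have hd := memLp_pairDiff_of_contDiff hn hη hηc
  have key := integral_inner_harmGrad_of_contDiff hn hη hηc hφ hcs
  simp only [real_inner_self_eq_norm_sq] at key
  set Q := ∫ p, ‖pairDiff (fun x => φ (incl x)) p‖ ^ 2 ∂(interMeasure n) with hQ
  set D : Fin (n + 1) → ℝ := fun i => ∫ X in upperHalf n, ‖partialDeriv i φ X‖ ^ 2 with hD
  have h1 : gammaConst n / 2 * Q ≤ ∑ i, (c / 2 * D i + 1 / (2 * c) * (C * Q)) := by
    rw [← key]
    refine Finset.sum_le_sum fun i _ => ?_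
    obtain ⟨h2, h3⟩ := h hη hηc i
    refine (integral_inner_le (memLp_partialDeriv hφ hcs i _) h2 hc0).trans ?_
    gcongr
  have h2 : gammaConst n / 4 * Q ≤ c / 2 * ∑ i, D i := by
    rw [Finset.sum_add_distrib, ← Finset.mul_sum, Finset.sum_const, Finset.card_univ,
      Fintype.card_fin, nsmul_eq_mul] at h1
    have e : ((n + 1 : ℕ) : ℝ) * (1 / (2 * c) * (C * Q)) = gammaConst n / 4 * Q := by
      rw [hc]; push_cast; field_simp; ring
    rw [e] at h1
    linarith
  have h3 : Q ≤ 2 * c / gammaConst n * ∑ i, D i := by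
    rw [div_mul_eq_mul_div, le_div_iff₀ hγ]
    linarith
  have hD0 : ∀ i, 0 ≤ D i := fun i => integral_nonneg fun X => by positivity
  have e : ∀ i, ENNReal.ofReal (D i) = ∫⁻ X in upperHalf n, ‖partialDeriv i φ X‖ₑ ^ 2 :=
    fun i => ofReal_integral_norm_sq (memLp_partialDeriv hφ hcs i _)
  rw [← ofReal_integral_norm_sq hd]
  simp only [← e]
  rw [← ENNReal.ofReal_sum_of_nonneg fun i _ => hD0 i, ← ENNReal.ofReal_mul (by positivity)]
  exact ENNReal.ofReal_le_ofReal h3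

/-- The boundary values of an approximating sequence converge in the energy space. -/
theorem IsHalfApprox.tendsto_pairDiff (hn : 1 ≤ n) {f : Euc (n + 1) → Euc m}
    {G : Euc (n + 1) → Fin (n + 1) → Euc m} {τ : Euc n → Euc m} {V : ℕ → Euc (n + 1) → Euc m}
    (h : IsHalfApprox f G τ V) (hτ : AEStronglyMeasurable τ)
    (hG : ∀ i, MemLp (fun X => G X i) 2 (volume.restrict (upperHalf n))) :
    Tendsto (fun k => eLpNorm (fun p => pairDiff (fun x => V k (incl x)) p - pairDiff τ p) 2
      (interMeasure n)) atTop (𝓝 0) := by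
  obtain ⟨C, hC, H⟩ := exists_lintegral_pairDiff_le hn
  have hd : ∀ k, ContDiff ℝ 1 (V k) := fun k => contDiff_one_of_infty (h.contDiff k)
  have hVm : ∀ k, AEStronglyMeasurable fun x => V k (incl x) := fun k =>
    ((hd k).continuous.comp continuous_incl).aestronglyMeasurable
  set e : ℕ → Fin (n + 1) → ℝ≥0∞ := fun k i =>
    ∫⁻ X in upperHalf n, ‖partialDeriv i (V k) X - G X i‖ₑ ^ 2 with he
  have he0 : ∀ i, Tendsto (fun k => e k i) atTop (𝓝 0) := fun i =>
    tendsto_eLpNorm_two_zero_iff.1 (h.tendsto_grad i)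
  set b : ℕ → ℝ≥0∞ := fun k => ENNReal.ofReal C * ∑ i, 2 * (e k i + 0) with hb
  have hb0 : Tendsto b atTop (𝓝 0) := by
    have : Tendsto b atTop (𝓝 (ENNReal.ofReal C * ∑ i : Fin (n + 1), 2 * (0 + 0))) := by
      refine ENNReal.Tendsto.const_mul (tendsto_finsetSum _ fun i _ => ?_)
        (Or.inr ENNReal.ofReal_ne_top)
      exact ENNReal.Tendsto.const_mul ((he0 i).add tendsto_const_nhds) (Or.inr (by simp))
    simpa using this
  have hle : ∀ k, ∫⁻ p, ‖pairDiff (fun x => V k (incl x) - τ x) p‖ₑ ^ 2 ∂(interMeasure n) ≤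
      b k := by
    intro k
    rw [← setLIntegral_univ]
    -- the trace inequality for `V k - V j`, in the limit of large `j`
    refine lintegral_pairDiff_le_of_tendsto (u := fun x => V k (incl x) - τ x) ((hVm k).sub hτ)
      (uk := fun j x => V k (incl x) - V j (incl x)) (fun j => (hVm k).sub (hVm j)) ?_ univ
      (a := fun j => ENNReal.ofReal C * ∑ i, 2 * (e k i + e j i)) ?_ fun j => ?_
    · refine h.tendsto_trace.congr fun j => ?_
      rw [← eLpNorm_neg]
      refine congrArg (fun f => eLpNorm f 2 volume) (funext fun x => ?_)
      simp only [Pi.neg_apply]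
      abel
    · refine ENNReal.Tendsto.const_mul (tendsto_finsetSum _ fun i _ => ?_)
        (Or.inr ENNReal.ofReal_ne_top)
      exact ENNReal.Tendsto.const_mul (tendsto_const_nhds.add (he0 i)) (Or.inr (by simp))
    · rw [setLIntegral_univ]
      refine (H (φ := fun X => V k X - V j X) ((hd k).sub (hd j))
        ((h.hasCompactSupport k).sub (h.hasCompactSupport j))).trans ?_
      gcongr with i
      simp only [partialDeriv_sub (hd k) (hd j)]
      rw [he]
      simp only
      rw [← lintegral_add_right', ← lintegral_const_mul' _ _ (by simp)]
      · refine lintegral_mono fun X => ?_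
        have e1 : partialDeriv i (V k) X - partialDeriv i (V j) X =
            (partialDeriv i (V k) X - G X i) + -(partialDeriv i (V j) X - G X i) := by abel
        rw [e1]
        refine (enorm_add_sq_le _ _).trans ?_
        rw [enorm_neg]
      · exact (((continuous_partialDeriv (hd j) i).aestronglyMeasurable).sub
          (hG i).1).enorm.pow_const 2
  refine tendsto_eLpNorm_two_zero_iff.2 (tendsto_of_tendsto_of_tendsto_of_le_of_le
    tendsto_const_nhds hb0 (fun k => zero_le) fun k => ?_)
  refine (lintegral_congr fun p => ?_).trans_le (hle k)
  simp only [pairDiff]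
  congr 2
  abel

/-- The Poisson extension at a fixed height contracts the `L²` norm of the data. -/
theorem lintegral_harmExt_sq_le {v : Euc n → Euc m} (hv : Integrable (fun z => wt z • v z)) {t : ℝ}
    (ht : 0 < t) : ∫⁻ x, ‖harmExt v (join x t)‖ₑ ^ 2 ≤ ∫⁻ x, ‖v x‖ₑ ^ 2 := by
  have hvm := aestronglyMeasurable_of_wt hv
  have hk : Measurable fun p : Euc n × Euc n => ‖pker (join (p.1 - p.2) t)‖ₑ :=
    ((measurable_pker_join t).comp (measurable_fst.sub measurable_snd)).enorm
  have hv2 : AEMeasurable (fun p : Euc n × Euc n => ‖v p.2‖ₑ ^ 2) (volume.prod volume) :=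
    (hvm.comp_snd (μ := (volume : Measure (Euc n)))).enorm.pow_const 2
  calc ∫⁻ x, ‖harmExt v (join x t)‖ₑ ^ 2
      ≤ ∫⁻ x, ∫⁻ z, ‖pker (join (x - z) t)‖ₑ * ‖v z‖ₑ ^ 2 := by
        refine lintegral_mono fun x => ?_
        have := enorm_harmExt_sub_sq_le hv ht x 0
        simpa only [sub_zero, sub_incl_join] using this
    _ = ∫⁻ z, ∫⁻ x, ‖pker (join (x - z) t)‖ₑ * ‖v z‖ₑ ^ 2 :=
        lintegral_lintegral_swap ((hk.aemeasurable.mul hv2).congr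
          (Eventually.of_forall fun p => rfl))
    _ = ∫⁻ z, ‖v z‖ₑ ^ 2 := by
        refine lintegral_congr fun z => ?_
        rw [lintegral_mul_const' _ _ (by finiteness),
          lintegral_sub_right_eq_self (fun y : Euc n => ‖pker (join y t)‖ₑ)]
        have h1 := lintegral_enorm_pker ht (0 : Euc n)
        simp only [sub_incl_join] at h1
        rw [lintegral_sub_left_eq_self (fun y : Euc n => ‖pker (join y t)‖ₑ)] at h1
        rw [h1, one_mul]

end SharpTrace

end HalfLap

namespace HalfLap

section SharpTrace

variable {n m : ℕ}

/-- Rescaled cutoffs: the truncated gradients of the harmonic extension converge to its gradient.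
The gradient of the cutoff is of order `c k` and lives on a layer of height of order `1 / c k`, on
whose slices the extension is bounded in `L²`; hence its contribution is of order `c k`. -/
theorem tendsto_truncGrad {η : Euc n → Euc m} (hv : Integrable (fun z => wt z • η z))
    (hη2 : MemLp η 2)
    (i : Fin (n + 1))
    (hG : MemLp (fun X => harmGrad η X i) 2 (volume.restrict (upperHalf n)))
    {χ : Euc (n + 1) → ℝ} (hχ : ContDiff ℝ ∞ χ) (hc : HasCompactSupport χ)
    (hχ1 : ∀ᶠ X in 𝓝 0, χ X = 1) {c : ℕ → ℝ} (hc0 : ∀ k, 0 < c k)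
    (hct : Tendsto c atTop (𝓝 0)) :
    Tendsto (fun k => eLpNorm (fun X => truncGrad (fun X => χ (c k • X)) η X i - harmGrad η X i) 2
      (volume.restrict (upperHalf n))) atTop (𝓝 0) := by
  have hvm := aestronglyMeasurable_of_wt hv
  have hGm := aestronglyMeasurable_harmGrad hvm i
  have hEm := aestronglyMeasurable_harmExt hvm
  have hχC := contDiff_one_of_infty hχ
  obtain ⟨M, hM⟩ := hχ.continuous.bounded_above_of_compact_support hc
  obtain ⟨M', hM'⟩ := (continuous_partialDeriv hχC i).bounded_above_of_compact_support
    (hasCompactSupport_partialDeriv hc i)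
  have hM0 : 0 ≤ M := (norm_nonneg _).trans (hM 0)
  have hM0' : 0 ≤ M' := (norm_nonneg _).trans (hM' 0)
  obtain ⟨R, hR⟩ := hc.isCompact.isBounded.subset_closedBall 0
  have hpd : ∀ k X, partialDeriv i (fun X => χ (c k • X)) X = c k * partialDeriv i χ (c k • X) := by
    intro k X
    unfold partialDeriv
    rw [show (fun X => χ (c k • X)) = (χ <| c k • ·) from rfl, fderiv_comp_smul]
    rfl
  -- the part containing the gradient of the harmonic extension
  have t1 : Tendsto (fun k => ∫⁻ X in upperHalf n, ‖(χ (c k • X) - 1) • harmGrad η X i‖ₑ ^ 2) atTop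
      (𝓝 0) := by
    have h0 : ∫⁻ _ in upperHalf n, (0 : ℝ≥0∞) = 0 := by simp
    rw [← h0]
    refine tendsto_lintegral_of_dominated_convergence'
      (fun X => ENNReal.ofReal (M + 1) ^ 2 * ‖harmGrad η X i‖ₑ ^ 2) (fun k => ?_) (fun k => ?_) ?_ ?_
    · have : Continuous fun X : Euc (n + 1) => χ (c k • X) - 1 :=
        (hχ.continuous.comp (continuous_const_smul _)).sub continuous_const
      exact ((this.aestronglyMeasurable.smul hGm).enorm.pow_const 2).restrict
    · refine Eventually.of_forall fun X => ?_
      simp only [enorm_smul, mul_pow]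
      gcongr
      rw [← ofReal_norm]
      refine ENNReal.ofReal_le_ofReal ((norm_sub_le _ _).trans ?_)
      simpa using hM (c k • X)
    · rw [lintegral_const_mul' _ _ (by finiteness)]
      exact ENNReal.mul_ne_top (by finiteness) (lintegral_two_ne_top hG)
    · refine Eventually.of_forall fun X => ?_
      have h1 : Tendsto (fun k => c k • X) atTop (𝓝 0) := by
        simpa using hct.smul_const X
      refine tendsto_const_nhds.congr' ?_
      filter_upwards [h1.eventually hχ1] with k hk
      simp [hk]
  -- the part containing the gradient of the cutoff
  have t2 : Tendsto (fun k => ∫⁻ X in upperHalf n,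
      ‖partialDeriv i (fun X => χ (c k • X)) X • harmExt η X‖ₑ ^ 2) atTop (𝓝 0) := by
    set J := ∫⁻ x, ‖η x‖ₑ ^ 2 with hJ
    have hJt : J ≠ ⊤ := lintegral_two_ne_top hη2
    have hlim : Tendsto (fun k => ENNReal.ofReal (c k * (M' ^ 2 * |R|)) * J) atTop (𝓝 0) := by
      have : Tendsto (fun k => ENNReal.ofReal (c k * (M' ^ 2 * |R|)) * J) atTop
          (𝓝 (ENNReal.ofReal (0 * (M' ^ 2 * |R|)) * J)) :=
        ENNReal.Tendsto.mul_const (ENNReal.tendsto_ofReal (hct.mul_const _)) (Or.inr hJt)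
      simpa using this
    refine tendsto_of_tendsto_of_tendsto_of_le_of_le tendsto_const_nhds hlim
      (fun k => zero_le) fun k => ?_
    have hck := hc0 k
    have hpt : ∀ X ∈ upperHalf n, ‖partialDeriv i (fun X => χ (c k • X)) X • harmExt η X‖ₑ ^ 2 ≤
        {X : Euc (n + 1) | horiz X ∈ (univ : Set (Euc n)) ∧
          height X ∈ Ioc 0 (|R| / c k)}.indicator
          (fun X => ENNReal.ofReal (c k * M') ^ 2 * ‖harmExt η X‖ₑ ^ 2) X := by
      intro X hX
      rw [hpd]
      by_cases h0 : partialDeriv i χ (c k • X) = 0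
      · simp [h0]
      · have h1 : ‖c k • X‖ ≤ R := by
          simpa using hR (tsupport_partialDeriv_subset χ i (subset_tsupport _ h0))
        rw [norm_smul, Real.norm_of_nonneg hck.le] at h1
        have h2 : height X ≤ |R| / c k := by
          rw [le_div_iff₀ hck, mul_comm]
          refine le_trans ?_ (h1.trans (le_abs_self R))
          gcongr
          exact (le_abs_self _).trans (abs_height_le X)
        have hmem : X ∈ {X : Euc (n + 1) |
          horiz X ∈ (univ : Set (Euc n)) ∧ height X ∈ Ioc 0 (|R| / c k)} := ⟨mem_univ _, hX, h2⟩
        rw [indicator_of_mem hmem, enorm_smul, mul_pow]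
        gcongr
        rw [← ofReal_norm, norm_mul, Real.norm_of_nonneg hck.le]
        gcongr
        exact hM' _
    have hms : MeasurableSet {X : Euc (n + 1) | horiz X ∈ (univ : Set (Euc n)) ∧
        height X ∈ Ioc 0 (|R| / c k)} :=
      (continuous_horiz.measurable MeasurableSet.univ).inter
        (measurable_height measurableSet_Ioc)
    calc ∫⁻ X in upperHalf n, ‖partialDeriv i (fun X => χ (c k • X)) X • harmExt η X‖ₑ ^ 2
        ≤ ∫⁻ X in upperHalf n, {X : Euc (n + 1) | horiz X ∈ (univ : Set (Euc n)) ∧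
          height X ∈ Ioc 0 (|R| / c k)}.indicator
          (fun X => ENNReal.ofReal (c k * M') ^ 2 * ‖harmExt η X‖ₑ ^ 2) X :=
          setLIntegral_mono' measurableSet_upperHalf hpt
      _ ≤ ∫⁻ X, {X : Euc (n + 1) | horiz X ∈ (univ : Set (Euc n)) ∧
          height X ∈ Ioc 0 (|R| / c k)}.indicator
          (fun X => ENNReal.ofReal (c k * M') ^ 2 * ‖harmExt η X‖ₑ ^ 2) X :=
          setLIntegral_le_lintegral _ _
      _ = ENNReal.ofReal (c k * M') ^ 2 *
          ∫⁻ t in Ioc 0 (|R| / c k), ∫⁻ x, ‖harmExt η (join x t)‖ₑ ^ 2 := by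
          rw [lintegral_indicator hms, lintegral_const_mul' _ _ (by finiteness),
            setLIntegral_cylinder (hEm.enorm.pow_const 2) MeasurableSet.univ measurableSet_Ioc,
            Measure.restrict_univ]
      _ ≤ ENNReal.ofReal (c k * M') ^ 2 * ∫⁻ _ in Ioc 0 (|R| / c k), J := by
          refine mul_le_mul' le_rfl ?_
          exact setLIntegral_mono' measurableSet_Ioc fun t ht => lintegral_harmExt_sq_le hv ht.1
      _ = _ := by
          rw [setLIntegral_const, Real.volume_Ioc, sub_zero, mul_comm J, ← mul_assoc,
            ← ENNReal.ofReal_pow (by positivity), ← ENNReal.ofReal_mul (by positivity)]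
          congr 2
          field_simp
  refine tendsto_eLpNorm_two_zero_iff.2 (tendsto_of_tendsto_of_tendsto_of_le_of_le
    tendsto_const_nhds (by
      have := ENNReal.Tendsto.const_mul (a := 2) (t1.add t2) (Or.inr (by simp))
      simpa using this) (fun k => zero_le) fun k => ?_)
  rw [← lintegral_add_left', ← lintegral_const_mul' _ _ (by simp)]
  · refine setLIntegral_mono' measurableSet_upperHalf fun X hX => ?_
    refine le_trans (le_of_eq ?_) (enorm_add_sq_le _ _)
    rw [truncGrad, indicator_of_mem hX, sub_smul, one_smul]
    congr 2
    abel
  · have : Continuous fun X : Euc (n + 1) => χ (c k • X) - 1 :=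
      (hχ.continuous.comp (continuous_const_smul _)).sub continuous_const
    exact ((this.aestronglyMeasurable.smul hGm).enorm.pow_const 2).restrict

/-- The Dirichlet energy of the harmonic extension is the interaction energy of its data. The extension
itself is not an admissible test map in the Dirichlet-to-Neumann identity; its truncations by
large cutoffs are limits of such maps. -/
theorem sum_integral_harmGrad_eq (hn : 1 ≤ n) {η : Euc n → Euc m} (hη : ContDiff ℝ 1 η)
    (hηc : HasCompactSupport η) :
    ∑ i, ∫ X in upperHalf n, ‖harmGrad η X i‖ ^ 2 =
      (gammaConst n / 2) * ∫ p, ‖pairDiff η p‖ ^ 2 ∂(interMeasure n) := by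
  obtain ⟨C, hC, hCG⟩ := exists_memLp_harmGrad hn
  have hd := memLp_pairDiff_of_contDiff hn hη hηc
  have hηm : AEStronglyMeasurable η := hη.continuous.aestronglyMeasurable
  have hv := integrable_wt_smul_of_hasCompactSupport hη.continuous hηc
  have hη2 : MemLp η 2 := hη.continuous.memLp_of_hasCompactSupport hηc
  have hG : ∀ i, MemLp (fun X => harmGrad η X i) 2 (volume.restrict (upperHalf n)) :=
    fun i => (hCG hη hηc i).1
  have hfin : ∫⁻ x in univ, ∫⁻ z, gagDens η x z ≠ ⊤ := by
    rw [lintegral_gagDens_univ hηm]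
    exact lintegral_two_ne_top hd
  obtain ⟨χ, hχ, hχc, -, hχ1, -⟩ := exists_smooth_cutoff (d := n + 1)
    (isCompact_closedBall (0 : Euc (n + 1)) 1) isOpen_univ (subset_univ _)
  have hχ1' : ∀ X : Euc (n + 1), ‖X‖ ≤ 1 → χ X = 1 := fun X hX =>
    hχ1.self_of_nhdsSet X (by simpa using hX)
  obtain ⟨r, hr⟩ := hηc.isCompact.isBounded.subset_closedBall 0
  -- scales for which every cutoff equals one on the support of `η`
  set c : ℕ → ℝ := fun k => (1 / (|r| + 1)) * (1 / ((k : ℝ) + 1)) with hc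
  have hc0 : ∀ k, 0 < c k := fun k => by positivity
  have hct : Tendsto c atTop (𝓝 0) := by
    simpa [hc] using tendsto_one_div_add_atTop_nhds_zero_nat.const_mul (1 / (|r| + 1))
  have hcr : ∀ k, c k * |r| ≤ 1 := fun k => by
    have h1 : 1 / (|r| + 1) * |r| ≤ 1 := by
      rw [one_div_mul_eq_div, div_le_one (by positivity)]; linarith
    have h2 : 1 / ((k : ℝ) + 1) ≤ 1 := by
      rw [div_le_one (by positivity)]; linarith [(Nat.cast_nonneg k : (0 : ℝ) ≤ k)]
    calc c k * |r| = (1 / (|r| + 1) * |r|) * (1 / ((k : ℝ) + 1)) := by rw [hc]; ring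
      _ ≤ 1 * 1 := mul_le_mul h1 h2 (by positivity) zero_le_one
      _ = 1 := one_mul 1
  set χk : ℕ → Euc (n + 1) → ℝ := fun k X => χ (c k • X) with hχk
  have hχks : ∀ k, ContDiff ℝ ∞ (χk k) := fun k => hχ.comp (contDiff_const_smul _)
  have hχkc : ∀ k, HasCompactSupport (χk k) := fun k => hχc.comp_smul (hc0 k).ne'
  have hsl : ∀ k, tsupport (χk k) ⊆ slitSpace (univ : Set (Euc n)) := fun k => by
    simp [slitSpace_univ]
  have key : ∀ k, ∑ i, ∫ X in upperHalf n, inner ℝ (truncGrad (χk k) η X i) (harmGrad η X i) =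
      (gammaConst n / 2) * ∫ p, ‖pairDiff η p‖ ^ 2 ∂(interMeasure n) := by
    intro k
    obtain ⟨V, hV⟩ := exists_isHalfApprox_truncExt hv isOpen_univ hfin (by simpa using hη2)
      (hχks k) (hχkc k) (hsl k)
    have hT2 := (memLp_truncExt hv isOpen_univ hfin (by simpa using hη2) (hχks k) (hχkc k)
      (hsl k)).2
    have hτ : (fun x : Euc n => χk k (incl x) • η x) = η := by
      funext x
      by_cases hx : x ∈ tsupport η
      · have h1 : ‖x‖ ≤ |r| := by
          have : ‖x‖ ≤ r := by simpa using hr hx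
          exact this.trans (le_abs_self r)
        have : χk k (incl x) = 1 := hχ1' _ (by
          rw [norm_smul, norm_incl, Real.norm_of_nonneg (hc0 k).le]
          exact (mul_le_mul_of_nonneg_left h1 (hc0 k).le).trans (hcr k))
        rw [this, one_smul]
      · rw [image_eq_zero_of_notMem_tsupport hx, smul_zero]
    rw [hτ] at hV
    -- the Dirichlet-to-Neumann identity along smooth approximations of the truncated extension
    have hVd : ∀ j, ContDiff ℝ 1 (V j) := fun j => contDiff_one_of_infty (hV.contDiff j)
    have l1 : Tendsto (fun j => ∑ i, ∫ X in upperHalf n,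
        inner ℝ (partialDeriv i (V j) X) (harmGrad η X i)) atTop
        (𝓝 (∑ i, ∫ X in upperHalf n, inner ℝ (truncGrad (χk k) η X i) (harmGrad η X i))) := by
      refine tendsto_finsetSum _ fun i _ => tendsto_integral_inner ((hT2 i).restrict _) (hG i)
        (fun j => memLp_partialDeriv (hVd j) (hV.hasCompactSupport j) i _) (fun _ => hG i)
        (hV.tendsto_grad i) ?_
      simp
    have l2 : Tendsto (fun j => ∫ p, inner ℝ (pairDiff (fun x => V j (incl x)) p) (pairDiff η p)
        ∂(interMeasure n)) atTop (𝓝 (∫ p, inner ℝ (pairDiff η p) (pairDiff η p)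
        ∂(interMeasure n))) := by
      refine tendsto_integral_inner hd hd (fun j => memLp_pairDiff_of_contDiff hn
        ((hVd j).comp contDiff_incl) (hasCompactSupport_incl (hV.hasCompactSupport j)))
        (fun _ => hd) (hV.tendsto_pairDiff hn hηm fun i => (hT2 i).restrict _) ?_
      simp
    simp only [real_inner_self_eq_norm_sq] at l2
    refine tendsto_nhds_unique l1 ((l2.const_mul (gammaConst n / 2)).congr fun j => ?_)
    exact (integral_inner_harmGrad_of_contDiff hn hη hηc (hVd j) (hV.hasCompactSupport j)).symm
  have l3 : Tendsto (fun k => ∑ i, ∫ X in upperHalf n,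
      inner ℝ (truncGrad (χk k) η X i) (harmGrad η X i)) atTop
      (𝓝 (∑ i, ∫ X in upperHalf n, inner ℝ (harmGrad η X i) (harmGrad η X i))) := by
    refine tendsto_finsetSum _ fun i _ => tendsto_integral_inner (hG i) (hG i)
      (fun k => ((memLp_truncExt hv isOpen_univ hfin (by simpa using hη2) (hχks k) (hχkc k)
        (hsl k)).2 i).restrict _) (fun _ => hG i) ?_ ?_
    · refine tendsto_truncGrad hv hη2 i (hG i) hχ hχc ?_ hc0 hct
      exact hχ1.filter_mono (nhds_le_nhdsSet (by simp))
    · simp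
  simp only [real_inner_self_eq_norm_sq] at l3
  simp only [key] at l3
  exact tendsto_nhds_unique l3 tendsto_const_nhds

/-- The sharp trace inequality: among all maps with given boundary values, the harmonic extension has
the least Dirichlet energy. By the Dirichlet-to-Neumann identity the interaction energy is the
pairing of the gradients of `φ` and of the harmonic extension of its boundary values, and the latter
has Dirichlet energy equal to the interaction energy. -/
theorem integral_pairDiff_sq_le (hn : 1 ≤ n) {φ : Euc (n + 1) → Euc m} (hφ : ContDiff ℝ 1 φ)
    (hc : HasCompactSupport φ) :
    (gammaConst n / 2) * ∫ p, ‖pairDiff (fun x => φ (incl x)) p‖ ^ 2 ∂(interMeasure n) ≤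
      ∑ i, ∫ X in upperHalf n, ‖partialDeriv i φ X‖ ^ 2 := by
  obtain ⟨C, hC, hCG⟩ := exists_memLp_harmGrad hn
  have hη : ContDiff ℝ 1 fun x : Euc n => φ (incl x) := hφ.comp contDiff_incl
  have hηc := hasCompactSupport_incl hc
  have key := integral_inner_harmGrad_of_contDiff hn hη hηc hφ hc
  have h2 := sum_integral_harmGrad_eq hn hη hηc
  simp only [real_inner_self_eq_norm_sq] at key
  have h1 : ∑ i, ∫ X in upperHalf n, inner ℝ (partialDeriv i φ X)
      (harmGrad (fun x => φ (incl x)) X i) ≤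
      ∑ i, (1 / 2 * (∫ X in upperHalf n, ‖partialDeriv i φ X‖ ^ 2) +
        1 / (2 * 1) * ∫ X in upperHalf n, ‖harmGrad (fun x => φ (incl x)) X i‖ ^ 2) :=
    Finset.sum_le_sum fun i _ =>
      integral_inner_le (memLp_partialDeriv hφ hc i _) (hCG hη hηc i).1 one_pos
  rw [Finset.sum_add_distrib, ← Finset.mul_sum, ← Finset.mul_sum, h2, key] at h1
  linarith

end SharpTrace

end HalfLap

/-! ### Traces on the flat part of the boundary -/

namespace HalfLap

section FlatTrace

variable {n m : ℕ}

/-- Together with `union_flatBdry_subset`, this identifies the flat part of the boundary with the part of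
the hyperplane in the interior of `Ω ∪ (upperHalf n)ᶜ`. -/
theorem mem_flatBdry_of_incl_mem {Ω : Set (Euc (n + 1))} (hΩ : IsOpen Ω) (hΩH : Ω ⊆ upperHalf n)
    {x : Euc n} (hx : incl x ∈ interior (Ω ∪ (upperHalf n)ᶜ)) : x ∈ flatBdry Ω := by
  have h0 : height (incl x) = 0 := height_incl x
  refine ⟨?_, ?_⟩
  · rw [hΩ.frontier_eq]
    refine ⟨?_, fun h => ?_⟩
    · have ht : Tendsto (fun t => join x t) (𝓝[>] (0 : ℝ)) (𝓝 (incl x)) :=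
        ((continuous_join_right x).tendsto 0).mono_left nhdsWithin_le_nhds
      refine mem_closure_of_tendsto ht ?_
      filter_upwards [ht.eventually (isOpen_interior.mem_nhds hx), self_mem_nhdsWithin] with t h1 h2
      refine interior_union_compl_inter_subset Ω ⟨h1, ?_⟩
      show 0 < height (join x t)
      rw [height_join]
      exact h2
    · have h1 : 0 < height (incl x) := hΩH h
      exact h1.ne' h0
  · obtain ⟨r, hr, h⟩ := Metric.isOpen_iff.1 isOpen_interior _ hx
    exact ⟨r, hr, fun Y hY => interior_union_compl_inter_subset Ω ⟨h hY.1, hY.2⟩⟩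

theorem isOpen_flatBdry {Ω : Set (Euc (n + 1))} (hΩ : IsOpen Ω) (hΩH : Ω ⊆ upperHalf n) :
    IsOpen (flatBdry Ω) := by
  have : flatBdry Ω = incl ⁻¹' interior (Ω ∪ (upperHalf n)ᶜ) := by
    ext x
    exact ⟨fun h => union_flatBdry_subset hΩ (Or.inr ⟨x, h, rfl⟩),
      fun h => mem_flatBdry_of_incl_mem hΩ hΩH h⟩
  rw [this]
  exact isOpen_interior.preimage continuous_incl

/-- The closure of an admissible set meets the hyperplane only in the closure of the flat part of its
boundary. -/
theorem IsAdmissible.closure_subset {Ω : Set (Euc (n + 1))} (hΩ : IsAdmissible Ω)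
    {W : Set (Euc n)} (hΩW : closure (flatBdry Ω) ⊆ W) : closure Ω ⊆ slitSpace W := by
  rw [closure_eq_self_union_frontier, hΩ.frontier_eq]
  rintro X (hX | hX | ⟨x, hx, rfl⟩)
  · exact Or.inl (ne_of_gt (hΩ.subset_upperHalf hX))
  · exact Or.inl (ne_of_gt hX.2)
  · exact Or.inr (by simpa using hΩW hx)

theorem partialDeriv_add {d : ℕ} {E : Type*} [NormedAddCommGroup E] [NormedSpace ℝ E]
    {φ ψ : Euc d → E} (hφ : ContDiff ℝ 1 φ) (hψ : ContDiff ℝ 1 ψ) (i : Fin d) (X : Euc d) :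
    partialDeriv i (fun Y => φ Y + ψ Y) X = partialDeriv i φ X + partialDeriv i ψ X := by
  have := fderiv_add (hφ.differentiable one_ne_zero X) (hψ.differentiable one_ne_zero X)
  unfold partialDeriv
  change (fderiv ℝ (φ + ψ) X) _ = _
  rw [this]; rfl

theorem partialDeriv_smul {d : ℕ} {E : Type*} [NormedAddCommGroup E] [NormedSpace ℝ E]
    {χ : Euc d → ℝ} {ψ : Euc d → E} (hχ : ContDiff ℝ 1 χ) (hψ : ContDiff ℝ 1 ψ)
    (i : Fin d) (X : Euc d) : partialDeriv i (fun Y => χ Y • ψ Y) X =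
      χ X • partialDeriv i ψ X + partialDeriv i χ X • ψ X := by
  have := fderiv_smul (hχ.differentiable one_ne_zero X) (hψ.differentiable one_ne_zero X)
  unfold partialDeriv
  change (fderiv ℝ (χ • ψ) X) _ = _
  rw [this]
  simp

theorem eLpNorm_smul_le_of_bound {α E : Type*} [MeasurableSpace α] [NormedAddCommGroup E]
    [NormedSpace ℝ E] {μ : Measure α} {a : α → ℝ} {M : ℝ} (ha : ∀ x, ‖a x‖ ≤ M) (f : α → E) :
    eLpNorm (fun x => a x • f x) 2 μ ≤ ENNReal.ofReal M * eLpNorm f 2 μ := by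
  refine eLpNorm_le_mul_eLpNorm_of_ae_le_mul (Eventually.of_forall fun x => ?_) 2
  rw [norm_smul]
  exact mul_le_mul_of_nonneg_right (ha x) (norm_nonneg _)

/-- Smooth maps whose values and gradients tend to zero in `L²(Ω)` have boundary values tending to
zero, locally in the flat part of the boundary. -/
theorem tendsto_trace_cutoff {Ω : Set (Euc (n + 1))} {D : ℕ → Euc (n + 1) → Euc m}
    (hD : ∀ k, ContDiff ℝ 1 (D k))
    (h0 : Tendsto (fun k => eLpNorm (D k) 2 (volume.restrict Ω)) atTop (𝓝 0))
    (h1 : Tendsto (fun k => eLpNorm (partialDeriv (Fin.last n) (D k)) 2 (volume.restrict Ω)) atTop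
      (𝓝 0))
    (hΩ : MeasurableSet Ω) (hΩH : Ω ⊆ upperHalf n) {χ : Euc (n + 1) → ℝ} (hχ : ContDiff ℝ 1 χ)
    (hc : HasCompactSupport χ) (hχΩ : tsupport χ ∩ upperHalf n ⊆ Ω) :
    Tendsto (fun k => eLpNorm (fun x : Euc n => χ (incl x) • D k (incl x)) 2) atTop (𝓝 0) := by
  set i := Fin.last n
  obtain ⟨M, hM⟩ := hχ.continuous.bounded_above_of_compact_support hc
  obtain ⟨M', hM'⟩ := (continuous_partialDeriv hχ i).bounded_above_of_compact_support
    (hasCompactSupport_partialDeriv hc i)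
  -- integrals over the half-space of maps supported in the support of `χ`
  have hres : ∀ {a : Euc (n + 1) → ℝ} (f : Euc (n + 1) → Euc m), (∀ X ∉ tsupport χ, a X = 0) →
      eLpNorm (fun X => a X • f X) 2 (volume.restrict (upperHalf n)) =
        eLpNorm (fun X => a X • f X) 2 (volume.restrict Ω) := by
    intro a f ha
    rw [← eLpNorm_indicator_eq_eLpNorm_restrict measurableSet_upperHalf,
      ← eLpNorm_indicator_eq_eLpNorm_restrict hΩ]
    congr 1
    ext1 X
    by_cases hX : X ∈ tsupport χ
    · by_cases hXH : X ∈ upperHalf n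
      · rw [indicator_of_mem hXH, indicator_of_mem (hχΩ ⟨hX, hXH⟩)]
      · rw [indicator_of_notMem hXH, indicator_of_notMem fun h => hXH (hΩH h)]
    · simp [indicator, ha X hX]
  have hχ0 : ∀ X ∉ tsupport χ, χ X = 0 := fun X hX => image_eq_zero_of_notMem_tsupport hX
  have hχ0' : ∀ X ∉ tsupport χ, partialDeriv i χ X = 0 := fun X hX =>
    image_eq_zero_of_notMem_tsupport fun h => hX (tsupport_partialDeriv_subset χ i h)
  have hb : Tendsto (fun k => ENNReal.ofReal M * eLpNorm (D k) 2 (volume.restrict Ω) +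
      (ENNReal.ofReal M * eLpNorm (partialDeriv i (D k)) 2 (volume.restrict Ω) +
        ENNReal.ofReal M' * eLpNorm (D k) 2 (volume.restrict Ω))) atTop (𝓝 0) := by
    have := (ENNReal.Tendsto.const_mul h0 (Or.inr (ENNReal.ofReal_ne_top (r := M)))).add
      ((ENNReal.Tendsto.const_mul h1 (Or.inr (ENNReal.ofReal_ne_top (r := M)))).add
        (ENNReal.Tendsto.const_mul h0 (Or.inr (ENNReal.ofReal_ne_top (r := M')))))
    simpa using this
  refine tendsto_of_tendsto_of_tendsto_of_le_of_le tendsto_const_nhds hb (fun k => zero_le)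
    fun k => ?_
  refine (eLpNorm_trace_le (φ := fun X => χ X • D k X) (hχ.smul (hD k)) hc.smul_right).trans ?_
  refine add_le_add ?_ ?_
  · rw [hres _ hχ0]
    exact eLpNorm_smul_le_of_bound hM _
  · have e : partialDeriv i (fun X => χ X • D k X) =
        (fun X => χ X • partialDeriv i (D k) X) + fun X => partialDeriv i χ X • D k X :=
      funext fun X => partialDeriv_smul hχ (hD k) i X
    rw [e]
    refine (eLpNorm_add_le
      (hχ.continuous.smul (continuous_partialDeriv (hD k) i)).aestronglyMeasurable
      ((continuous_partialDeriv hχ i).smul (hD k).continuous).aestronglyMeasurable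
      one_le_two).trans ?_
    refine add_le_add ?_ ?_
    · refine (hres _ hχ0).trans_le ?_
      exact eLpNorm_smul_le_of_bound hM _
    · refine (hres _ hχ0').trans_le ?_
      exact eLpNorm_smul_le_of_bound hM' _

theorem tendsto_eLpNorm_sub {α E : Type*} [MeasurableSpace α] [NormedAddCommGroup E]
    {μ : Measure α} {f g : ℕ → α → E} (hf : ∀ k, AEStronglyMeasurable (f k) μ)
    (hg : ∀ k, AEStronglyMeasurable (g k) μ)
    (h1 : Tendsto (fun k => eLpNorm (f k) 2 μ) atTop (𝓝 0))
    (h2 : Tendsto (fun k => eLpNorm (g k) 2 μ) atTop (𝓝 0)) :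
    Tendsto (fun k => eLpNorm (fun x => f k x - g k x) 2 μ) atTop (𝓝 0) := by
  refine tendsto_of_tendsto_of_tendsto_of_le_of_le tendsto_const_nhds
    (by simpa using h1.add h2) (fun k => zero_le) fun k => ?_
  exact eLpNorm_sub_le (hf k) (hg k) one_le_two

theorem tendsto_eLpNorm_add {α E : Type*} [MeasurableSpace α] [NormedAddCommGroup E]
    {μ : Measure α} {f g : ℕ → α → E} (hf : ∀ k, AEStronglyMeasurable (f k) μ)
    (hg : ∀ k, AEStronglyMeasurable (g k) μ)
    (h1 : Tendsto (fun k => eLpNorm (f k) 2 μ) atTop (𝓝 0))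
    (h2 : Tendsto (fun k => eLpNorm (g k) 2 μ) atTop (𝓝 0)) :
    Tendsto (fun k => eLpNorm (fun x => f k x + g k x) 2 μ) atTop (𝓝 0) := by
  refine tendsto_of_tendsto_of_tendsto_of_le_of_le tendsto_const_nhds
    (by simpa using h1.add h2) (fun k => zero_le) fun k => ?_
  exact eLpNorm_add_le (hf k) (hg k) one_le_two

/-- The trace on the flat part of the boundary is unique. -/
theorem IsFlatTrace.ae_eq {Ω : Set (Euc (n + 1))} (hΩ : IsOpen Ω) (hΩH : Ω ⊆ upperHalf n)
    {u : Euc (n + 1) → Euc m} {w w' : Euc n → Euc m} (h : IsFlatTrace Ω u w)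
    (h' : IsFlatTrace Ω u w') : ∀ᵐ x, x ∈ flatBdry Ω → w x = w' x := by
  obtain ⟨hu, hw, U, hU, U0, U1, U2⟩ := h
  obtain ⟨-, hw', U', hU', U0', U1', U2'⟩ := h'
  have hΓm := (isOpen_flatBdry hΩ hΩH).measurableSet
  have hd : ∀ k, ContDiff ℝ 1 (U k) := fun k => contDiff_one_of_infty (hU k)
  have hd' : ∀ k, ContDiff ℝ 1 (U' k) := fun k => contDiff_one_of_infty (hU' k)
  set i := Fin.last n
  have hg := (hu.isWeakGrad.1 i).1
  have hum := hu.1.1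
  have D0 : Tendsto (fun k => eLpNorm (fun X => U k X - U' k X) 2 (volume.restrict Ω)) atTop
      (𝓝 0) := by
    refine (tendsto_eLpNorm_sub (fun k => (hd k).continuous.aestronglyMeasurable.sub hum)
      (fun k => (hd' k).continuous.aestronglyMeasurable.sub hum) U0 U0').congr fun k => ?_
    simp
  have D1 : Tendsto (fun k => eLpNorm (partialDeriv i (fun X => U k X - U' k X)) 2
      (volume.restrict Ω)) atTop (𝓝 0) := by
    refine (tendsto_eLpNorm_sub
      (fun k => (continuous_partialDeriv (hd k) i).aestronglyMeasurable.sub hg)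
      (fun k => (continuous_partialDeriv (hd' k) i).aestronglyMeasurable.sub hg)
      (U1 i) (U1' i)).congr fun k => ?_
    rw [show partialDeriv i (fun X => U k X - U' k X) =
      fun X => partialDeriv i (U k) X - partialDeriv i (U' k) X from
        funext fun X => partialDeriv_sub (hd k) (hd' k) i X]
    simp
  have hUi : ∀ k, Continuous fun x : Euc n => U k (incl x) := fun k =>
    (hd k).continuous.comp continuous_incl
  have hUi' : ∀ k, Continuous fun x : Euc n => U' k (incl x) := fun k =>
    (hd' k).continuous.comp continuous_incl
  have D2 := tendsto_eLpNorm_sub (fun k => (hUi k).aestronglyMeasurable.sub hw.1)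
    (fun k => (hUi' k).aestronglyMeasurable.sub hw'.1) U2 U2'
  -- it suffices to show that the traces agree almost everywhere near each point of the flat part
  suffices hnull : volume {x | ¬(x ∈ flatBdry Ω → w x = w' x)} = 0 from hnull
  refine measure_null_of_locally_null _ fun x₀ hx₀ => ?_
  have hx₀' : x₀ ∈ flatBdry Ω := by
    by_contra hh
    exact hx₀ fun h => absurd h hh
  obtain ⟨χ, hχ, hχc, hχs, hχ1, -⟩ := exists_smooth_cutoff (isCompact_singleton (x := incl x₀))
    isOpen_interior (singleton_subset_iff.2 (union_flatBdry_subset hΩ (Or.inr ⟨x₀, hx₀', rfl⟩)))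
  have hχd := contDiff_one_of_infty hχ
  obtain ⟨M, hM⟩ := hχ.continuous.bounded_above_of_compact_support hχc
  have hχi : Continuous fun x : Euc n => χ (incl x) := hχ.continuous.comp continuous_incl
  have t1 := tendsto_trace_cutoff (D := fun k X => U k X - U' k X) (fun k => (hd k).sub (hd' k))
    D0 D1 hΩ.measurableSet hΩH hχd hχc
    (fun X hX => interior_union_compl_inter_subset Ω ⟨hχs hX.1, hX.2⟩)
  have hz : eLpNorm (fun x => χ (incl x) • (w x - w' x)) 2 (volume.restrict (flatBdry Ω)) = 0 := by
    refine le_antisymm (ge_of_tendsto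
      (f := fun k => eLpNorm (fun x : Euc n => χ (incl x) • (U k (incl x) - U' k (incl x))) 2 +
        ENNReal.ofReal M * eLpNorm (fun x => (U k (incl x) - w x) - (U' k (incl x) - w' x)) 2
          (volume.restrict (flatBdry Ω))) (x := atTop) ?_ ?_) zero_le
    · have := t1.add (ENNReal.Tendsto.const_mul D2 (Or.inr (ENNReal.ofReal_ne_top (r := M))))
      simpa using this
    · refine Eventually.of_forall fun k => ?_
      have e : (fun x => χ (incl x) • (w x - w' x)) =
          (fun x : Euc n => χ (incl x) • (U k (incl x) - U' k (incl x))) -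
          fun x : Euc n => χ (incl x) • ((U k (incl x) - w x) - (U' k (incl x) - w' x)) := by
        funext x
        simp only [Pi.sub_apply, ← smul_sub]
        congr 1
        abel
      rw [e]
      refine (eLpNorm_sub_le
        (hχi.smul ((hUi k).sub (hUi' k))).aestronglyMeasurable
        (hχi.aestronglyMeasurable.smul (((hUi k).aestronglyMeasurable.sub hw.1).sub
          ((hUi' k).aestronglyMeasurable.sub hw'.1))) one_le_two).trans ?_
      refine add_le_add (eLpNorm_mono_measure _ Measure.restrict_le_self) ?_
      exact eLpNorm_smul_le_of_bound (fun x : Euc n => hM (incl x)) _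
  have hz' := (eLpNorm_eq_zero_iff (hχi.aestronglyMeasurable.smul (hw.1.sub hw'.1))
    two_ne_zero).1 hz
  have hz'' := (ae_restrict_iff' hΓm).1 hz'
  have hN : {x : Euc n | χ (incl x) = 1} ∈ 𝓝 x₀ := by
    have h1 : ∀ᶠ X in 𝓝 (incl x₀), χ X = 1 := hχ1.filter_mono (nhds_le_nhdsSet (mem_singleton _))
    exact continuous_incl.continuousAt.eventually h1
  refine ⟨_, inter_mem_nhdsWithin _ hN, measure_mono_null ?_ (ae_iff.1 hz'')⟩
  rintro x ⟨hx, hx1⟩ hcon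
  have hx1' : χ (incl x) = 1 := hx1
  refine hx fun hxΓ => ?_
  have := hcon hxΓ
  simp only [hx1', one_smul, Pi.zero_apply, Pi.smul_apply', Pi.sub_apply] at this
  exact sub_eq_zero.1 this

end FlatTrace

end HalfLap

/-! ### Comparison of the energies -/

namespace HalfLap

section Comparison

variable {n m : ℕ}

/-- The Dirichlet energy may be computed with any square integrable weak gradient. -/
theorem dirichletEnergy_eq {Ω : Set (Euc (n + 1))} (hΩ : IsOpen Ω) {u : Euc (n + 1) → Euc m}
    {G : Euc (n + 1) → Fin (n + 1) → Euc m} (hu : MemLp u 2 (volume.restrict Ω))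
    (hG : ∀ i, MemLp (fun X => G X i) 2 (volume.restrict Ω)) (hw : IsWeakGrad Ω u G) :
    dirichletEnergy Ω u = (1 / 2) * ∑ i, ∫ X in Ω, ‖G X i‖ ^ 2 := by
  have hae : ∀ᵐ X ∂(volume.restrict Ω), ∀ i, weakGrad Ω u X i = G X i := by
    refine ae_all_iff.2 fun i => (ae_restrict_iff' hΩ.measurableSet).2 ?_
    exact hw.weakGrad_ae_eq hΩ hu hG i
  rw [dirichletEnergy, ← integral_finsetSum _ fun i _ => (hG i).integrable_norm_pow two_ne_zero]
  congr 1
  refine integral_congr_ae ?_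
  filter_upwards [hae] with X hX
  simp only [hX]

theorem fracEnergy_congr {v w : Euc n → Euc m} (hv : AEStronglyMeasurable v)
    (h : w =ᵐ[volume] v) {W : Set (Euc n)} (hW : MeasurableSet W) :
    fracEnergy w W = fracEnergy v W := by
  rw [fracEnergy_eq hv hW, fracEnergy_eq (hv.congr h.symm) hW]
  congr 1
  refine lintegral_congr_ae (ae_restrict_of_ae ?_)
  filter_upwards [pairDiff_congr h] with p hp
  rw [hp]

theorem MemHhat.toReal_fracEnergy {W : Set (Euc n)} (hW : MeasurableSet W) {v : Euc n → Euc m}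
    (h : MemHhat W v) : (fracEnergy v W).toReal =
      gammaConst n / 4 * ∫ p in touching W, ‖pairDiff v p‖ ^ 2 ∂(interMeasure n) := by
  have hγ := gammaConst_pos n
  rw [fracEnergy_eq h.aestronglyMeasurable hW, ← ofReal_integral_norm_sq (h.memLp_pairDiff hW),
    ← ENNReal.ofReal_mul (by positivity), ENNReal.toReal_ofReal]
  exact mul_nonneg (by positivity) (integral_nonneg fun p => by positivity)

/-- The variation of the fractional energy under a smooth perturbation of the extension, bounded by
the variation of the Dirichlet energy. Both energies are quadratic: their first variations agree by
the Dirichlet-to-Neumann identity, and the second ones are compared by the sharp trace inequality. -/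
theorem lintegral_pairDiff_add_le (hn : 1 ≤ n) {W : Set (Euc n)} (hWo : IsOpen W)
    {v : Euc n → Euc m} (hv : MemHhat W v) (hw : Integrable (fun z => wt z • v z))
    {φ : Euc (n + 1) → Euc m} (hφ : ContDiff ℝ 1 φ) (hc : HasCompactSupport φ)
    (hφW : tsupport φ ⊆ slitSpace W) :
    0 ≤ (fracEnergy v W).toReal +
      (∑ i, ∫ X in upperHalf n, inner ℝ (partialDeriv i φ X) (harmGrad v X i)) +
      1 / 2 * ∑ i, ∫ X in upperHalf n, ‖partialDeriv i φ X‖ ^ 2 ∧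
    ENNReal.ofReal (gammaConst n / 4) *
      ∫⁻ p in touching W, ‖pairDiff (fun x => v x + φ (incl x)) p‖ₑ ^ 2 ∂(interMeasure n) ≤
    ENNReal.ofReal ((fracEnergy v W).toReal +
      (∑ i, ∫ X in upperHalf n, inner ℝ (partialDeriv i φ X) (harmGrad v X i)) +
      1 / 2 * ∑ i, ∫ X in upperHalf n, ‖partialDeriv i φ X‖ ^ 2) := by
  have hγ := gammaConst_pos n
  have hWm := hWo.measurableSet
  have hfin := hv.lintegral_gagDens_ne_top hWm
  have hη : ContDiff ℝ 1 fun x : Euc n => φ (incl x) := hφ.comp contDiff_incl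
  have hηc := hasCompactSupport_incl hc
  have hdη := memLp_pairDiff_of_contDiff hn hη hηc
  have hdv := hv.memLp_pairDiff hWm
  set μ := (interMeasure n).restrict (touching W) with hμ
  have hη0 : ∀ x ∉ W, φ (incl x) = 0 := fun x hx => image_eq_zero_of_notMem_tsupport fun h => by
    obtain h1 | h1 := hφW h
    · exact h1 (height_incl x)
    · exact hx (by simpa using h1)
  have e0 : pairDiff (fun x => v x + φ (incl x)) =
      pairDiff v + pairDiff (fun x => φ (incl x)) := by
    funext p
    simp only [pairDiff, Pi.add_apply]
    abel
  have hsum : MemLp (pairDiff fun x => v x + φ (incl x)) 2 μ := by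
    rw [e0]
    exact hdv.add (hdη.restrict _)
  -- pairs that do not touch `W` do not contribute to the perturbation
  have hzero : ∀ p ∉ touching W, pairDiff (fun x => φ (incl x)) p = 0 := fun p hp =>
    pairDiff_eq_zero_of_notMem hη0 hp
  have e1 : ∫ p, ‖pairDiff (fun x => v x + φ (incl x)) p‖ ^ 2 ∂μ =
      (∫ p, ‖pairDiff v p‖ ^ 2 ∂μ) +
      2 * (∫ p, inner ℝ (pairDiff (fun x => φ (incl x)) p) (pairDiff v p) ∂(interMeasure n)) +
      ∫ p, ‖pairDiff (fun x => φ (incl x)) p‖ ^ 2 ∂(interMeasure n) := by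
    rw [← setIntegral_eq_integral_of_forall_compl_eq_zero (s := touching W)
        (f := fun p => inner ℝ (pairDiff (fun x => φ (incl x)) p) (pairDiff v p))
        fun p hp => by rw [hzero p hp, inner_zero_left],
      ← setIntegral_eq_integral_of_forall_compl_eq_zero (s := touching W)
        (f := fun p => ‖pairDiff (fun x => φ (incl x)) p‖ ^ 2)
        fun p hp => by rw [hzero p hp, norm_zero, zero_pow two_ne_zero], ← hμ,
      ← integral_const_mul, ← integral_add, ← integral_add]
    · refine integral_congr_ae (Eventually.of_forall fun p => ?_)
      simp only [e0, Pi.add_apply]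
      rw [norm_add_sq_real, real_inner_comm]
    · exact (hdv.integrable_norm_pow two_ne_zero).add
        ((integrable_inner_of_memLp (hdη.restrict _) hdv).const_mul 2)
    · exact (hdη.restrict _).integrable_norm_pow two_ne_zero
    · exact hdv.integrable_norm_pow two_ne_zero
    · exact (integrable_inner_of_memLp (hdη.restrict _) hdv).const_mul 2
  have e2 := integral_inner_harmGrad hw hn hWo hfin hφ hc hφW
  rw [integral_finsetSum _ fun i _ => integrable_inner_harmGrad hw hWo hfin hφ hc hφW i] at e2
  have e3 := integral_pairDiff_sq_le hn hφ hc
  have key : gammaConst n / 4 * (∫ p, ‖pairDiff (fun x => v x + φ (incl x)) p‖ ^ 2 ∂μ) ≤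
      (fracEnergy v W).toReal +
      (∑ i, ∫ X in upperHalf n, inner ℝ (partialDeriv i φ X) (harmGrad v X i)) +
      1 / 2 * ∑ i, ∫ X in upperHalf n, ‖partialDeriv i φ X‖ ^ 2 := by
    rw [hv.toReal_fracEnergy hWm, e1, e2, ← hμ]
    linarith
  refine ⟨le_trans (mul_nonneg (by positivity) (integral_nonneg fun p => by positivity)) key, ?_⟩
  rw [← ofReal_integral_norm_sq hsum, ← ENNReal.ofReal_mul (by positivity)]
  exact ENNReal.ofReal_le_ofReal key

theorem IsHalfApprox.shift {f : Euc (n + 1) → Euc m} {G : Euc (n + 1) → Fin (n + 1) → Euc m}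
    {τ : Euc n → Euc m} {φ : ℕ → Euc (n + 1) → Euc m} (h : IsHalfApprox f G τ φ) (N : ℕ) :
    IsHalfApprox f G τ fun k => φ (k + N) where
  contDiff _ := h.contDiff _
  hasCompactSupport _ := h.hasCompactSupport _
  tendsto := h.tendsto.comp (tendsto_add_atTop_nat N)
  tendsto_grad i := (h.tendsto_grad i).comp (tendsto_add_atTop_nat N)
  tendsto_trace := h.tendsto_trace.comp (tendsto_add_atTop_nat N)

variable {W : Set (Euc n)} {Ω : Set (Euc (n + 1))} {v : Euc n → Euc m}

/-- The harmonic extension has class `H¹(Ω)`, because the closure of `Ω` is a compact subset of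
`slitSpace W`. -/
theorem memLp_harm_of_isAdmissible (hWo : IsOpen W) (hWb : Bornology.IsBounded W)
    (hΩ : IsAdmissible Ω) (hΩW : closure (flatBdry Ω) ⊆ W) (hv : MemHhat W v)
    (hw : Integrable (fun z => wt z • v z)) :
    MemLp (harmExt v) 2 (volume.restrict Ω) ∧
      (∀ i, MemLp (fun X => harmGrad v X i) 2 (volume.restrict Ω)) ∧
      IsWeakGrad Ω (harmExt v) (harmGrad v) := by
  have hfin := hv.lintegral_gagDens_ne_top hWo.measurableSet
  have hK : IsCompact (closure Ω) := hΩ.isBounded.isCompact_closure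
  have hKW := hΩ.closure_subset hΩW
  have hsub : Ω ⊆ closure Ω ∩ upperHalf n := subset_inter subset_closure hΩ.subset_upperHalf
  exact ⟨(memLp_harmExt hw hWo hfin (hv.memLp hWb) hK hKW).mono_measure
      (Measure.restrict_mono_set _ hsub),
    fun i => (memLp_harmGrad hw hWo hfin hK hKW i).mono_measure
      (Measure.restrict_mono_set _ hsub),
    (isWeakGrad_harmExt hw).mono hΩ.subset_upperHalf⟩

/-- A competitor differs from the harmonic extension by a map with smooth approximations that are
compactly supported up to the flat part of the boundary. -/
theorem exists_isHalfApprox_sub (hΩ : IsAdmissible Ω)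
    (hE : MemLp (harmExt v) 2 (volume.restrict Ω))
    (hG : ∀ i, MemLp (fun X => harmGrad v X i) 2 (volume.restrict Ω))
    (hGw : IsWeakGrad Ω (harmExt v) (harmGrad v))
    {u : Euc (n + 1) → Euc m} (hu : MemH1 Ω u) (hcd : CompactDiffUpToFlat Ω u (harmExt v)) :
    ∃ f τ φ, f =ᵐ[volume] (Ω.indicator fun X => u X - harmExt v X) ∧ MemLp f 2 ∧ MemLp τ 2 ∧
      IsHalfApprox f (fun X i => Ω.indicator (fun X => weakGrad Ω u X i - harmGrad v X i) X) τ φ ∧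
      ∀ k, tsupport (φ k) ⊆ interior (Ω ∪ (upperHalf n)ᶜ) := by
  obtain ⟨K, hK, hKΩ, hKd⟩ := hcd
  have hΩo := hΩ.isOpen
  have hΩm := hΩo.measurableSet
  have hΩH := hΩ.subset_upperHalf
  obtain ⟨hg, hgw⟩ := hu.isWeakGrad
  have hsub := IsWeakGrad.sub hΩm hgw hGw (integrableOn_of_memLp_two hu.1)
    (integrableOn_of_memLp_two hE) (fun i => integrableOn_of_memLp_two (hg i))
    (fun i => integrableOn_of_memLp_two (hG i))
  have hz : ∀ᵐ X, X ∈ Ω → X ∉ K → u X - harmExt v X = 0 := by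
    filter_upwards [hKd] with X hX h1 h2
    rw [hX h1 h2, sub_self]
  have hext := hsub.extend_zero hΩo hΩH (integrableOn_of_memLp_two (hu.1.sub hE))
    (fun i => integrableOn_of_memLp_two ((hg i).sub (hG i))) hK hKΩ hz
  set f := (Ω ∩ K).indicator fun X => u X - harmExt v X with hf
  have hfae : f =ᵐ[volume] (Ω.indicator fun X => u X - harmExt v X) := by
    filter_upwards [hz] with X hX
    by_cases h1 : X ∈ Ω
    · by_cases h2 : X ∈ K
      · simp [hf, h1, h2]
      · simp [hf, h1, h2, hX h1 h2]
    · simp [hf, h1]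
  have hf2 : MemLp f 2 :=
    ((memLp_indicator_iff_restrict hΩm).2 (hu.1.sub hE)).ae_eq hfae.symm
  obtain ⟨τ, φ, hτ, hφ, hs⟩ := exists_isHalfApprox hf2
    (fun i => (memLp_indicator_iff_restrict hΩm).2 ((hg i).sub (hG i)))
    (fun X hX => indicator_of_notMem (fun h => hX (hΩH h.1)) _)
    (fun X hX i => indicator_of_notMem (fun h => hX (hΩH h)) _) hext hK
    (fun X hX => indicator_of_notMem (fun h => hX h.2) _)
  obtain ⟨δ, hδ, hδK⟩ := hK.exists_cthickening_subset_open isOpen_interior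
    (hKΩ.trans (union_flatBdry_subset hΩo))
  obtain ⟨N, hN⟩ := eventually_atTop.1 (hs δ hδ)
  exact ⟨f, τ, fun k => φ (k + N), hfae, hf2, hτ, hφ.shift N,
    fun k => (hN _ (Nat.le_add_left N k)).trans hδK⟩

/-- Every competitor has a trace, and its extension by `v` satisfies the energy inequality. The trace
is `v` plus the boundary value `τ` of `u - harmExt v`; the energy inequality holds for `v` plus the
boundary values of smooth approximations, and passes to the limit by Fatou's lemma on the left and
by strong convergence of the gradients on the right. -/
theorem exists_extendedTrace (hn : 1 ≤ n) (hWo : IsOpen W) (hWb : Bornology.IsBounded W)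
    (hΩ : IsAdmissible Ω) (hΩW : closure (flatBdry Ω) ⊆ W) (hv : MemHhat W v)
    (hw : Integrable (fun z => wt z • v z))
    {u : Euc (n + 1) → Euc m} (hu : MemH1 Ω u) (hcd : CompactDiffUpToFlat Ω u (harmExt v)) :
    ∃ w, IsExtendedTrace Ω v u w ∧ MemHhat W w ∧
      (fracEnergy w W).toReal - (fracEnergy v W).toReal ≤
        dirichletEnergy Ω u - dirichletEnergy Ω (harmExt v) := by
  have hγ := gammaConst_pos n
  have hWm := hWo.measurableSet
  have hΩo := hΩ.isOpen
  have hΩm := hΩo.measurableSet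
  have hΩH := hΩ.subset_upperHalf
  have hΓm := (isOpen_flatBdry hΩo hΩH).measurableSet
  have hΓW : flatBdry Ω ⊆ W := subset_closure.trans hΩW
  have hvm := hv.aestronglyMeasurable
  have hfin := hv.lintegral_gagDens_ne_top hWm
  obtain ⟨hE, hG, hGw⟩ := memLp_harm_of_isAdmissible hWo hWb hΩ hΩW hv hw
  obtain ⟨hg, hgw⟩ := hu.isWeakGrad
  obtain ⟨f, τ, φ, hfae, hf2, hτ, hφ, hφs⟩ := exists_isHalfApprox_sub hΩ hE hG hGw hu hcd
  have hφd : ∀ k, ContDiff ℝ 1 (φ k) := fun k => contDiff_one_of_infty (hφ.contDiff k)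
  have hφi : ∀ k, Continuous fun x : Euc n => φ k (incl x) := fun k =>
    (hφd k).continuous.comp continuous_incl
  have hφ0 : ∀ k, ∀ x ∉ flatBdry Ω, φ k (incl x) = 0 := fun k x hx =>
    image_eq_zero_of_notMem_tsupport fun h => hx (mem_flatBdry_of_incl_mem hΩo hΩH (hφs k h))
  have hφΩ : ∀ k, ∀ X ∈ upperHalf n, X ∉ Ω → X ∉ tsupport (φ k) := fun k X hX hXΩ h =>
    hXΩ (interior_union_compl_inter_subset Ω ⟨hφs k h, hX⟩)
  have hφW : ∀ k, tsupport (φ k) ⊆ slitSpace W := fun k X hX => by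
    by_cases h0 : height X = 0
    · right
      have hX' : X = incl (horiz X) := by
        conv_lhs => rw [← join_horiz_height X, h0]
        rfl
      refine hΓW (mem_flatBdry_of_incl_mem hΩo hΩH ?_)
      rw [← hX']
      exact hφs k hX
    · exact Or.inl h0
  -- the trace of the difference vanishes outside the flat part
  have hτ0 : ∀ᵐ x, x ∉ flatBdry Ω → τ x = 0 := by
    have h1 : eLpNorm τ 2 (volume.restrict (flatBdry Ω)ᶜ) = 0 := by
      refine le_antisymm (ge_of_tendsto hφ.tendsto_trace (Eventually.of_forall fun k => ?_))
        zero_le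
      refine le_trans (le_of_eq ?_) (eLpNorm_mono_measure _
        (Measure.restrict_le_self (s := (flatBdry Ω)ᶜ)))
      rw [← eLpNorm_neg]
      refine eLpNorm_congr_ae ?_
      filter_upwards [ae_restrict_mem hΓm.compl] with x hx
      simp [hφ0 k x hx]
    have h2 := (eLpNorm_eq_zero_iff hτ.1.restrict two_ne_zero).1 h1
    exact (ae_restrict_iff' hΓm.compl).1 h2
  refine ⟨fun x => v x + τ x, ⟨⟨hu, ?_, ?_⟩, ?_⟩, ?_⟩
  · exact ((hv.memLp hWb).mono_measure (Measure.restrict_mono_set _ hΓW)).add (hτ.restrict _)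
  · -- smooth approximations of the harmonic extension near the closure of `Ω`
    obtain ⟨χ, hχ, hχc, hχs, hχ1, -⟩ := exists_smooth_cutoff hΩ.isBounded.isCompact_closure
      (isOpen_slitSpace hWo) (hΩ.closure_subset hΩW)
    obtain ⟨V, hV⟩ := exists_isHalfApprox_truncExt hw hWo hfin (hv.memLp hWb) hχ hχc hχs
    have hVd : ∀ k, ContDiff ℝ 1 (V k) := fun k => contDiff_one_of_infty (hV.contDiff k)
    obtain ⟨hT, hTG⟩ := memLp_truncExt hw hWo hfin (hv.memLp hWb) hχ hχc hχs
    have hχΩ : ∀ X ∈ Ω, χ X = 1 ∧ ∀ i, partialDeriv i χ X = 0 := fun X hX => by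
      have h1 : ∀ᶠ Y in 𝓝 X, χ Y = 1 :=
        hχ1.filter_mono (nhds_le_nhdsSet (subset_closure hX))
      refine ⟨h1.self_of_nhds, fun i => ?_⟩
      have : fderiv ℝ χ X = fderiv ℝ (fun _ => (1 : ℝ)) X := Filter.EventuallyEq.fderiv_eq h1
      simp [partialDeriv, this]
    have hres : (volume.restrict Ω : Measure (Euc (n + 1))) ≤ volume.restrict (upperHalf n) :=
      Measure.restrict_mono_set _ hΩH
    have hmono : ∀ {F : ℕ → Euc (n + 1) → Euc m},
        Tendsto (fun k => eLpNorm (F k) 2 (volume.restrict (upperHalf n))) atTop (𝓝 0) →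
        Tendsto (fun k => eLpNorm (F k) 2 (volume.restrict Ω)) atTop (𝓝 0) := fun h =>
      tendsto_of_tendsto_of_tendsto_of_le_of_le tendsto_const_nhds h (fun k => zero_le)
        fun k => eLpNorm_mono_measure _ hres
    refine ⟨fun k X => V k X + φ k X, fun k => (hV.contDiff k).add (hφ.contDiff k), ?_,
      fun i => ?_, ?_⟩
    · refine (tendsto_eLpNorm_add
        (fun k => (hVd k).continuous.aestronglyMeasurable.sub hT.1.restrict)
        (fun k => (hφd k).continuous.aestronglyMeasurable.sub hf2.1.restrict)
        (hmono hV.tendsto) (hmono hφ.tendsto)).congr fun k => eLpNorm_congr_ae ?_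
      filter_upwards [ae_restrict_of_ae hfae, ae_restrict_mem hΩm] with X h1 hX
      simp only [Pi.sub_apply]
      rw [h1, indicator_of_mem hX, truncExt, indicator_of_mem (hΩH hX), (hχΩ X hX).1, one_smul]
      abel
    · have hGi : AEStronglyMeasurable
          (Ω.indicator (fun X => weakGrad Ω u X i - harmGrad v X i)) volume :=
        ((memLp_indicator_iff_restrict hΩm).2 ((hg i).sub (hG i))).1
      refine (tendsto_eLpNorm_add
        (fun k => (continuous_partialDeriv (hVd k) i).aestronglyMeasurable.sub (hTG i).1.restrict)
        (fun k => (continuous_partialDeriv (hφd k) i).aestronglyMeasurable.sub hGi.restrict)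
        (hmono (hV.tendsto_grad i)) (hmono (hφ.tendsto_grad i))).congr
        fun k => eLpNorm_congr_ae ?_
      filter_upwards [ae_restrict_mem hΩm] with X hX
      simp only [Pi.sub_apply]
      rw [indicator_of_mem hX, truncGrad, indicator_of_mem (hΩH hX), (hχΩ X hX).1,
        (hχΩ X hX).2, one_smul, zero_smul, add_zero, partialDeriv_add (hVd k) (hφd k)]
      abel
    · have hVi : ∀ k, Continuous fun x : Euc n => V k (incl x) := fun k =>
        (hVd k).continuous.comp continuous_incl
      have hχv : AEStronglyMeasurable fun x : Euc n => χ (incl x) • v x :=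
        (hχ.continuous.comp continuous_incl).aestronglyMeasurable.smul hvm
      have hmono' : ∀ {F : ℕ → Euc n → Euc m},
          Tendsto (fun k => eLpNorm (F k) 2) atTop (𝓝 0) →
          Tendsto (fun k => eLpNorm (F k) 2 (volume.restrict (flatBdry Ω))) atTop (𝓝 0) := fun h =>
        tendsto_of_tendsto_of_tendsto_of_le_of_le tendsto_const_nhds h (fun k => zero_le)
          fun k => eLpNorm_mono_measure _ Measure.restrict_le_self
      refine (tendsto_eLpNorm_add
        (fun k => ((hVi k).aestronglyMeasurable.sub hχv).restrict)
        (fun k => ((hφi k).aestronglyMeasurable.sub hτ.1).restrict)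
        (hmono' hV.tendsto_trace) (hmono' hφ.tendsto_trace)).congr fun k => eLpNorm_congr_ae ?_
      filter_upwards [ae_restrict_mem hΓm] with x hx
      have h1 : χ (incl x) = 1 := hχ1.self_of_nhdsSet _ (frontier_subset_closure hx.1)
      simp only [Pi.sub_apply]
      rw [h1, one_smul]
      abel
  · filter_upwards [hτ0] with x h1 h2
    rw [h1 h2, add_zero]
  -- the energy inequality, in the limit of the smooth approximations
  · set e : ℕ → ℝ := fun k => (fracEnergy v W).toReal +
      (∑ i, ∫ X in upperHalf n, inner ℝ (partialDeriv i (φ k) X) (harmGrad v X i)) +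
      1 / 2 * ∑ i, ∫ X in upperHalf n, ‖partialDeriv i (φ k) X‖ ^ 2 with he
    have hΩint : ∀ k i, ∀ h : Euc m → Euc (n + 1) → ℝ, (∀ X, h 0 X = 0) →
        ∫ X in upperHalf n, h (partialDeriv i (φ k) X) X = ∫ X in Ω, h (partialDeriv i (φ k) X) X := by
      intro k i h h0
      refine setIntegral_eq_of_subset_of_forall_sdiff_eq_zero measurableSet_upperHalf hΩH
        fun X hX => ?_
      rw [image_eq_zero_of_notMem_tsupport fun h' =>
        hφΩ k X hX.1 hX.2 (tsupport_partialDeriv_subset _ i h'), h0]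
    have hdiff : ∀ i, MemLp (fun X => weakGrad Ω u X i - harmGrad v X i) 2 (volume.restrict Ω) :=
      fun i => (hg i).sub (hG i)
    have hconv : ∀ i, Tendsto (fun k => eLpNorm (fun X => partialDeriv i (φ k) X -
        (weakGrad Ω u X i - harmGrad v X i)) 2 (volume.restrict Ω)) atTop (𝓝 0) := fun i => by
      refine tendsto_of_tendsto_of_tendsto_of_le_of_le tendsto_const_nhds (hφ.tendsto_grad i)
        (fun k => zero_le) fun k => ?_
      refine le_trans (le_of_eq (eLpNorm_congr_ae ?_)) (eLpNorm_mono_measure _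
        (Measure.restrict_mono_set _ hΩH))
      filter_upwards [ae_restrict_mem hΩm] with X hX
      rw [indicator_of_mem hX]
    have hpm : ∀ i k, MemLp (partialDeriv i (φ k)) 2 (volume.restrict Ω) := fun i k =>
      memLp_partialDeriv (hφd k) (hφ.hasCompactSupport k) i _
    have hlim : Tendsto e atTop (𝓝 ((fracEnergy v W).toReal +
        (dirichletEnergy Ω u - dirichletEnergy Ω (harmExt v)))) := by
      have t1 : ∀ i, Tendsto (fun k => ∫ X in upperHalf n,
          inner ℝ (partialDeriv i (φ k) X) (harmGrad v X i)) atTop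
          (𝓝 (∫ X in Ω, inner ℝ (weakGrad Ω u X i - harmGrad v X i) (harmGrad v X i))) := fun i => by
        simp only [fun k => hΩint k i (fun a X => inner ℝ a (harmGrad v X i))
          fun X => inner_zero_left _]
        exact tendsto_integral_inner (hdiff i) (hG i) (hpm i) (fun _ => hG i) (hconv i) (by simp)
      have t2 : ∀ i, Tendsto (fun k => ∫ X in upperHalf n, ‖partialDeriv i (φ k) X‖ ^ 2) atTop
          (𝓝 (∫ X in Ω, ‖weakGrad Ω u X i - harmGrad v X i‖ ^ 2)) := fun i => by
        simp only [fun k => hΩint k i (fun a X => ‖a‖ ^ 2) fun X => by simp]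
        simp only [← real_inner_self_eq_norm_sq]
        exact tendsto_integral_inner (hdiff i) (hdiff i) (hpm i) (hpm i) (hconv i) (hconv i)
      have t3 := (tendsto_const_nhds (x := (fracEnergy v W).toReal)).add
        (tendsto_finsetSum Finset.univ fun i _ => t1 i) |>.add
        ((tendsto_finsetSum Finset.univ fun i _ => t2 i).const_mul (1 / 2))
      -- `|∇u|² - |∇vᵉ|² = 2 ⟨∇(u - vᵉ), ∇vᵉ⟩ + |∇(u - vᵉ)|²`
      convert t3 using 2
      rw [dirichletEnergy_eq hΩo hu.1 hg hgw, dirichletEnergy_eq hΩo hE hG hGw, add_assoc,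
        ← mul_sub, ← Finset.sum_sub_distrib, Finset.mul_sum, Finset.mul_sum,
        ← Finset.sum_add_distrib]
      congr 1
      refine Finset.sum_congr rfl fun i _ => ?_
      have i1 := (hg i).integrable_norm_pow two_ne_zero
      have i2 := (hG i).integrable_norm_pow two_ne_zero
      have i3 := (hdiff i).integrable_norm_pow two_ne_zero
      have i4 := integrable_inner_of_memLp (hdiff i) (hG i)
      rw [← integral_sub i1 i2, ← integral_const_mul, ← integral_const_mul,
        ← integral_add i4 (i3.const_mul _)]
      refine integral_congr_ae (Eventually.of_forall fun X => ?_)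
      simp only
      rw [norm_sub_sq_real, inner_sub_left, real_inner_self_eq_norm_sq]
      ring
    have hsm := fun k => lintegral_pairDiff_add_le hn hWo hv hw (hφd k) (hφ.hasCompactSupport k)
      (hφW k)
    have hγ4 : ENNReal.ofReal (gammaConst n / 4) ≠ 0 := by simpa using hγ
    -- lower semicontinuity of the interaction energy
    have hfat := lintegral_pairDiff_le_of_tendsto (u := fun x => v x + τ x)
      (uk := fun k x => v x + φ k (incl x)) (hvm.add hτ.1)
      (fun k => hvm.add (hφi k).aestronglyMeasurable)
      (hφ.tendsto_trace.congr fun k => by simp) (touching W)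
      (a := fun k => (ENNReal.ofReal (gammaConst n / 4))⁻¹ * ENNReal.ofReal (e k))
      (ENNReal.Tendsto.const_mul (ENNReal.tendsto_ofReal hlim) (Or.inr (by simpa using hγ)))
      fun k => by
        rw [← ENNReal.mul_le_iff_le_inv hγ4 ENNReal.ofReal_ne_top]
        exact (hsm k).2
    rw [← ENNReal.mul_le_iff_le_inv hγ4 ENNReal.ofReal_ne_top,
      ← fracEnergy_eq (v := fun x => v x + τ x) (hvm.add hτ.1) hWm] at hfat
    have hmem : MemHhat W fun x => v x + τ x :=
      ⟨fun K hK => (hv.1 K hK).add (hτ.restrict _), hfat.trans_lt ENNReal.ofReal_lt_top⟩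
    refine ⟨hmem, ?_⟩
    have hpos : 0 ≤ (fracEnergy v W).toReal +
        (dirichletEnergy Ω u - dirichletEnergy Ω (harmExt v)) :=
      ge_of_tendsto hlim (Eventually.of_forall fun k => (hsm k).1)
    have := ENNReal.toReal_mono ENNReal.ofReal_ne_top hfat
    rw [ENNReal.toReal_ofReal hpos] at this
    linarith

end Comparison

end HalfLap

theorem mainTheorem12 {n m : ℕ} (hn : 1 ≤ n)
    (W : Set (HalfLap.Euc n)) (hWo : IsOpen W) (hWb : Bornology.IsBounded W)
    (Ω : Set (HalfLap.Euc (n + 1))) (hΩ : HalfLap.IsAdmissible Ω)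
    (hΩW : closure (HalfLap.flatBdry Ω) ⊆ W)
    (v : HalfLap.Euc n → HalfLap.Euc m) (hv : HalfLap.MemHhat W v) :
    -- the harmonic extension is well defined in the half-space and has class `H¹(Ω)`
    (∀ x ∈ HalfLap.upperHalf n, Integrable (fun z => HalfLap.poissonKernel x z • v z)) ∧
    HalfLap.MemH1 Ω (HalfLap.harmExt v) ∧
    -- every competitor has a trace, its extension by `v` has finite energy, and the energy
    -- inequality holds
    (∀ u : HalfLap.Euc (n + 1) → HalfLap.Euc m, HalfLap.MemH1 Ω u →
      HalfLap.CompactDiffUpToFlat Ω u (HalfLap.harmExt v) →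
      (∃ w, HalfLap.IsExtendedTrace Ω v u w) ∧
      ∀ w, HalfLap.IsExtendedTrace Ω v u w →
        HalfLap.MemHhat W w ∧
        (HalfLap.fracEnergy w W).toReal - (HalfLap.fracEnergy v W).toReal ≤
          HalfLap.dirichletEnergy Ω u - HalfLap.dirichletEnergy Ω (HalfLap.harmExt v)) ∧
    -- local minimality of the extension among competitors with trace `v`
    (∀ u : HalfLap.Euc (n + 1) → HalfLap.Euc m, HalfLap.MemH1 Ω u →
      HalfLap.CompactDiffUpToFlat Ω u (HalfLap.harmExt v) →
      HalfLap.IsFlatTrace Ω u v →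
      HalfLap.dirichletEnergy Ω (HalfLap.harmExt v) ≤ HalfLap.dirichletEnergy Ω u) ∧
    -- transfer of minimality, for any constraint `C` and any additional energy term `F`
    (∀ (C : Set (HalfLap.Euc n → HalfLap.Euc m)) (F : (HalfLap.Euc n → HalfLap.Euc m) → ℝ),
      (∀ w ∈ C, HalfLap.MemHhat W w → HalfLap.CompactDiffIn W w v →
        (HalfLap.fracEnergy v W).toReal + F v ≤ (HalfLap.fracEnergy w W).toReal + F w) →
      ∀ u : HalfLap.Euc (n + 1) → HalfLap.Euc m, HalfLap.MemH1 Ω u →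
        HalfLap.CompactDiffUpToFlat Ω u (HalfLap.harmExt v) →
        ∀ w ∈ C, HalfLap.IsExtendedTrace Ω v u w →
          HalfLap.dirichletEnergy Ω (HalfLap.harmExt v) + F v ≤
            HalfLap.dirichletEnergy Ω u + F w) := by
  have hWm := hWo.measurableSet
  have hvm := hv.aestronglyMeasurable
  -- `W` is nonempty because it contains the flat part of the boundary
  have hW0 : volume W ≠ 0 :=
    (hWo.measure_pos volume (hΩ.flat_nonempty.mono (subset_closure.trans hΩW))).ne'
  have hw := HalfLap.integrable_wt_smul hvm hW0 (hv.lintegral_gagDens_ne_top hWm)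
  obtain ⟨hE, hG, hGw⟩ := HalfLap.memLp_harm_of_isAdmissible hWo hWb hΩ hΩW hv hw
  have hΩo := hΩ.isOpen
  have hΩH := hΩ.subset_upperHalf
  have main : ∀ u : HalfLap.Euc (n + 1) → HalfLap.Euc m, HalfLap.MemH1 Ω u →
      HalfLap.CompactDiffUpToFlat Ω u (HalfLap.harmExt v) →
      (∃ w, HalfLap.IsExtendedTrace Ω v u w) ∧
      ∀ w, HalfLap.IsExtendedTrace Ω v u w →
        HalfLap.MemHhat W w ∧
        (HalfLap.fracEnergy w W).toReal - (HalfLap.fracEnergy v W).toReal ≤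
          HalfLap.dirichletEnergy Ω u - HalfLap.dirichletEnergy Ω (HalfLap.harmExt v) := by
    intro u hu hcd
    obtain ⟨w₀, h₀, hmem, hle⟩ := HalfLap.exists_extendedTrace hn hWo hWb hΩ hΩW hv hw hu hcd
    refine ⟨⟨w₀, h₀⟩, fun w h => ?_⟩
    -- any other extended trace agrees with `w₀` almost everywhere
    have hae : w =ᵐ[volume] w₀ := by
      filter_upwards [h.1.ae_eq hΩo hΩH h₀.1, h.2, h₀.2] with x h1 h2 h3
      by_cases hx : x ∈ HalfLap.flatBdry Ω
      · exact h1 hx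
      · rw [h2 hx, h3 hx]
    have hfe := HalfLap.fracEnergy_congr hmem.aestronglyMeasurable hae hWm
    refine ⟨⟨fun K hK => (hmem.1 K hK).ae_eq (ae_restrict_of_ae hae.symm), ?_⟩, ?_⟩
    · rw [hfe]
      exact hmem.2
    · rw [hfe]
      exact hle
  refine ⟨fun x hx => ?_, ⟨hE, _, hG, hGw⟩, main, fun u hu hcd htr => ?_,
    fun C F hC u hu hcd w hwC hwt => ?_⟩
  · simp only [HalfLap.poissonKernel_eq]
    exact HalfLap.integrable_pker_smul hw hx
  -- if the trace is `v`, then `v` itself is an extended trace and the fractional energies cancel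
  · have := ((main u hu hcd).2 v ⟨htr, Eventually.of_forall fun _ _ => rfl⟩).2
    linarith
  -- an extended trace differs from `v` only in the closure of the flat part, a compact subset of `W`
  · obtain ⟨hmem, hle⟩ := (main u hu hcd).2 w hwt
    have hcpt : IsCompact (closure (HalfLap.flatBdry Ω)) :=
      (hWb.subset (subset_closure.trans hΩW)).isCompact_closure
    have := hC w hwC hmem ⟨_, hcpt, hΩW, by
      filter_upwards [hwt.2] with x hx hx' using hx fun h => hx' (subset_closure h)⟩
    linarith
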